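/- Let $(\mathcal S,\mathcal B)$ be a measurable space and $P$ a Markov transition kernel on it. Let $C\in\mathcal B$, let $\nu$ be a probability measure on $\mathcal S$, let $V:\mathcal S\to[1,\infty)$ be measurable, and let $0<b<1$, $0<\lambda<1$, $K<\infty$ be constants such that 1. (minorization with constant $1$, so that $C$ is an atom) $P(x,A)\ge\nu(A)$ for all $x\in C$, $A\in\mathcal B$; 2. (drift) $PV(x)\le\lambda V(x)$ for $x\notin C$ and $PV(x)\le K$ for $x\in C$; 3. (strong aperiodicity) $\nu(C)\ge b$. Let $B_V$ be the Banach space of complex-valued measurable functions $g$ on $\mathcal S$ with $\|g\|_V:=\sup_x|g(x)|/V(x)<\infty$. Then the chain is geometrically ergodic: there is a unique invariant probability measure $\pi$, $\int V\,d\pi<\infty$, the operator $P-1\otimes\pi:\ g\mapsto Pg-\int g\,d\pi$ is bounded on $B_V$, its spectral radius $\rho_V$ is $<1$, and $M_V(r)<\infty$ for some $r>1$. Here, for $r>1$, $M_V(r)\in[0,\infty]$ is the least constant with $$\Big\|P^ng-\int g\,d\pi\Big\|_V\le M_V(r)\,r^{-n}\,\|g\|_V\qquad(g\in B_V,\ n\ge1).$$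 Moreover, put $R=\lambda^{-1}$, $L=\lambda^{-1}K$, $N=\frac{L-1}{R-1}$ and, for $\alpha>0$, $$D(\alpha)=\frac{\big|1+\frac b{1-b}(1-e^{i\pi/(1+\alpha)})\big|-1}{|1-e^{i\pi/(1+\alpha)}|},\qquad \kappa(\alpha)=\frac{\log\frac{N-1}{(1-b)\alpha}}{\log R},\qquad \alpha_0=\frac{\log\frac{L-bR}{(1-b)R}}{\log R}.$$ For each of the two choices of $r_0$ and $K_0$ below, $r_0>1$, $\rho_V\le r_0^{-1}$, and for all $1<r<r_0$ $$M_V(r)\le \frac{r\lambda}{1-r\lambda}+\frac{r\lambda(K-\lambda)}{(1-\lambda)^2}+\frac{r\lambda(K-1)}{(1-\lambda)(1-r\lambda)}+\frac{r(K-r\lambda)}{1-r\lambda}\,K_0(r).$$ (a) ($\pi(C)$ known.) If $\pi(C)<1$: with $\alpha=\frac{\pi(C)^{-1}-1}{1-b}$, $$r_0=\min\Big\{R,\Big(1+\frac{D(\alpha)}\alpha\Big)^{1/\kappa(\alpha)}\Big\},\qquad K_0(r)=\frac{\pi(C)\,(r^{\kappa(\alpha)}-1)}{(r-1)(\alpha^{-1}D(\alpha)-r^{\kappa(\alpha)}+1)}.$$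 (b) ($\pi(C)$ unknown.) If $\alpha_0\ge1$, which always holds when $b=\nu(C)$: $$r_0=\min\Big\{R,\min_{1\le\alpha\le\alpha_0}\Big(1+\frac{D(\alpha)}\alpha\Big)^{1/\kappa(\alpha)}\Big\},\qquad K_0(r)=\max_{1\le\alpha\le\alpha_0}\frac{r^{\kappa(\alpha)}-1}{(r-1)(\alpha^{-1}D(\alpha)-r^{\kappa(\alpha)}+1)}.$$ -/

import Mathlib

open MeasureTheory ProbabilityTheory
open scoped ENNReal NNReal

noncomputable section

/-- A measurable weight `V : S → [1, ∞)`. -/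
structure Weight (S : Type*) [MeasurableSpace S] where
  /-- the underlying function -/
  toFun : S → ℝ
  measurable_toFun : Measurable toFun
  one_le_toFun : ∀ x, 1 ≤ toFun x

instance {S : Type*} [MeasurableSpace S] : CoeFun (Weight S) (fun _ => S → ℝ) :=
  ⟨Weight.toFun⟩

theorem Weight.pos {S : Type*} [MeasurableSpace S] (V : Weight S) (x : S) : 0 < V x :=
  lt_of_lt_of_le one_pos (V.one_le_toFun x)

/-- The measurable functions `f : S → ℂ` with `sup_x |f x| / V x < ∞`, as a linear subspace. -/
def boundedBy {S : Type*} [MeasurableSpace S] (V : Weight S) : Submodule ℂ (S → ℂ) where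
  carrier := {f | Measurable f ∧ BddAbove (Set.range fun x => ‖f x‖ / V x)}
  zero_mem' := by
    refine ⟨measurable_const, 0, ?_⟩
    rintro _ ⟨x, rfl⟩
    simp
  add_mem' := by
    rintro f g ⟨hf, A, hA⟩ ⟨hg, B, hB⟩
    refine ⟨hf.add hg, A + B, ?_⟩
    rintro _ ⟨x, rfl⟩
    have h1 : ‖f x‖ / V x ≤ A := hA ⟨x, rfl⟩
    have h2 : ‖g x‖ / V x ≤ B := hB ⟨x, rfl⟩
    have h3 : ‖f x + g x‖ / V x ≤ (‖f x‖ + ‖g x‖) / V x :=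
      div_le_div_of_nonneg_right (norm_add_le _ _) (V.pos x).le
    rw [add_div] at h3
    exact h3.trans (add_le_add h1 h2)
  smul_mem' := by
    rintro c f ⟨hf, A, hA⟩
    refine ⟨hf.const_smul c, ‖c‖ * A, ?_⟩
    rintro _ ⟨x, rfl⟩
    have h1 : ‖f x‖ / V x ≤ A := hA ⟨x, rfl⟩
    have h2 : ‖(c • f) x‖ / V x = ‖c‖ * (‖f x‖ / V x) := by
      simp [mul_div_assoc]
    change ‖(c • f) x‖ / V x ≤ _
    rw [h2]
    exact mul_le_mul_of_nonneg_left h1 (norm_nonneg c)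

/-- The space `B_V` of measurable functions `f : S → ℂ` with finite norm
`‖f‖_V = sup_x |f x| / V x`. -/
def BV {S : Type*} [MeasurableSpace S] (V : Weight S) : Type _ := boundedBy V

namespace BV

variable {S : Type*} [MeasurableSpace S] {V : Weight S}

instance : AddCommGroup (BV V) := inferInstanceAs (AddCommGroup (boundedBy V))

instance : Module ℂ (BV V) := inferInstanceAs (Module ℂ (boundedBy V))

instance : CoeFun (BV V) (fun _ => S → ℂ) := ⟨fun f => f.1⟩

instance : Norm (BV V) := ⟨fun f => ⨆ x, ‖f x‖ / V x⟩

theorem norm_def (f : BV V) : ‖f‖ = ⨆ x, ‖f x‖ / V x := rfl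

theorem measurable (f : BV V) : Measurable (f : S → ℂ) := f.2.1

theorem norm_apply_le (f : BV V) (x : S) : ‖f x‖ ≤ ‖f‖ * V x :=
  (div_le_iff₀ (V.pos x)).1 (le_ciSup f.2.2 x)

theorem norm_nonneg' (f : BV V) : 0 ≤ ‖f‖ :=
  Real.iSup_nonneg fun x => div_nonneg (norm_nonneg _) (V.pos x).le

theorem norm_le_of_forall (f : BV V) {A : ℝ} (hA : 0 ≤ A) (h : ∀ x, ‖f x‖ ≤ A * V x) : ‖f‖ ≤ A :=
  Real.iSup_le (fun x => (div_le_iff₀ (V.pos x)).2 (h x)) hA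

theorem core (V : Weight S) : NormedSpace.Core ℂ (BV V) where
  norm_nonneg := norm_nonneg'
  norm_smul c f := by
    rw [norm_def, norm_def, Real.mul_iSup_of_nonneg (norm_nonneg c)]
    refine iSup_congr fun x => ?_
    have h : (c • f : BV V) x = c * f x := rfl
    rw [h, norm_mul, mul_div_assoc]
  norm_triangle f g := by
    refine norm_le_of_forall _ (add_nonneg f.norm_nonneg' g.norm_nonneg') fun x => ?_
    have h : (f + g : BV V) x = f x + g x := rfl
    rw [h, add_mul]
    exact (norm_add_le _ _).trans (add_le_add (f.norm_apply_le x) (g.norm_apply_le x))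
  norm_eq_zero_iff f := by
    constructor
    · intro hf
      apply Subtype.ext
      funext x
      have h := f.norm_apply_le x
      rw [hf, zero_mul] at h
      exact norm_le_zero_iff.1 h
    · rintro rfl
      refine le_antisymm (norm_le_of_forall _ le_rfl fun x => ?_) (norm_nonneg' _)
      have h : (0 : BV V) x = 0 := rfl
      simp [h]

instance : NormedAddCommGroup (BV V) := NormedAddCommGroup.ofCore (core V)

instance : NormedSpace ℂ (BV V) := NormedSpace.ofCore (core V)

end BV

/-- `M_V(r)`: the optimal (least) constant `M ∈ [0, ∞]` such that
`‖Pⁿ g - ∫ g dπ‖_V ≤ M r⁻ⁿ ‖g‖_V` for all `g ∈ B_V` and `n ≥ 1`. -/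
def optimalConst {S : Type*} [MeasurableSpace S] (P : Kernel S S) (π : Measure S) (V : Weight S)
    (r : ℝ) : ℝ≥0∞ :=
  sInf {M : ℝ≥0∞ | ∀ n : ℕ, 1 ≤ n → ∀ g : BV V, ∀ x : S,
    ‖(∫ y, g y ∂((P ^ n) x)) - ∫ y, g y ∂π‖ₑ ≤ M * ENNReal.ofReal ((r ^ n)⁻¹ * ‖g‖ * V x)}

/-- `IsCentered P π V T`: the bounded operator `T` on `B_V` is `P - 1 ⊗ π`. -/
def IsCentered {S : Type*} [MeasurableSpace S] (P : Kernel S S) (π : Measure S) (V : Weight S)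
    (T : BV V →L[ℂ] BV V) : Prop :=
  ∀ (g : BV V) (x : S), (T g) x = (∫ y, g y ∂(P x)) - ∫ y, g y ∂π

/-- `D(α) = (|1 + b/(1-b) (1 - e^{iπ/(1+α)})| - 1) / |1 - e^{iπ/(1+α)}|`. -/
def kendallD (b α : ℝ) : ℝ :=
  (‖1 + (b : ℂ) / (1 - b) * (1 - Complex.exp (Complex.I * Real.pi / (1 + α)))‖ - 1) /
    ‖1 - Complex.exp (Complex.I * Real.pi / (1 + α))‖

/-- `κ(α) = log ((N - 1) / ((1 - b) α)) / log R`, where `N = (L - 1) / (R - 1)`. -/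
def kendallKappa (b R L α : ℝ) : ℝ :=
  Real.log (((L - 1) / (R - 1) - 1) / ((1 - b) * α)) / Real.log R

/-- `α₀ = log ((L - b R) / ((1 - b) R)) / log R`. -/
def kendallAlpha0 (b R L : ℝ) : ℝ :=
  Real.log ((L - b * R) / ((1 - b) * R)) / Real.log R

/-- `(1 + D(α) / α) ^ (1 / κ(α))`. -/
def kendallRadius (b R L α : ℝ) : ℝ :=
  (1 + kendallD b α / α) ^ (1 / kendallKappa b R L α)

/-- `(r ^ κ(α) - 1) / ((r - 1) (D(α) / α - r ^ κ(α) + 1))`. -/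
def kendallBound (b R L α r : ℝ) : ℝ :=
  (r ^ kendallKappa b R L α - 1) /
    ((r - 1) * (kendallD b α / α - r ^ kendallKappa b R L α + 1))

/-- `r₀` when `π(C)` is known: `min {R, (1 + D(α) / α) ^ (1 / κ(α))}` with
`α = (π(C)⁻¹ - 1) / (1 - b)`. -/
def r0Known (b R L p : ℝ) : ℝ :=
  min R (kendallRadius b R L ((p⁻¹ - 1) / (1 - b)))

/-- `K₀(r)` when `p = π(C)` is known. -/
def K0Known (b R L p r : ℝ) : ℝ :=
  p * kendallBound b R L ((p⁻¹ - 1) / (1 - b)) r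

/-- `r₀` when `π(C)` is unknown: the minimum over `α ∈ [1, α₀]`. -/
def r0 (b R L : ℝ) : ℝ :=
  min R (sInf (kendallRadius b R L '' Set.Icc 1 (kendallAlpha0 b R L)))

/-- `K₀(r)` when `π(C)` is unknown: the maximum over `α ∈ [1, α₀]`. -/
def K0 (b R L r : ℝ) : ℝ :=
  sSup ((fun α => kendallBound b R L α r) '' Set.Icc 1 (kendallAlpha0 b R L))

/-- The bound on `M_V(r)` in terms of `r`, `λ` (written `l`), `K` and a value `k` of `K₀(r)`. -/
def MVBound (l K k r : ℝ) : ℝ :=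
  r * l / (1 - r * l) + r * l * (K - l) / (1 - l) ^ 2 +
    r * l * (K - 1) / ((1 - l) * (1 - r * l)) + r * (K - r * l) / (1 - r * l) * k

end

/-! Every visit to the atom `C` is followed by a fresh start from `ν`, so the chain is controlled by
a renewal sequence and by its excursions away from `C`. Let c_n (`returnTail`) be the probability
that the chain started from `ν` avoids `C` at times 0, ..., n-1. Then c_0 = 1, c decreases and c_1 =
1 - ν(C) ≤ 1 - b. Let u_0 = 1 and let u_{n+1} be the probability of being in `C` at time n; the
index is shifted because `ν` is the law one step after a visit. Total mass in the last exit
decomposition gives the renewal equation u * c = 1. The invariant law is the normalized occupation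
measure of one excursion, and π(C) = (∑ c_n)⁻¹.

Renewal rate. The generating function of u_n - π(C) is π(C) times that of the tails of c, divided by
c(z) = ∑ c_n zⁿ. Cauchy's estimate on |z| = r turns a lower bound for |c(z)| into a rate
(`abs_renewal_sub_mul_pow_le`). Write ∑_{n≥1} c_n = (1-b)α. On the unit circle |c(z)| ≥ (1-b)D(α)
(`mul_kendallD_le_norm_genFun`). For |arg z| ≥ π/(1+α) this follows from (1-z)c(z) being 1 - bz
minus a power series with nonnegative coefficients of sum 1-b. For smaller arguments one tests c(z)
against a well chosen phase and sums by parts. Moving from the unit circle to |z| ≤ r changes c by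
at most (1-b)α(r^κ - 1), by Hölder interpolation between radius 1 and R = 1/λ, where the drift
condition bounds the sum. This gives `abs_renewal_sub_le_kendallBound`.

Transfer to `B_V`. Last exit decomposition from `ν` and first entrance decomposition from x express
Pⁿg - π(g) through u_n - π(C) and integrals over excursions. The drift condition applied to V - 1
bounds the latter and produces the four terms of `MVBound` (`norm_integral_pow_sub_le`).

Unknown π(C). The drift bound forces α ≤ α₀ (`le_kendallAlpha0_of_tsum_eq`). If α < 1, an elementary
induction (`abs_renewal_sub_le_of_tsum_lt_one`) gives a rate that the value of `kendallBound` at 1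
dominates. -/

/-! ### Generating functions of nonnegative sequences and Cauchy's estimate. -/

/-- The generating function `∑ cₙ zⁿ` of a real sequence. -/
noncomputable def genFun (c : ℕ → ℝ) (z : ℂ) : ℂ := ∑' n, (c n : ℂ) * z ^ n

theorem norm_genFun_term {c : ℕ → ℝ} (hc : ∀ n, 0 ≤ c n) (z : ℂ) (n : ℕ) :
    ‖(c n : ℂ) * z ^ n‖ = c n * ‖z‖ ^ n := by
  rw [norm_mul, norm_pow, Complex.norm_real, Real.norm_of_nonneg (hc n)]

theorem summable_mul_pow_of_le {c : ℕ → ℝ} (hc : ∀ n, 0 ≤ c n) {r R : ℝ} (hr : 0 ≤ r) (hrR : r ≤ R)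
    (h : Summable fun n => c n * R ^ n) : Summable fun n => c n * r ^ n :=
  h.of_nonneg_of_le (fun n => mul_nonneg (hc n) (pow_nonneg hr n))
    fun n => mul_le_mul_of_nonneg_left (pow_le_pow_left₀ hr hrR n) (hc n)

theorem summable_genFun {c : ℕ → ℝ} (hc : ∀ n, 0 ≤ c n) {R : ℝ} (h : Summable fun n => c n * R ^ n)
    {z : ℂ} (hz : ‖z‖ ≤ R) : Summable fun n => ‖(c n : ℂ) * z ^ n‖ := by
  simp_rw [norm_genFun_term hc]
  exact summable_mul_pow_of_le hc (norm_nonneg z) hz h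

theorem norm_genFun_le {c : ℕ → ℝ} (hc : ∀ n, 0 ≤ c n) {r : ℝ} (h : Summable fun n => c n * r ^ n)
    {z : ℂ} (hz : ‖z‖ ≤ r) : ‖genFun c z‖ ≤ ∑' n, c n * r ^ n := by
  have hs := summable_genFun hc h hz
  refine (norm_tsum_le_tsum_norm hs).trans (hs.tsum_le_tsum (fun n => ?_) h)
  rw [norm_genFun_term hc]
  exact mul_le_mul_of_nonneg_left (pow_le_pow_left₀ (norm_nonneg z) hz n) (hc n)

theorem genFun_ofReal {c : ℕ → ℝ} (r : ℝ) : genFun c r = ((∑' n, c n * r ^ n : ℝ) : ℂ) := by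
  rw [genFun, Complex.ofReal_tsum]
  simp

theorem differentiableOn_genFun {c : ℕ → ℝ} (hc : ∀ n, 0 ≤ c n) {R : ℝ}
    (h : Summable fun n => c n * R ^ n) : DifferentiableOn ℂ (genFun c) (Metric.ball 0 R) := by
  refine Complex.differentiableOn_tsum_of_summable_norm h (fun n => ?_) Metric.isOpen_ball
    fun n z hz => ?_
  · fun_prop
  · rw [norm_genFun_term hc]
    have : ‖z‖ < R := by simpa using hz
    exact mul_le_mul_of_nonneg_left (pow_le_pow_left₀ (norm_nonneg z) this.le n) (hc n)

/-- Cauchy's estimate for the coefficients of a power series that converges on the unit disc to a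
function holomorphic on a larger disc. -/
theorem norm_coeff_le_of_hasSum {f : ℕ → ℂ} {Q : ℂ → ℂ} {r B : ℝ} (hr : 0 < r)
    (hQ : DifferentiableOn ℂ Q (Metric.closedBall 0 r)) (hB : ∀ z, ‖z‖ = r → ‖Q z‖ ≤ B)
    (hf : ∀ z : ℂ, ‖z‖ < 1 → HasSum (fun n => f n * z ^ n) (Q z)) (n : ℕ) :
    ‖f n‖ * r ^ n ≤ B := by
  lift r to ℝ≥0 using hr.le
  have hr' : 0 < r := by exact_mod_cast hr
  have h1 : HasFPowerSeriesAt Q (cauchyPowerSeries Q 0 r) 0 :=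
    (hQ.hasFPowerSeriesOnBall hr').hasFPowerSeriesAt
  have h2 : HasFPowerSeriesAt Q (FormalMultilinearSeries.ofScalars ℂ f) 0 := by
    rw [hasFPowerSeriesAt_iff]
    filter_upwards [Metric.ball_mem_nhds (0 : ℂ) one_pos] with z hz
    have := hf z (by simpa using hz)
    simpa [FormalMultilinearSeries.coeff_ofScalars, mul_comm] using this
  -- Uniqueness of power series at 0: the given coefficients are the Cauchy integrals over the
  -- circle of radius `r`, although their series is only assumed to converge to `Q` on the unit
  -- disc.
  have h3 := h1.eq_formalMultilinearSeries h2
  have h4 := norm_cauchyPowerSeries_le Q 0 r n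
  rw [h3, FormalMultilinearSeries.ofScalars_norm] at h4
  have h5 : ∫ θ in (0 : ℝ)..2 * Real.pi, ‖Q (circleMap 0 r θ)‖ ≤ B * (2 * Real.pi) := by
    have h6 : ‖∫ θ in (0 : ℝ)..2 * Real.pi, ‖Q (circleMap 0 r θ)‖‖ ≤ B * |2 * Real.pi - 0| := by
      refine intervalIntegral.norm_integral_le_of_norm_le_const fun θ _ => ?_
      rw [norm_norm]
      exact hB _ (by simp)
    rw [sub_zero, abs_of_pos Real.two_pi_pos] at h6
    exact (le_abs_self _).trans h6
  have h7 : (2 * Real.pi)⁻¹ * ∫ θ in (0 : ℝ)..2 * Real.pi, ‖Q (circleMap 0 r θ)‖ ≤ B := by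
    rw [inv_mul_le_iff₀ Real.two_pi_pos]
    linarith
  have h8 : ‖f n‖ ≤ B * ((r : ℝ)⁻¹) ^ n := by
    refine h4.trans ?_
    rw [abs_of_pos hr]
    exact mul_le_mul_of_nonneg_right h7 (by positivity)
  rw [inv_pow, ← div_eq_mul_inv, le_div_iff₀ (by positivity)] at h8
  exact h8

/-! ### Tail sums and their generating function. -/

/-- The tails `∑_{j > n} cⱼ`. -/
noncomputable def tailSum (c : ℕ → ℝ) (n : ℕ) : ℝ := ∑' j, c (n + 1 + j)

section Tail

variable {c : ℕ → ℝ}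

theorem tailSum_nonneg (hc : ∀ n, 0 ≤ c n) (n : ℕ) : 0 ≤ tailSum c n :=
  tsum_nonneg fun _ => hc _

theorem sum_add_tailSum (h : Summable c) (n : ℕ) :
    ∑ j ∈ Finset.range (n + 1), c j + tailSum c n = ∑' j, c j := by
  rw [← h.sum_add_tsum_nat_add (n + 1), tailSum]
  simp_rw [add_comm]

theorem tailSum_eq_add (h : Summable c) (n : ℕ) : tailSum c n = c (n + 1) + tailSum c (n + 1) := by
  have h1 := sum_add_tailSum h n
  have h2 := sum_add_tailSum h (n + 1)
  rw [Finset.sum_range_succ] at h2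
  linarith

theorem summable_of_summable_mul_pow (hc : ∀ n, 0 ≤ c n) {R : ℝ} (hR : 1 ≤ R)
    (h : Summable fun n => c n * R ^ n) : Summable c := by
  simpa using summable_mul_pow_of_le hc zero_le_one hR h

theorem tailSum_mul_pow_le (hc : ∀ n, 0 ≤ c n) {r : ℝ} (hr : 1 ≤ r)
    (h : Summable fun n => c n * r ^ n) (n : ℕ) :
    tailSum c n * r ^ (n + 1) ≤ ∑' j, c (n + 1 + j) * r ^ (n + 1 + j) := by
  rw [tailSum, ← tsum_mul_right]
  have hs : Summable fun j => c (n + 1 + j) * r ^ (n + 1 + j) := by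
    have := (summable_nat_add_iff (n + 1)).2 h
    simpa [add_comm] using this
  have hle : ∀ j, c (n + 1 + j) * r ^ (n + 1) ≤ c (n + 1 + j) * r ^ (n + 1 + j) := fun j =>
    mul_le_mul_of_nonneg_left (pow_le_pow_right₀ hr (by omega)) (hc _)
  exact (hs.of_nonneg_of_le (fun j => mul_nonneg (hc _) (by positivity)) hle).tsum_le_tsum hle hs

theorem summable_tailSum_mul_pow (hc : ∀ n, 0 ≤ c n) {r R : ℝ} (hr : 0 ≤ r) (hrR : r < R)
    (hR : 1 ≤ R) (h : Summable fun n => c n * R ^ n) : Summable fun n => tailSum c n * r ^ n := by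
  have hR0 : 0 < R := by linarith
  have hg : Summable fun n : ℕ => (∑' j, c j * R ^ j) * (r / R) ^ n :=
    (summable_geometric_of_lt_one (by positivity) ((div_lt_one hR0).2 hrR)).mul_left _
  refine hg.of_nonneg_of_le (fun n => mul_nonneg (tailSum_nonneg hc n) (by positivity)) fun n => ?_
  have h1 := tailSum_mul_pow_le hc hR h n
  have h2 : ∑' j, c (n + 1 + j) * R ^ (n + 1 + j) ≤ ∑' j, c j * R ^ j := by
    rw [← h.sum_add_tsum_nat_add (n + 1)]
    simp_rw [add_comm _ (n + 1)]
    exact le_add_of_nonneg_left (Finset.sum_nonneg fun i _ => mul_nonneg (hc _) (by positivity))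
  have h3 : tailSum c n * R ^ n ≤ ∑' j, c j * R ^ j := by
    refine le_trans (mul_le_mul_of_nonneg_left ?_ (tailSum_nonneg hc n)) (h1.trans h2)
    exact pow_le_pow_right₀ hR (by omega)
  rw [div_pow, mul_div_assoc', le_div_iff₀ (by positivity), mul_right_comm]
  exact mul_le_mul_of_nonneg_right h3 (by positivity)

theorem one_sub_mul_genFun (hc : ∀ n, 0 ≤ c n) {z : ℂ} (h : Summable fun n => c n * ‖z‖ ^ n) :
    (1 - z) * genFun c z = c 0 - ∑' n, ((c n : ℂ) - c (n + 1)) * z ^ (n + 1) := by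
  have hs : Summable fun n => (c n : ℂ) * z ^ n := (summable_genFun hc h le_rfl).of_norm
  have hs1 : Summable fun n => (c (n + 1) : ℂ) * z ^ (n + 1) := (summable_nat_add_iff 1).2 hs
  have h0 : genFun c z = c 0 + ∑' n, (c (n + 1) : ℂ) * z ^ (n + 1) := by
    rw [genFun, hs.tsum_eq_zero_add]; simp
  have h1 : z * genFun c z = ∑' n, (c n : ℂ) * z ^ (n + 1) := by
    rw [genFun, ← tsum_mul_left]
    exact tsum_congr fun n => by ring
  have hs2 : Summable fun n => (c n : ℂ) * z ^ (n + 1) :=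
    (hs.mul_left z).congr fun n => by ring
  rw [sub_mul, one_mul, h1, h0]
  simp_rw [sub_mul]
  rw [hs2.tsum_sub hs1]
  ring

/-- The differences of consecutive tails are the terms of `c`, so multiplication by 1 - z
telescopes. The quotient (c(1) - c(z))/(1 - z) therefore extends holomorphically across z = 1. -/
theorem one_sub_mul_genFun_tailSum (hc : ∀ n, 0 ≤ c n) {z : ℂ} {R : ℝ} (hz : ‖z‖ < R) (hR : 1 ≤ R)
    (h : Summable fun n => c n * R ^ n) :
    (1 - z) * genFun (tailSum c) z = (∑' n, c n : ℝ) - genFun c z := by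
  have hsum := summable_of_summable_mul_pow hc hR h
  rw [one_sub_mul_genFun (tailSum_nonneg hc)
    (summable_tailSum_mul_pow hc (norm_nonneg z) hz hR h)]
  have hs : Summable fun n => (c n : ℂ) * z ^ n := (summable_genFun hc h hz.le).of_norm
  have h0 : genFun c z = c 0 + ∑' n, (c (n + 1) : ℂ) * z ^ (n + 1) := by
    rw [genFun, hs.tsum_eq_zero_add]; simp
  have h1 : ∀ n, (tailSum c n : ℂ) - tailSum c (n + 1) = c (n + 1) := fun n => by
    rw [tailSum_eq_add hsum n]; push_cast; ring
  simp_rw [h1]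
  rw [h0, ← sum_add_tailSum hsum 0]
  push_cast
  simp

end Tail

/-! ### Interpolation between radius 1 and radius R. -/

/-- Hölder's inequality for the generating function of a nonnegative sequence, in the form given by
Bernoulli's inequality. -/
theorem tsum_mul_pow_le_mul_rpow {c : ℕ → ℝ} (hc : ∀ n, 0 ≤ c n) {r R m y : ℝ} (hr : 1 ≤ r)
    (hrR : r ≤ R) (hR : 1 < R) (hy : 0 < y) (h : Summable fun n => c n * R ^ n)
    (hm : ∑' n, c n ≤ m) (hM : ∑' n, c n * R ^ n ≤ y * m) :
    ∑' n, c n * r ^ n ≤ m * r ^ (Real.log y / Real.log R) := by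
  have hlR : 0 < Real.log R := Real.log_pos hR
  have hr0 : 0 < r := by linarith
  have hR0 : 0 < R := by linarith
  -- With r = R^s, scaling by `y` and Bernoulli give rⁿ = y^s (Rⁿ/y)^s ≤ y^s (1 + s(Rⁿ/y - 1)).
  -- Summed against `c`, this uses only the two given moments, and y^s is the required power of `r`.
  set s := Real.log r / Real.log R with hs
  have hs0 : 0 ≤ s := div_nonneg (Real.log_nonneg hr) hlR.le
  have hs1 : s ≤ 1 := (div_le_one hlR).2 (Real.log_le_log hr0 hrR)
  have hys : r ^ (Real.log y / Real.log R) = y ^ s := by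
    rw [Real.rpow_def_of_pos hr0, Real.rpow_def_of_pos hy, hs]
    congr 1; ring
  have hRs : ∀ n : ℕ, (r : ℝ) ^ n = (R ^ n) ^ s := fun n => by
    rw [← Real.rpow_natCast R, ← Real.rpow_mul hR0.le, mul_comm, Real.rpow_mul hR0.le,
      Real.rpow_natCast]
    congr 1
    rw [Real.rpow_def_of_pos hR0, hs, mul_div_cancel₀ _ hlR.ne', Real.exp_log hr0]
  have hterm : ∀ n, c n * r ^ n ≤ y ^ s * (1 - s) * c n + y ^ s * s / y * (c n * R ^ n) := by
    intro n
    have h1 : (R ^ n) ^ s = y ^ s * (1 + (R ^ n / y - 1)) ^ s := by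
      rw [← Real.mul_rpow hy.le (by ring_nf; positivity)]
      congr 1; field_simp; ring
    have h2 : (1 + (R ^ n / y - 1)) ^ s ≤ 1 + s * (R ^ n / y - 1) :=
      rpow_one_add_le_one_add_mul_self (by linarith [show 0 ≤ R ^ n / y by positivity]) hs0 hs1
    rw [hRs, h1]
    calc c n * (y ^ s * (1 + (R ^ n / y - 1)) ^ s)
        ≤ c n * (y ^ s * (1 + s * (R ^ n / y - 1))) := by gcongr; exact hc n
      _ = _ := by field_simp; ring
  have hsum := summable_of_summable_mul_pow hc hR.le h
  have hsr := summable_mul_pow_of_le hc hr0.le hrR h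
  have hys0 : 0 < y ^ s := Real.rpow_pos_of_pos hy s
  calc ∑' n, c n * r ^ n
      ≤ ∑' n, (y ^ s * (1 - s) * c n + y ^ s * s / y * (c n * R ^ n)) :=
        hsr.tsum_le_tsum hterm ((hsum.mul_left _).add (h.mul_left _))
    _ = y ^ s * (1 - s) * ∑' n, c n + y ^ s * s / y * ∑' n, c n * R ^ n := by
        rw [(hsum.mul_left _).tsum_add (h.mul_left _), tsum_mul_left, tsum_mul_left]
    _ ≤ y ^ s * (1 - s) * m + y ^ s * s / y * (y * m) := by
        have : 0 ≤ 1 - s := by linarith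
        gcongr
    _ = m * r ^ (Real.log y / Real.log R) := by rw [hys]; field_simp; ring

/-- `tsum_mul_pow_le_mul_rpow` for the series without its constant term. -/
theorem tsum_succ_mul_pow_le_mul_rpow {c : ℕ → ℝ} (hc : ∀ n, 0 ≤ c n) {r R m y : ℝ} (hr : 1 ≤ r)
    (hrR : r ≤ R) (hR : 1 < R) (hy : 0 < y) (h : Summable fun n => c n * R ^ n)
    (hm : ∑' n, c (n + 1) ≤ m) (hM : ∑' n, c (n + 1) * R ^ (n + 1) ≤ y * m) :
    ∑' n, c (n + 1) * r ^ (n + 1) ≤ m * r ^ (Real.log y / Real.log R) := by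
  have hlR : 0 < Real.log R := Real.log_pos hR
  have hr0 : 0 < r := by linarith
  have hR0 : 0 < R := by linarith
  have hsh : ∀ x : ℝ, ∑' n, c (n + 1) * x ^ (n + 1) = x * ∑' n, c (n + 1) * x ^ n := fun x => by
    rw [← tsum_mul_left]
    exact tsum_congr fun n => by ring
  have h' : Summable fun n => c (n + 1) * R ^ n := by
    have := ((summable_nat_add_iff 1).2 h).mul_left R⁻¹
    refine this.congr fun n => ?_
    field_simp
    ring
  -- The shifted sequence has its moment at `R` divided by `R`, hence y/R in place of y. This lowers
  -- the exponent by 1, and the outer factor `r` restores it.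
  have := tsum_mul_pow_le_mul_rpow (c := fun n => c (n + 1)) (fun n => hc _) hr hrR hR
    (div_pos hy hR0) h' hm (by rw [hsh] at hM; rw [div_mul_eq_mul_div, le_div_iff₀ hR0]; linarith)
  rw [hsh]
  refine (mul_le_mul_of_nonneg_left this hr0.le).trans (le_of_eq ?_)
  rw [Real.log_div hy.ne' hR0.ne', sub_div, div_self hlR.ne', Real.rpow_sub hr0, Real.rpow_one]
  field_simp

/-! ### Lower bound for the generating function away from z = 1. -/

/-- The decrements of `c` form a probability distribution, and (1 - z)c(z) is 1 minus its generating
function. Its first weight is at least `b`; the remaining mass 1 - b contributes at most (1 - b)|z|.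
-/
theorem norm_one_sub_mul_genFun_ge {c : ℕ → ℝ} {b : ℝ} (h0 : c 0 = 1) (hanti : Antitone c)
    (hc : ∀ n, 0 ≤ c n) (hb : c 1 ≤ 1 - b) (hs : Summable c) {z : ℂ} (hz : ‖z‖ ≤ 1) :
    ‖1 - b * z‖ - (1 - b) * ‖z‖ ≤ ‖(1 - z) * genFun c z‖ := by
  have hsz : Summable fun n => c n * ‖z‖ ^ n := by
    refine summable_mul_pow_of_le hc (norm_nonneg z) hz ?_
    simpa using hs
  -- The decrements with mass `b` removed from the first one; nonnegative because c 1 ≤ 1 - b.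
  set e : ℕ → ℝ := fun n => c n - c (n + 1) - if n = 0 then b else 0 with he
  have he0 : ∀ n, 0 ≤ e n := by
    intro n
    rcases n with _ | n
    · simp only [he, h0, if_true]; linarith
    · simpa [he] using hanti (Nat.le_succ (n + 1))
  have hs1 : Summable fun n => c (n + 1) := (summable_nat_add_iff 1).2 hs
  have hsb : HasSum (fun n : ℕ => if n = 0 then b else 0) b := hasSum_ite_eq 0 b
  have hes : HasSum e (1 - b) := by
    have : HasSum (fun n => c n - c (n + 1)) (c 0) := by
      have h1 := hs.hasSum.sub hs1.hasSum
      rwa [hs.tsum_eq_zero_add, add_sub_cancel_right] at h1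
    rw [h0] at this
    exact this.sub hsb
  have hez : ∀ n, ‖(e n : ℂ) * z ^ (n + 1)‖ ≤ ‖z‖ * e n := fun n => by
    rw [norm_mul, norm_pow, Complex.norm_real, Real.norm_of_nonneg (he0 n), mul_comm]
    refine mul_le_mul_of_nonneg_right ?_ (he0 n)
    rw [pow_succ]
    exact mul_le_of_le_one_left (norm_nonneg z) (pow_le_one₀ (norm_nonneg z) hz)
  have hzs : Summable fun n => ‖(e n : ℂ) * z ^ (n + 1)‖ :=
    (hes.summable.mul_left ‖z‖).of_nonneg_of_le (fun n => norm_nonneg _) hez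
  have hn : ‖∑' n, (e n : ℂ) * z ^ (n + 1)‖ ≤ (1 - b) * ‖z‖ := by
    refine (norm_tsum_le_tsum_norm hzs).trans ?_
    refine (hzs.tsum_le_tsum hez (hes.summable.mul_left _)).trans (le_of_eq ?_)
    rw [tsum_mul_left, hes.tsum_eq, mul_comm]
  have hid : (1 - z) * genFun c z = (1 - b * z) - ∑' n, (e n : ℂ) * z ^ (n + 1) := by
    rw [one_sub_mul_genFun hc hsz, h0]
    have hbz : HasSum (fun n : ℕ => if n = 0 then (b : ℂ) * z else 0) (b * z) :=
      hasSum_ite_eq 0 ((b : ℂ) * z)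
    have : ∑' n, ((c n : ℂ) - c (n + 1)) * z ^ (n + 1)
        = ∑' n, (e n : ℂ) * z ^ (n + 1) + b * z := by
      rw [← hbz.tsum_eq, ← hzs.of_norm.tsum_add hbz.summable]
      refine tsum_congr fun n => ?_
      rcases n with _ | n
      · simp [he]; ring
      · simp [he]
    rw [this]
    push_cast
    ring
  rw [hid]
  linarith [norm_sub_norm_le (1 - b * z) (∑' n, (e n : ℂ) * z ^ (n + 1))]

/-- The preceding estimate with b = 0 reads 1 - |z| ≤ |(1 - z)c(z)|. -/
theorem genFun_ne_zero_of_norm_lt_one {c : ℕ → ℝ} (h0 : c 0 = 1) (hanti : Antitone c)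
    (hc : ∀ n, 0 ≤ c n) (hs : Summable c) {z : ℂ} (hz : ‖z‖ < 1) : genFun c z ≠ 0 := by
  intro h
  have := norm_one_sub_mul_genFun_ge (b := 0) h0 hanti hc
    (by have := hanti (zero_le_one' ℕ); linarith) hs hz.le
  rw [h] at this
  simp at this
  linarith

theorem norm_one_sub_exp (θ : ℝ) : ‖1 - Complex.exp (Complex.I * θ)‖ = 2 * |Real.sin (θ / 2)| := by
  have h : (1 - Complex.exp (Complex.I * θ)) = ⟨1 - Real.cos θ, -Real.sin θ⟩ := by
    rw [mul_comm, Complex.exp_mul_I]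
    apply Complex.ext <;> simp [Complex.cos_ofReal_re, Complex.sin_ofReal_re]
  rw [h, Complex.norm_eq_sqrt_sq_add_sq]
  have h2 : Real.cos θ = 1 - 2 * Real.sin (θ / 2) ^ 2 := by
    have := Real.cos_two_mul' (θ / 2)
    rw [mul_div_cancel₀ _ (two_ne_zero)] at this
    nlinarith [Real.sin_sq_add_cos_sq (θ / 2)]
  have h1 : (1 - Real.cos θ) ^ 2 + (-Real.sin θ) ^ 2 = (2 * Real.sin (θ / 2)) ^ 2 := by
    nlinarith [Real.sin_sq_add_cos_sq θ]
  simp only [h1]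
  rw [Real.sqrt_sq_eq_abs, abs_mul, abs_two]

theorem norm_add_mul_one_sub_exp (x y θ : ℝ) :
    ‖x + y * (1 - Complex.exp (Complex.I * θ))‖
      = √(x ^ 2 + y * (x + y) * (2 * Real.sin (θ / 2)) ^ 2) := by
  have h : (x + y * (1 - Complex.exp (Complex.I * θ)))
      = ⟨x + y * (1 - Real.cos θ), -y * Real.sin θ⟩ := by
    rw [mul_comm Complex.I, Complex.exp_mul_I]
    apply Complex.ext <;> simp [Complex.cos_ofReal_re, Complex.sin_ofReal_re]
  rw [h, Complex.norm_eq_sqrt_sq_add_sq]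
  have h2 : Real.cos θ = 1 - 2 * Real.sin (θ / 2) ^ 2 := by
    have := Real.cos_two_mul' (θ / 2)
    rw [mul_div_cancel₀ _ (two_ne_zero)] at this
    nlinarith [Real.sin_sq_add_cos_sq (θ / 2)]
  congr 1
  have h3 : Real.sin θ ^ 2 = 1 - Real.cos θ ^ 2 := by
    linarith [Real.sin_sq_add_cos_sq θ]
  simp only [mul_pow, h3, neg_sq]
  rw [h2]
  ring

/-- `(√((1-b)² + b t²) - (1-b)) / t`, which is `(1 - b) D(α)` for `t = |1 - e^{iπ/(1+α)}|`. -/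
noncomputable def chordBound (b t : ℝ) : ℝ := (√((1 - b) ^ 2 + b * t ^ 2) - (1 - b)) / t

/-- Rationalizing the numerator gives bt / (√((1-b)² + bt²) + (1-b)), which is visibly increasing in
`t`. It extends the bound at the angle π/(1+α) to all larger angles. -/
theorem chordBound_mono {b s t : ℝ} (hb0 : 0 < b) (hb1 : b < 1) (hs : 0 < s) (hst : s ≤ t) :
    chordBound b s ≤ chordBound b t := by
  have ht : 0 < t := hs.trans_le hst
  have hb : 0 < 1 - b := by linarith
  have key : ∀ x, 0 < x → chordBound b x = b * x / (√((1 - b) ^ 2 + b * x ^ 2) + (1 - b)) := by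
    intro x hx
    have hsq := Real.sq_sqrt (show 0 ≤ (1 - b) ^ 2 + b * x ^ 2 by positivity)
    have hp : 0 < √((1 - b) ^ 2 + b * x ^ 2) + (1 - b) := by positivity
    rw [chordBound, div_eq_div_iff hx.ne' hp.ne']
    linear_combination hsq
  rw [key s hs, key t ht, div_le_div_iff₀ (by positivity) (by positivity)]
  have h1 : s * √((1 - b) ^ 2 + b * t ^ 2) ≤ t * √((1 - b) ^ 2 + b * s ^ 2) := by
    rw [← Real.sqrt_sq hs.le, ← Real.sqrt_sq ht.le, ← Real.sqrt_mul (sq_nonneg s),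
      ← Real.sqrt_mul (sq_nonneg t), Real.sqrt_sq hs.le, Real.sqrt_sq ht.le]
    apply Real.sqrt_le_sqrt
    nlinarith [mul_le_mul_of_nonneg_right (pow_le_pow_left₀ hs.le hst 2) (sq_nonneg (1 - b))]
  have h2 : 0 ≤ b * (1 - b) * (t - s) := by
    have := sub_nonneg.2 hst
    positivity
  linarith [mul_le_mul_of_nonneg_left h1 hb0.le]

theorem chordBound_pos {b t : ℝ} (hb0 : 0 < b) (hb1 : b < 1) (ht : 0 < t) : 0 < chordBound b t := by
  have hb : 0 < 1 - b := by linarith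
  refine div_pos (sub_pos.2 ?_) ht
  rw [Real.lt_sqrt hb.le]
  have : 0 < b * t ^ 2 := by positivity
  linarith

/-- The half chord `sin (π / (2 (1 + α)))` is positive. -/
theorem sin_half_pos {α : ℝ} (hα : 0 ≤ α) : 0 < Real.sin (Real.pi / (1 + α) / 2) := by
  have h1 : 0 < Real.pi / (1 + α) := div_pos Real.pi_pos (by linarith)
  have h2 : Real.pi / (1 + α) ≤ Real.pi := div_le_self Real.pi_pos.le (by linarith)
  exact Real.sin_pos_of_pos_of_lt_pi (by linarith) (by linarith)

theorem kendallD_eq {b α : ℝ} (hb1 : b < 1) (hα : 0 ≤ α) :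
    kendallD b α = chordBound b (2 * Real.sin (Real.pi / (1 + α) / 2)) / (1 - b) := by
  have hs := sin_half_pos hα
  have hb : 0 < 1 - b := by linarith
  have h1 := norm_one_sub_exp (Real.pi / (1 + α))
  have h2 := norm_add_mul_one_sub_exp 1 (b / (1 - b)) (Real.pi / (1 + α))
  push_cast at h1 h2
  rw [← mul_div_assoc] at h1 h2
  rw [kendallD, h1, h2, abs_of_pos hs, chordBound]
  set t := 2 * Real.sin (Real.pi / (1 + α) / 2)
  have h3 : (1 - b) * √(1 ^ 2 + b / (1 - b) * (1 + b / (1 - b)) * t ^ 2)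
      = √((1 - b) ^ 2 + b * t ^ 2) := by
    rw [← Real.sqrt_sq hb.le, ← Real.sqrt_mul (sq_nonneg _), Real.sqrt_sq hb.le]
    congr 1
    field_simp
    ring
  rw [← h3]
  have ht : 0 < t := by positivity
  field_simp

theorem kendallD_pos {b α : ℝ} (hb0 : 0 < b) (hb1 : b < 1) (hα : 0 ≤ α) : 0 < kendallD b α := by
  rw [kendallD_eq hb1 hα]
  exact div_pos (chordBound_pos hb0 hb1 (mul_pos two_pos (sin_half_pos hα))) (by linarith)

/-- The lower bound for the generating function at arguments far from `1`. -/
theorem chordBound_le_norm_genFun {c : ℕ → ℝ} {b : ℝ} (hb0 : 0 < b) (hb1 : b < 1) (h0 : c 0 = 1)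
    (hanti : Antitone c) (hc : ∀ n, 0 ≤ c n) (hb : c 1 ≤ 1 - b) (hs : Summable c) {s θ : ℝ}
    (hs0 : 0 < s) (hst : s ≤ 2 * Real.sin (θ / 2)) :
    chordBound b s ≤ ‖genFun c (Complex.exp (Complex.I * θ))‖ := by
  set z := Complex.exp (Complex.I * θ) with hz
  have hz1 : ‖z‖ = 1 := by rw [hz, mul_comm]; exact Complex.norm_exp_ofReal_mul_I θ
  have ht : 0 < 2 * Real.sin (θ / 2) := hs0.trans_le hst
  refine (chordBound_mono hb0 hb1 hs0 hst).trans ?_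
  have h := norm_one_sub_mul_genFun_ge h0 hanti hc hb hs hz1.le
  have hz2 : ‖1 - z‖ = 2 * Real.sin (θ / 2) := by
    rw [hz, norm_one_sub_exp, abs_of_pos (by linarith)]
  have hz3 : ‖1 - b * z‖ = √((1 - b) ^ 2 + b * (2 * Real.sin (θ / 2)) ^ 2) := by
    have := norm_add_mul_one_sub_exp (1 - b) b θ
    rw [← hz] at this
    push_cast at this
    rw [show (1 : ℂ) - b * z = 1 - b + b * (1 - z) by ring, this]
    congr 1; ring
  rw [norm_mul, hz2, hz3, hz1, mul_one] at h
  rw [chordBound, div_le_iff₀ ht, mul_comm ‖_‖]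
  exact h

/-! ### Lower bound near z = 1: summation by parts against a phase. -/

/-- Abel's inequality for a decreasing nonnegative sequence. -/
theorem neg_mul_le_sum_of_antitone {c s : ℕ → ℝ} {A : ℝ} (hanti : Antitone c) (hc : ∀ n, 0 ≤ c n)
    (hs : ∀ n, -A ≤ ∑ j ∈ Finset.range n, s j) (n : ℕ) :
    -A * c 0 ≤ ∑ j ∈ Finset.range n, c j * s j := by
  have hA : 0 ≤ A := by simpa using hs 0
  rcases n with _ | n
  · simpa using mul_nonneg hA (hc 0)
  have key : -A * (c 0 - c n) + c n * ∑ j ∈ Finset.range (n + 1), s j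
      ≤ ∑ j ∈ Finset.range (n + 1), c j * s j := by
    induction n with
    | zero => simp
    | succ n ih =>
      rw [Finset.sum_range_succ (fun j => c j * s j), Finset.sum_range_succ s]
      have h1 : 0 ≤ (c n - c (n + 1)) * (∑ j ∈ Finset.range (n + 1), s j + A) :=
        mul_nonneg (sub_nonneg.2 (hanti (Nat.le_succ n))) (by linarith [hs (n + 1)])
      nlinarith
  nlinarith [mul_le_mul_of_nonneg_left (hs (n + 1)) (hc n)]

theorem neg_mul_le_tsum_of_antitone {c s : ℕ → ℝ} {A : ℝ} (hanti : Antitone c) (hc : ∀ n, 0 ≤ c n)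
    (hs : ∀ n, -A ≤ ∑ j ∈ Finset.range n, s j) (h : Summable fun j => c j * s j) :
    -A * c 0 ≤ ∑' j, c j * s j :=
  ge_of_tendsto' h.hasSum.tendsto_sum_nat (neg_mul_le_sum_of_antitone hanti hc hs)

theorem two_mul_sin_mul_sum_sin (B θ : ℝ) (n : ℕ) :
    2 * Real.sin (θ / 2) * ∑ j ∈ Finset.range n, Real.sin (B + (j + 1) * θ)
      = Real.cos (B + θ / 2) - Real.cos (B + (n + 1 / 2) * θ) := by
  induction n with
  | zero => simp; ring_nf
  | succ n ih =>
    rw [Finset.sum_range_succ, mul_add, ih]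
    have h1 : B + (n + 1 / 2) * θ = B + (n + 1) * θ - θ / 2 := by ring
    have h2 : B + ((n + 1 : ℕ) + 1 / 2) * θ = B + (n + 1) * θ + θ / 2 := by push_cast; ring
    rw [h1, h2, Real.cos_sub (B + (n + 1) * θ), Real.cos_add (B + (n + 1) * θ)]
    ring

/-- The right side is the line through (0, cos B) and (π, 1). Up to x = π the cosine does not exceed
cos B, and beyond π the line is above 1. A linear majorant allows a constant increment per term to
compensate the partial sums of sines. -/
theorem cos_add_le_chord {B x : ℝ} (hB0 : 0 ≤ B) (hB : B ≤ Real.pi / 2) (hx : 0 ≤ x) :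
    Real.cos (B + x) ≤ Real.cos B + (1 - Real.cos B) * (x / Real.pi) := by
  have hπ := Real.pi_pos
  have h1 : 0 ≤ 1 - Real.cos B := by linarith [Real.cos_le_one B]
  rcases le_total Real.pi x with h | h
  · have : 1 ≤ x / Real.pi := (one_le_div hπ).2 h
    nlinarith [Real.cos_le_one (B + x)]
  · have h2 : Real.cos (B + x) ≤ Real.cos B := by
      rcases le_total (B + x) Real.pi with h3 | h3
      · exact Real.cos_le_cos_of_nonneg_of_le_pi hB0 h3 (by linarith)
      · rw [← Real.cos_two_pi_sub (B + x)]
        exact Real.cos_le_cos_of_nonneg_of_le_pi hB0 (by linarith) (by linarith)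
    have : 0 ≤ (1 - Real.cos B) * (x / Real.pi) := by positivity
    linarith

theorem mul_cos_sub_le {B u ε : ℝ} (hu : u ≤ B) (hu0 : 0 ≤ u) (hB : B ≤ Real.pi / 2) (hε0 : 0 ≤ ε)
    (hε1 : ε ≤ 1) :
    ε * (Real.cos (B - u) - Real.cos B) ≤ Real.cos (B - ε * u) - Real.cos B := by
  have h := strictConcaveOn_cos_Icc.concaveOn.2 (show B ∈ _ from ⟨by linarith, hB⟩)
    (show B - u ∈ _ from ⟨by linarith, by linarith⟩) (show 0 ≤ 1 - ε by linarith) hε0 (by ring)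
  simp only [smul_eq_mul] at h
  have h2 : (1 - ε) * B + ε * (B - u) = B - ε * u := by ring
  rw [h2] at h
  linarith

theorem mul_sin_le {x ε : ℝ} (hx0 : 0 ≤ x) (hx : x ≤ Real.pi) (hε0 : 0 ≤ ε) (hε1 : ε ≤ 1) :
    ε * Real.sin x ≤ Real.sin (ε * x) := by
  have h := strictConcaveOn_sin_Icc.concaveOn.2 (show (0 : ℝ) ∈ _ from ⟨le_rfl, Real.pi_pos.le⟩)
    (show x ∈ _ from ⟨hx0, hx⟩) (show 0 ≤ 1 - ε by linarith) hε0 (by ring)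
  simpa using h

/-- The phase that realizes the chord bound as a linear functional. -/
theorem exists_phase {b x : ℝ} (hb0 : 0 < b) (hb1 : b < 1) (hx0 : 0 < x) (hx : x ≤ Real.pi / 2) :
    ∃ B, x ≤ B ∧ B ≤ Real.pi / 2 ∧ chordBound b (2 * Real.sin x)
      = b * Real.sin B - (1 - b) * (1 - Real.cos (B - x)) / (2 * Real.sin x) := by
  have hb : 0 < 1 - b := by linarith
  have hs : 0 < Real.sin x := Real.sin_pos_of_pos_of_lt_pi hx0 (by linarith [Real.pi_pos])
  have hcx : 0 ≤ Real.cos x := Real.cos_nonneg_of_mem_Icc ⟨by linarith [Real.pi_pos], hx⟩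
  -- Multiplied by 2 sin x, the right side of the claim is X cos B + Y sin B - (1-b), with X = (1-b)
  -- cos x and Y = (1+b) sin x. Its maximum over `B` is S - (1-b), since X² + Y² = S², and is
  -- attained where cos B = X/S and sin B = Y/S.
  set S := √((1 - b) ^ 2 + b * (2 * Real.sin x) ^ 2) with hS
  have hS2 : S ^ 2 = (1 - b) ^ 2 + b * (2 * Real.sin x) ^ 2 := Real.sq_sqrt (by positivity)
  have hSb : 1 - b ≤ S := Real.le_sqrt_of_sq_le (by nlinarith [sq_nonneg (2 * Real.sin x)])
  have hS0 : 0 < S := by linarith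
  set X := (1 - b) * Real.cos x with hX
  set Y := (1 + b) * Real.sin x with hY
  have hXY : X ^ 2 + Y ^ 2 = S ^ 2 := by
    rw [hS2, hX, hY, mul_pow, mul_pow, Real.cos_sq']
    ring
  have hX0 : 0 ≤ X := by positivity
  have hY0 : 0 ≤ Y := by positivity
  have hXS : X / S ≤ Real.cos x := by
    rw [div_le_iff₀ hS0]
    nlinarith
  have hcosB : Real.cos (Real.arccos (X / S)) = X / S :=
    Real.cos_arccos (by linarith [div_nonneg hX0 hS0.le]) (hXS.trans (Real.cos_le_one x))
  have hsinB : Real.sin (Real.arccos (X / S)) = Y / S := by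
    rw [Real.sin_arccos, Real.sqrt_eq_iff_mul_self_eq_of_pos]
    · field_simp
      linarith
    · positivity
  refine ⟨Real.arccos (X / S), ?_, ?_, ?_⟩
  · have := Real.arccos_le_arccos hXS
    rwa [Real.arccos_cos hx0.le (by linarith [Real.pi_pos])] at this
  · exact Real.arccos_le_pi_div_two.2 (div_nonneg hX0 hS0.le)
  · rw [Real.cos_sub, hcosB, hsinB, chordBound, ← hS, eq_sub_iff_add_eq, ← add_div,
      div_eq_iff (by positivity)]
    field_simp
    rw [hX, hY] at hXY ⊢
    linear_combination (-1) * hXY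

theorem hasSum_mul_sin {c : ℕ → ℝ} (hc : ∀ n, 0 ≤ c n) (hs : Summable c) (B θ : ℝ) :
    HasSum (fun n => c n * Real.sin (B + n * θ))
      (Complex.exp (B * Complex.I) * genFun c (Complex.exp (Complex.I * θ))).im := by
  have hz1 : ‖Complex.exp (Complex.I * θ)‖ ≤ 1 := by
    rw [mul_comm, Complex.norm_exp_ofReal_mul_I]
  have hsum := (summable_genFun (R := 1) hc (by simpa using hs) hz1).of_norm
  have h1 := Complex.hasSum_im (hsum.hasSum.mul_left (Complex.exp (B * Complex.I)))
  have h3 : ∀ n : ℕ, (Complex.exp (B * Complex.I) * ((c n : ℂ) * Complex.exp (Complex.I * θ) ^ n)).im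
      = c n * Real.sin (B + n * θ) := fun n => by
    have h2 : Complex.exp (B * Complex.I) * ((c n : ℂ) * Complex.exp (Complex.I * θ) ^ n)
        = c n * Complex.exp (((B + n * θ : ℝ) : ℂ) * Complex.I) := by
      rw [← Complex.exp_nat_mul, mul_left_comm, ← Complex.exp_add]
      congr 2
      push_cast
      ring
    rw [h2, Complex.im_ofReal_mul, Complex.exp_ofReal_mul_I_im]
  simp only [h3] at h1
  exact h1

theorem tsum_mul_sin_le_norm_genFun {c : ℕ → ℝ} (hc : ∀ n, 0 ≤ c n) (hs : Summable c) (B θ : ℝ) :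
    ∑' n, c n * Real.sin (B + n * θ) ≤ ‖genFun c (Complex.exp (Complex.I * θ))‖ := by
  rw [(hasSum_mul_sin hc hs B θ).tsum_eq]
  refine (Complex.im_le_norm _).trans (le_of_eq ?_)
  rw [norm_mul, Complex.norm_exp_ofReal_mul_I, one_mul]

/-- The chord estimate, in trigonometric form. -/
theorem chord_slope_le {α B θ θ₀ : ℝ} (hα : 0 ≤ α) (hθ₀ : θ₀ = Real.pi / (1 + α)) (hB1 : θ₀ / 2 ≤ B)
    (hB2 : B ≤ Real.pi / 2) (hθ0 : 0 ≤ θ) (hθ : θ ≤ θ₀) :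
    (Real.cos B + (1 - Real.cos B) * (θ / Real.pi) / 2 - Real.cos (B + θ / 2))
        + (1 - Real.cos B) * (θ / Real.pi) * α
      ≤ 2 * Real.sin (θ / 2) * Real.sin B
        + 2 * Real.sin (θ / 2) / (2 * Real.sin (θ₀ / 2)) * (1 - Real.cos (B - θ₀ / 2)) := by
  have hπ := Real.pi_pos
  have hθ₀0 : 0 < θ₀ := by rw [hθ₀]; exact div_pos hπ (by linarith)
  have hθ₀π : θ₀ ≤ Real.pi := by linarith
  have hs0 : 0 < Real.sin (θ₀ / 2) :=
    Real.sin_pos_of_pos_of_lt_pi (by linarith) (by linarith)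
  have hq : 0 ≤ 1 - Real.cos (B - θ₀ / 2) := by linarith [Real.cos_le_one (B - θ₀ / 2)]
  -- Everything is compared with the extreme angle θ₀. Since θ₀(1 + α) = π, the linear terms with (1
  -- - cos B)θ/π add up to at most ε(1 - cos B). Concavity of sine and cosine gives the matching
  -- lower bounds with the same ε, and cos(B - θ₀/2) cancels.
  obtain ⟨ε, hε⟩ : ∃ ε, ε = θ / θ₀ := ⟨_, rfl⟩
  have hε0 : 0 ≤ ε := by rw [hε]; positivity
  have hε1 : ε ≤ 1 := by rw [hε]; exact (div_le_one hθ₀0).2 hθ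
  have hεθ : ε * (θ₀ / 2) = θ / 2 := by rw [hε]; field_simp
  have hratio : ε ≤ 2 * Real.sin (θ / 2) / (2 * Real.sin (θ₀ / 2)) := by
    rw [le_div_iff₀ (by linarith), ← hεθ]
    linarith [mul_sin_le (x := θ₀ / 2) (by linarith) (by linarith) hε0 hε1]
  have hconc := mul_cos_sub_le hB1 (by linarith) hB2 hε0 hε1
  rw [hεθ] at hconc
  have hprod : 2 * Real.sin (θ / 2) * Real.sin B = Real.cos (B - θ / 2) - Real.cos (B + θ / 2) := by
    rw [Real.cos_sub, Real.cos_add]; ring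
  have hAα : (1 - Real.cos B) * (θ / Real.pi) * (1 + α) = (1 - Real.cos B) * ε := by
    rw [hε, hθ₀]; field_simp
  have hq2 := mul_le_mul_of_nonneg_right hratio hq
  have hA' : 0 ≤ (1 - Real.cos B) * (θ / Real.pi) :=
    mul_nonneg (by linarith [Real.cos_le_one B]) (by positivity)
  rw [hprod]
  linarith

/-- The lower bound for the generating function at arguments close to `1`. -/
theorem chordBound_le_norm_genFun_of_le {c : ℕ → ℝ} {b α : ℝ} (hb0 : 0 < b) (hb1 : b < 1)
    (h0 : c 0 = 1) (hanti : Antitone c) (hc : ∀ n, 0 ≤ c n) (hb : c 1 ≤ 1 - b) (hs : Summable c)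
    (hα : 0 ≤ α) (hcα : ∑' n, c (n + 1) ≤ (1 - b) * α) {θ : ℝ} (hθ0 : 0 ≤ θ)
    (hθ : θ ≤ Real.pi / (1 + α)) :
    chordBound b (2 * Real.sin (Real.pi / (1 + α) / 2))
      ≤ ‖genFun c (Complex.exp (Complex.I * θ))‖ := by
  have hπ := Real.pi_pos
  have hb' : 0 < 1 - b := by linarith
  have ht0 : 0 < 2 * Real.sin (Real.pi / (1 + α) / 2) := mul_pos two_pos (sin_half_pos hα)
  obtain ⟨θ₀, hθ₀⟩ : ∃ θ₀, θ₀ = Real.pi / (1 + α) := ⟨_, rfl⟩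
  rw [← hθ₀] at ht0 hθ ⊢
  have hθ₀0 : 0 < θ₀ := by rw [hθ₀]; exact div_pos hπ (by linarith)
  have hθ₀π : θ₀ ≤ Real.pi := by rw [hθ₀]; exact div_le_self hπ.le (by linarith)
  obtain ⟨B, hB1, hB2, hD⟩ := exists_phase hb0 hb1 (x := θ₀ / 2) (by linarith) (by linarith)
  have hB0 : 0 ≤ B := by linarith
  refine le_trans ?_ (tsum_mul_sin_le_norm_genFun hc hs B θ)
  have hphase := (hasSum_mul_sin hc hs B θ).summable
  rw [hphase.tsum_eq_zero_add, h0, hD]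
  have hsinB : 0 ≤ Real.sin B := Real.sin_nonneg_of_nonneg_of_le_pi hB0 (by linarith)
  have hq : 0 ≤ 1 - Real.cos (B - θ₀ / 2) := by linarith [Real.cos_le_one (B - θ₀ / 2)]
  have hs1 : Summable fun n => c (n + 1) := (summable_nat_add_iff 1).2 hs
  have hs2 : Summable fun n : ℕ => c (n + 1) * Real.sin (B + ((n + 1 : ℕ) : ℝ) * θ) :=
    (summable_nat_add_iff 1).2 hphase
  simp only [Nat.cast_zero, zero_mul, add_zero, one_mul]
  -- At θ = 0 the chord 2 sin(θ/2) vanishes and cannot be divided out; there all terms have the same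
  -- sign.
  rcases hθ0.eq_or_lt with hθ1 | hθ1
  · have h2 : 0 ≤ ∑' n, c (n + 1) * Real.sin (B + ((n + 1 : ℕ) : ℝ) * θ) := by
      refine tsum_nonneg fun n => mul_nonneg (hc _) ?_
      rw [← hθ1]
      simpa using hsinB
    have h3 : 0 ≤ (1 - b) * (1 - Real.cos (B - θ₀ / 2)) / (2 * Real.sin (θ₀ / 2)) := by positivity
    have h4 : b * Real.sin B ≤ Real.sin B := mul_le_of_le_one_left hsinB hb1.le
    linarith
  have htpos : 0 < 2 * Real.sin (θ / 2) :=
    mul_pos two_pos (Real.sin_pos_of_pos_of_lt_pi (by linarith) (by linarith))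
  have hmain := chord_slope_le hα hθ₀ hB1 hB2 hθ0 hθ
  have hA'0 : 0 ≤ (1 - Real.cos B) * (θ / Real.pi) :=
    mul_nonneg (by linarith [Real.cos_le_one B]) (by positivity)
  -- The sine sum telescopes to a difference of cosines, which may drift down linearly in `n`. The
  -- added constant (1 - cos B)θ/π per term cancels exactly this drift in the chord bound, so the
  -- partial sums stay above a fixed -A.
  have hpart : ∀ n : ℕ,
      -(Real.cos B + (1 - Real.cos B) * (θ / Real.pi) / 2 - Real.cos (B + θ / 2))
      ≤ ∑ j ∈ Finset.range n, (2 * Real.sin (θ / 2) * Real.sin (B + ((j + 1 : ℕ) : ℝ) * θ)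
        + (1 - Real.cos B) * (θ / Real.pi)) := by
    intro n
    rw [Finset.sum_add_distrib, ← Finset.mul_sum]
    push_cast
    rw [two_mul_sin_mul_sum_sin]
    have := cos_add_le_chord hB0 hB2 (x := (n + 1 / 2) * θ) (by positivity)
    have h2 : (1 - Real.cos B) * ((n + 1 / 2) * θ / Real.pi)
        = n * ((1 - Real.cos B) * (θ / Real.pi)) + (1 - Real.cos B) * (θ / Real.pi) / 2 := by
      ring
    simp only [Finset.sum_const, Finset.card_range, nsmul_eq_mul]
    linarith
  generalize Real.cos B + (1 - Real.cos B) * (θ / Real.pi) / 2 - Real.cos (B + θ / 2) = A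
    at hpart hmain
  generalize (1 - Real.cos B) * (θ / Real.pi) = A' at hpart hmain hA'0
  generalize 2 * Real.sin (θ / 2) = t at hpart hmain htpos
  have hfun : (fun n : ℕ => c (n + 1) * (t * Real.sin (B + ((n + 1 : ℕ) : ℝ) * θ) + A'))
      = fun n : ℕ => t * (c (n + 1) * Real.sin (B + ((n + 1 : ℕ) : ℝ) * θ)) + A' * c (n + 1) := by
    funext n; ring
  -- Abel's inequality is applied to the sequence from index 1 on, so that its leading value is at
  -- most 1 - b. The constant added per term costs A' times ∑_{n≥1} c_n, at most A'(1 - b)α.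
  have habel := neg_mul_le_tsum_of_antitone (c := fun n => c (n + 1))
    (fun m n h => hanti (by omega)) (fun n => hc _) hpart
    (by rw [hfun]; exact (hs2.mul_left t).add (hs1.mul_left A'))
  rw [hfun, (hs2.mul_left t).tsum_add (hs1.mul_left A'), tsum_mul_left, tsum_mul_left] at habel
  have hA0 : 0 ≤ A := by simpa using hpart 0
  have h1 : A * c (0 + 1) ≤ A * (1 - b) := mul_le_mul_of_nonneg_left hb hA0
  have h2 : A' * ∑' n, c (n + 1) ≤ A' * ((1 - b) * α) := mul_le_mul_of_nonneg_left hcα hA'0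
  generalize ∑' n, c (n + 1) * Real.sin (B + ((n + 1 : ℕ) : ℝ) * θ) = U at habel ⊢
  have hfin := mul_le_mul_of_nonneg_left hmain hb'.le
  refine le_of_mul_le_mul_left ?_ htpos
  have h5 : t * (b * Real.sin B - (1 - b) * (1 - Real.cos (B - θ₀ / 2)) / (2 * Real.sin (θ₀ / 2)))
      = t * b * Real.sin B
        - (1 - b) * (t / (2 * Real.sin (θ₀ / 2)) * (1 - Real.cos (B - θ₀ / 2))) := by ring
  rw [h5]
  linarith

/-- The lower bound for the generating function of a decreasing sequence on the unit circle. -/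
theorem mul_kendallD_le_norm_genFun {c : ℕ → ℝ} {b α : ℝ} (hb0 : 0 < b) (hb1 : b < 1)
    (h0 : c 0 = 1) (hanti : Antitone c) (hc : ∀ n, 0 ≤ c n) (hb : c 1 ≤ 1 - b) (hs : Summable c)
    (hα : 0 ≤ α) (hcα : ∑' n, c (n + 1) ≤ (1 - b) * α) {z : ℂ} (hz : ‖z‖ = 1) :
    (1 - b) * kendallD b α ≤ ‖genFun c z‖ := by
  have hb' : 1 - b ≠ 0 := by linarith
  rw [kendallD_eq hb1 hα, mul_div_cancel₀ _ hb']
  have key : ∀ θ : ℝ, 0 ≤ θ → θ ≤ Real.pi → chordBound b (2 * Real.sin (Real.pi / (1 + α) / 2))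
      ≤ ‖genFun c (Complex.exp (Complex.I * θ))‖ := by
    intro θ hθ0 hθπ
    rcases le_total θ (Real.pi / (1 + α)) with h | h
    · exact chordBound_le_norm_genFun_of_le hb0 hb1 h0 hanti hc hb hs hα hcα hθ0 h
    · refine chordBound_le_norm_genFun hb0 hb1 h0 hanti hc hb hs
        (mul_pos two_pos (sin_half_pos hα)) ?_
      have : 0 < Real.pi / (1 + α) := div_pos Real.pi_pos (by linarith)
      have := Real.sin_le_sin_of_le_of_le_pi_div_two (x := Real.pi / (1 + α) / 2) (y := θ / 2)
        (by linarith [Real.pi_pos]) (by linarith) (by linarith)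
      linarith
  have hz' : z = Complex.exp (Complex.I * z.arg) := by
    have := Complex.norm_mul_exp_arg_mul_I z
    rw [hz, Complex.ofReal_one, one_mul, mul_comm] at this
    exact this.symm
  rcases le_total 0 z.arg with h | h
  · rw [hz']
    exact key _ h (Complex.arg_le_pi z)
  -- The coefficients are real, so conjugation reduces negative arguments to positive ones.
  · have h1 := key (-z.arg) (by linarith) (by linarith [Complex.neg_pi_lt_arg z])
    have h2 : Complex.exp (Complex.I * ((-z.arg : ℝ) : ℂ)) = (starRingEnd ℂ) z := by
      conv_rhs => rw [hz']
      rw [← Complex.exp_conj]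
      simp
    have h3 : genFun c ((starRingEnd ℂ) z) = (starRingEnd ℂ) (genFun c z) := by
      rw [genFun, genFun, Complex.conj_tsum]
      simp
    rw [h2, h3, RCLike.norm_conj] at h1
    exact h1

/-! ### The renewal equation: analytic and elementary rates. -/

section Renewal

variable {c u : ℕ → ℝ}

theorem tsum_mul_pow_sub_tsum (hc : ∀ n, 0 ≤ c n) {r : ℝ} (hr : 1 ≤ r)
    (h : Summable fun n => c n * r ^ n) :
    ∑' n, c n * r ^ n - ∑' n, c n = ∑' n, c (n + 1) * r ^ (n + 1) - ∑' n, c (n + 1) := by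
  have hsum := summable_of_summable_mul_pow hc hr h
  rw [h.tsum_eq_zero_add, hsum.tsum_eq_zero_add]
  simp

theorem tsum_tailSum_mul_pow (hc : ∀ n, 0 ≤ c n) {r R : ℝ} (hr : 1 < r) (hrR : r < R)
    (h : Summable fun n => c n * R ^ n) :
    ∑' n, tailSum c n * r ^ n = (∑' n, c n * r ^ n - ∑' n, c n) / (r - 1) := by
  have hR : 1 ≤ R := by linarith
  have h1 := one_sub_mul_genFun_tailSum hc (z := (r : ℂ)) (R := R)
    (by rw [Complex.norm_real, Real.norm_of_nonneg (by linarith)]; exact hrR) hR h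
  rw [genFun_ofReal, genFun_ofReal] at h1
  have h2 : (1 - r) * ∑' n, tailSum c n * r ^ n = ∑' n, c n - ∑' n, c n * r ^ n := by
    exact_mod_cast h1
  rw [eq_div_iff (by linarith)]
  linarith

/-- The generating function changes by at most `∑ cₙ (rⁿ - 1)` along rays between the unit circle
and the circle of radius `r`. -/
theorem norm_genFun_sub_le (hc : ∀ n, 0 ≤ c n) {r : ℝ} (h : Summable fun n => c n * r ^ n)
    {z : ℂ} (hz1 : 1 ≤ ‖z‖) (hzr : ‖z‖ ≤ r) :
    ‖genFun c z - genFun c (z / ‖z‖)‖ ≤ ∑' n, c n * r ^ n - ∑' n, c n := by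
  have hz0 : 0 < ‖z‖ := by linarith
  have hsum := summable_of_summable_mul_pow hc (hz1.trans hzr) h
  have hw : ‖z / ‖z‖‖ = 1 := by
    rw [norm_div, Complex.norm_real, norm_norm, div_self hz0.ne']
  have hs1 := (summable_genFun hc h hzr).of_norm
  have hs2 := (summable_genFun (R := 1) hc (by simpa using hsum) hw.le).of_norm
  rw [genFun, genFun, ← hs1.tsum_sub hs2, ← h.tsum_sub hsum]
  refine tsum_of_norm_bounded (h.sub hsum).hasSum fun n => ?_
  have hzw : z = ‖z‖ * (z / ‖z‖) :=
    (mul_div_cancel₀ z (by exact_mod_cast hz0.ne')).symm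
  have h1 : (c n : ℂ) * z ^ n - c n * (z / ‖z‖) ^ n
      = ((c n * (‖z‖ ^ n - 1) : ℝ) : ℂ) * (z / ‖z‖) ^ n := by
    conv_lhs => enter [1]; rw [hzw, mul_pow]
    push_cast
    ring
  have h2 : 0 ≤ ‖z‖ ^ n - 1 := sub_nonneg.2 (one_le_pow₀ hz1)
  rw [h1, norm_mul, norm_pow, hw, one_pow, mul_one, Complex.norm_real,
    Real.norm_of_nonneg (mul_nonneg (hc n) h2)]
  have h3 : ‖z‖ ^ n ≤ r ^ n := pow_le_pow_left₀ (norm_nonneg z) hzr n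
  nlinarith [hc n]

/-- Convolving the constant (∑ c)⁻¹ with `c` gives a partial sum over the total; its deficit from 1
is the normalized tail. -/
theorem renewal_deviation (hs : Summable c)
    (hpos : 0 < ∑' n, c n) (hu : ∀ n, ∑ k ∈ Finset.range (n + 1), u k * c (n - k) = 1) (n : ℕ) :
    ∑ k ∈ Finset.range (n + 1), (u k - (∑' j, c j)⁻¹) * c (n - k)
      = (∑' j, c j)⁻¹ * tailSum c n := by
  have h1 := sum_add_tailSum hs n
  simp_rw [sub_mul, Finset.sum_sub_distrib, hu, ← Finset.mul_sum]
  have h2 : ∑ k ∈ Finset.range (n + 1), c (n - k) = ∑ k ∈ Finset.range (n + 1), c k := by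
    simpa using Finset.sum_range_reflect c (n + 1)
  rw [h2, ← h1]
  rw [← h1] at hpos
  field_simp
  ring

theorem renewal_le_one (h0 : c 0 = 1) (hc : ∀ n, 0 ≤ c n) (hu0 : ∀ n, 0 ≤ u n)
    (hu : ∀ n, ∑ k ∈ Finset.range (n + 1), u k * c (n - k) = 1) (n : ℕ) : u n ≤ 1 := by
  have h := hu n
  rw [Finset.sum_range_succ, Nat.sub_self, h0, mul_one] at h
  have : 0 ≤ ∑ k ∈ Finset.range n, u k * c (n - k) :=
    Finset.sum_nonneg fun k _ => mul_nonneg (hu0 k) (hc _)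
  linarith

theorem one_le_tsum_of_zero_eq_one (h0 : c 0 = 1) (hc : ∀ n, 0 ≤ c n) (hs : Summable c) :
    1 ≤ ∑' n, c n := by
  rw [← h0]
  exact hs.le_tsum 0 fun n _ => hc n

theorem abs_renewal_sub_le_one (h0 : c 0 = 1) (hc : ∀ n, 0 ≤ c n) (hs : Summable c)
    (hu0 : ∀ n, 0 ≤ u n) (hu : ∀ n, ∑ k ∈ Finset.range (n + 1), u k * c (n - k) = 1) (n : ℕ) :
    |u n - (∑' j, c j)⁻¹| ≤ 1 := by
  have h1 := one_le_tsum_of_zero_eq_one h0 hc hs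
  have h2 : (∑' j, c j)⁻¹ ≤ 1 := inv_le_one_of_one_le₀ h1
  have h3 : 0 ≤ (∑' j, c j)⁻¹ := by positivity
  have h4 := renewal_le_one h0 hc hu0 hu n
  rw [abs_le]
  constructor <;> linarith [hu0 n]

/-- This is the Cauchy product of `renewal_deviation`. Inside the unit disc |u_n - (∑ c)⁻¹| ≤ 1
gives absolute convergence, and the quotient then continues the sum beyond the disc. -/
theorem hasSum_renewal_deviation (h0 : c 0 = 1) (hanti : Antitone c) (hc : ∀ n, 0 ≤ c n)
    (hs : Summable c) (hu0 : ∀ n, 0 ≤ u n)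
    (hu : ∀ n, ∑ k ∈ Finset.range (n + 1), u k * c (n - k) = 1) {z : ℂ} (hz : ‖z‖ < 1) :
    HasSum (fun n => ((u n - (∑' j, c j)⁻¹ : ℝ) : ℂ) * z ^ n)
      ((∑' j, c j : ℝ)⁻¹ * genFun (tailSum c) z / genFun c z) := by
  have hpos : 0 < ∑' j, c j := zero_lt_one.trans_le (one_le_tsum_of_zero_eq_one h0 hc hs)
  have hne := genFun_ne_zero_of_norm_lt_one h0 hanti hc hs hz
  have hsf : Summable fun n => ‖((u n - (∑' j, c j)⁻¹ : ℝ) : ℂ) * z ^ n‖ := by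
    refine (summable_geometric_of_lt_one (norm_nonneg z) hz).of_nonneg_of_le
      (fun n => norm_nonneg _) fun n => ?_
    rw [norm_mul, norm_pow, Complex.norm_real]
    exact mul_le_of_le_one_left (by positivity) (abs_renewal_sub_le_one h0 hc hs hu0 hu n)
  have hsc := summable_genFun (R := 1) hc (by simpa using hs) hz.le
  have hprod := tsum_mul_tsum_eq_tsum_sum_range_of_summable_norm hsf hsc
  have hterm : ∀ n, ∑ k ∈ Finset.range (n + 1),
      ((u k - (∑' j, c j)⁻¹ : ℝ) : ℂ) * z ^ k * ((c (n - k) : ℂ) * z ^ (n - k))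
      = (∑' j, c j : ℝ)⁻¹ * ((tailSum c n : ℂ) * z ^ n) := by
    intro n
    rw [← mul_assoc, ← Complex.ofReal_mul, ← renewal_deviation hs hpos hu n,
      Complex.ofReal_sum, Finset.sum_mul]
    refine Finset.sum_congr rfl fun k hk => ?_
    have hk' : k ≤ n := by simpa [Nat.lt_succ_iff] using hk
    rw [← Nat.add_sub_of_le hk', pow_add, Nat.add_sub_cancel_left]
    push_cast
    ring
  simp_rw [hterm, tsum_mul_left] at hprod
  have : (∑' j, c j : ℝ)⁻¹ * genFun (tailSum c) z / genFun c z
      = ∑' n, ((u n - (∑' j, c j)⁻¹ : ℝ) : ℂ) * z ^ n := by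
    rw [div_eq_iff hne, genFun, genFun]
    exact hprod.symm
  rw [this]
  exact hsf.of_norm.hasSum

/-- A lower bound for the generating function on an annulus yields a geometric rate in the renewal
theorem. -/
theorem abs_renewal_sub_mul_pow_le (h0 : c 0 = 1) (hanti : Antitone c) (hc : ∀ n, 0 ≤ c n)
    (hu0 : ∀ n, 0 ≤ u n) (hu : ∀ n, ∑ k ∈ Finset.range (n + 1), u k * c (n - k) = 1)
    {r R δ : ℝ} (hr : 1 < r) (hrR : r < R) (h : Summable fun n => c n * R ^ n) (hδ : 0 < δ)
    (hlow : ∀ z : ℂ, 1 ≤ ‖z‖ → ‖z‖ ≤ r → δ ≤ ‖genFun c z‖) (n : ℕ) :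
    |u n - (∑' j, c j)⁻¹| * r ^ n
      ≤ (∑' j, c j)⁻¹ * ((∑' n, c n * r ^ n - ∑' n, c n) / ((r - 1) * δ)) := by
  have hR : 1 ≤ R := by linarith
  have hr0 : 0 < r := by linarith
  have hs := summable_of_summable_mul_pow hc hR h
  have hpos : 0 < ∑' j, c j := zero_lt_one.trans_le (one_le_tsum_of_zero_eq_one h0 hc hs)
  have hst := summable_tailSum_mul_pow hc hr0.le hrR hR h
  have hne : ∀ z : ℂ, ‖z‖ ≤ r → genFun c z ≠ 0 := by
    intro z hz
    rcases lt_or_ge ‖z‖ 1 with h1 | h1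
    · exact genFun_ne_zero_of_norm_lt_one h0 hanti hc hs h1
    · exact norm_pos_iff.1 (hδ.trans_le (hlow z h1 hz))
  -- Holomorphy on the closed disc of radius `r` is obtained from an open disc of radius r' on which
  -- the tails are still summable; this needs r' < R strictly.
  obtain ⟨r', hr', hr'R⟩ := exists_between hrR
  have hsub : Metric.closedBall (0 : ℂ) r ⊆ Metric.ball 0 r' := Metric.closedBall_subset_ball hr'
  have hst' := summable_tailSum_mul_pow hc (hr0.le.trans hr'.le) hr'R hR h
  have hsr' := summable_mul_pow_of_le hc (hr0.le.trans hr'.le) hr'R.le h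
  have hdiff : DifferentiableOn ℂ
      (fun z => (∑' j, c j : ℝ)⁻¹ * genFun (tailSum c) z / genFun c z) (Metric.closedBall 0 r) :=
    (((differentiableOn_genFun (tailSum_nonneg hc) hst').mono hsub).const_mul _).div
      ((differentiableOn_genFun hc hsr').mono hsub) fun z hz => hne z (by simpa using hz)
  have := norm_coeff_le_of_hasSum (f := fun n => ((u n - (∑' j, c j)⁻¹ : ℝ) : ℂ))
    (B := (∑' j, c j)⁻¹ * ((∑' n, c n * r ^ n - ∑' n, c n) / ((r - 1) * δ))) hr0 hdiff ?_
    (fun z hz => hasSum_renewal_deviation h0 hanti hc hs hu0 hu hz) n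
  · rwa [Complex.norm_real, Real.norm_eq_abs] at this
  · intro z hz
    have h1 : ‖genFun (tailSum c) z‖ ≤ (∑' n, c n * r ^ n - ∑' n, c n) / (r - 1) := by
      rw [← tsum_tailSum_mul_pow hc hr hrR h]
      exact norm_genFun_le (tailSum_nonneg hc) hst hz.le
    have h2 := hlow z (by rw [hz]; exact hr.le) hz.le
    rw [norm_div, norm_mul, Complex.norm_real, Real.norm_of_nonneg (inv_nonneg.2 hpos.le),
      mul_div_assoc, ← div_div]
    exact mul_le_mul_of_nonneg_left (div_le_div₀ ((norm_nonneg _).trans h1) h1 hδ h2)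
      (inv_nonneg.2 hpos.le)

/-- The renewal theorem of Kendall with the rate given by `kendallBound`. -/
theorem abs_renewal_sub_le_kendallBound (h0 : c 0 = 1) (hanti : Antitone c) (hc : ∀ n, 0 ≤ c n)
    (hu0 : ∀ n, 0 ≤ u n) (hu : ∀ n, ∑ k ∈ Finset.range (n + 1), u k * c (n - k) = 1)
    {b α r R L : ℝ} (hb0 : 0 < b) (hb1 : b < 1) (hb : c 1 ≤ 1 - b) (hr : 1 < r) (hrR : r < R)
    (h : Summable fun n => c n * R ^ n) (hα : 0 < α) (hcα : ∑' n, c (n + 1) = (1 - b) * α)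
    (hL : ∑' n, c (n + 1) * R ^ (n + 1) ≤ (L - 1) / (R - 1) - 1)
    (hκ : r ^ kendallKappa b R L α < 1 + kendallD b α / α) (n : ℕ) :
    |u n - (∑' j, c j)⁻¹| * r ^ n ≤ (∑' j, c j)⁻¹ * kendallBound b R L α r := by
  have hR : 1 < R := by linarith
  have hb' : 0 < 1 - b := by linarith
  have hm : 0 < (1 - b) * α := mul_pos hb' hα
  have hs := summable_of_summable_mul_pow hc hR.le h
  have hsr := summable_mul_pow_of_le hc (by linarith) hrR.le h
  have hpos : 0 < ∑' j, c j := zero_lt_one.trans_le (one_le_tsum_of_zero_eq_one h0 hc hs)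
  have hM : 0 < (L - 1) / (R - 1) - 1 := by
    refine lt_of_lt_of_le hm (le_trans ?_ hL)
    rw [← hcα]
    refine Summable.tsum_le_tsum (fun n => ?_) ((summable_nat_add_iff 1).2 hs)
      ((summable_nat_add_iff 1).2 h)
    exact le_mul_of_one_le_right (hc _) (one_le_pow₀ hR.le)
  -- The constant term drops out of the difference. The interpolation has m = (1-b)α and y =
  -- (N-1)/((1-b)α), so its exponent is exactly κ(α).
  have hH : ∑' n, c n * r ^ n - ∑' n, c n ≤ (1 - b) * α * (r ^ kendallKappa b R L α - 1) := by
    rw [tsum_mul_pow_sub_tsum hc hr.le hsr, hcα]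
    have := tsum_succ_mul_pow_le_mul_rpow hc hr.le hrR.le hR (div_pos hM hm) h hcα.le
      (by rw [div_mul_cancel₀ _ hm.ne']; exact hL)
    rw [kendallKappa]
    linarith
  have hδ : 0 < (1 - b) * α * (kendallD b α / α - r ^ kendallKappa b R L α + 1) :=
    mul_pos hm (by linarith)
  -- Project `z` radially to the unit circle, use the lower bound (1-b)D(α) there, and subtract the
  -- radial variation.
  have hlow : ∀ z : ℂ, 1 ≤ ‖z‖ → ‖z‖ ≤ r →
      (1 - b) * α * (kendallD b α / α - r ^ kendallKappa b R L α + 1) ≤ ‖genFun c z‖ := by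
    intro z hz1 hzr
    have h1 := norm_genFun_sub_le hc hsr hz1 hzr
    have h2 := mul_kendallD_le_norm_genFun hb0 hb1 h0 hanti hc hb hs hα.le hcα.le
      (z := z / ‖z‖) (by rw [norm_div, Complex.norm_real, norm_norm, div_self (by linarith)])
    have h3 : ‖genFun c (z / ‖z‖)‖ ≤ ‖genFun c z‖ + ‖genFun c z - genFun c (z / ‖z‖)‖ := by
      rw [norm_sub_rev]; exact norm_le_norm_add_norm_sub' _ _
    have h4 : (1 - b) * α * (kendallD b α / α - r ^ kendallKappa b R L α + 1)
        = (1 - b) * kendallD b α - (1 - b) * α * (r ^ kendallKappa b R L α - 1) := by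
      field_simp
      ring
    linarith
  refine (abs_renewal_sub_mul_pow_le h0 hanti hc hu0 hu hr hrR h hδ hlow n).trans ?_
  refine mul_le_mul_of_nonneg_left ?_ (inv_nonneg.2 hpos.le)
  rw [kendallBound, ← mul_div_mul_left (r ^ kendallKappa b R L α - 1) _ hm.ne']
  refine div_le_div₀ ((sub_nonneg.2 ?_).trans hH) hH ?_ (le_of_eq (by ring))
  · exact hs.tsum_le_tsum (fun n => le_mul_of_one_le_right (hc n) (one_le_pow₀ hr.le)) hsr
  · have : 0 < r - 1 := by linarith
    have : 0 < kendallD b α / α - r ^ kendallKappa b R L α + 1 := by linarith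
    positivity

/-- A rate in the renewal theorem when `∑_{j ≥ 1} cⱼ rʲ < 1`. -/
theorem abs_renewal_sub_le_of_tsum_lt_one (h0 : c 0 = 1) (hc : ∀ n, 0 ≤ c n)
    (hu : ∀ n, ∑ k ∈ Finset.range (n + 1), u k * c (n - k) = 1)
    {r T : ℝ} (hr : 1 ≤ r) (h : Summable fun n => c n * r ^ n)
    (hT : ∑' n, c (n + 1) * r ^ (n + 1) ≤ T) (hT1 : T < 1) (n : ℕ) :
    |u n - (∑' j, c j)⁻¹| * r ^ n ≤ T / (r * (1 - T)) := by
  have hr0 : 0 < r := by linarith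
  have hs := summable_of_summable_mul_pow hc hr h
  have hone := one_le_tsum_of_zero_eq_one h0 hc hs
  have hpos : 0 < ∑' j, c j := zero_lt_one.trans_le hone
  have h' : Summable fun n => c (n + 1) * r ^ (n + 1) := (summable_nat_add_iff 1).2 h
  have hT0 : 0 ≤ T := (tsum_nonneg fun n => mul_nonneg (hc _) (by positivity)).trans hT
  -- The claimed constant x is the fixed point of x = T/r + T x: the tail contributes at most T/r,
  -- and earlier deviations at most T x.
  have hB : T / r + T * (T / (r * (1 - T))) = T / (r * (1 - T)) := by
    have : 1 - T ≠ 0 := by linarith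
    field_simp
    ring
  induction n using Nat.strong_induction_on with
  | _ n ih =>
    have hdev := renewal_deviation hs hpos hu n
    -- Reversing the convolution isolates the term with c 0 = 1, that is, the deviation at time `n`
    -- in terms of the earlier ones.
    rw [← Finset.sum_range_reflect, Finset.sum_range_succ'] at hdev
    simp only [Nat.add_sub_cancel, Nat.sub_zero, Nat.sub_self, h0, mul_one] at hdev
    have hterm : ∀ j ∈ Finset.range n,
        |(u (n - (j + 1)) - (∑' j, c j)⁻¹) * c (n - (n - (j + 1)))| * r ^ n
          ≤ c (j + 1) * r ^ (j + 1) * (T / (r * (1 - T))) := by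
      intro j hj
      have hj' : j < n := Finset.mem_range.1 hj
      have h1 := ih (n - (j + 1)) (by omega)
      have h2 : n - (n - (j + 1)) = j + 1 := by omega
      have h3 : r ^ n = r ^ (j + 1) * r ^ (n - (j + 1)) := by
        rw [← pow_add]; congr 1; omega
      rw [h2, abs_mul, abs_of_nonneg (hc _), h3]
      have h4 : 0 ≤ c (j + 1) * r ^ (j + 1) := mul_nonneg (hc _) (by positivity)
      calc _ = c (j + 1) * r ^ (j + 1)
            * (|u (n - (j + 1)) - (∑' j, c j)⁻¹| * r ^ (n - (j + 1))) := by ring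
        _ ≤ _ := mul_le_mul_of_nonneg_left h1 h4
    have hsum : (∑ j ∈ Finset.range n,
        |(u (n - (j + 1)) - (∑' j, c j)⁻¹) * c (n - (n - (j + 1)))|) * r ^ n
          ≤ (∑ j ∈ Finset.range n, c (j + 1) * r ^ (j + 1)) * (T / (r * (1 - T))) := by
      rw [Finset.sum_mul, Finset.sum_mul]
      exact Finset.sum_le_sum hterm
    have habs : |u n - (∑' j, c j)⁻¹| ≤ (∑' j, c j)⁻¹ * tailSum c n + ∑ j ∈ Finset.range n,
        |(u (n - (j + 1)) - (∑' j, c j)⁻¹) * c (n - (n - (j + 1)))| := by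
      rw [eq_sub_of_add_eq' hdev]
      refine (abs_sub _ _).trans ?_
      rw [abs_of_nonneg (mul_nonneg (inv_nonneg.2 hpos.le) (tailSum_nonneg hc n))]
      gcongr
      exact Finset.abs_sum_le_sum_abs _ _
    have htail : (∑' j, c j)⁻¹ * tailSum c n * r ^ n
        ≤ (∑' j, c (n + 1 + j) * r ^ (n + 1 + j)) / r := by
      rw [le_div_iff₀ hr0]
      refine le_trans (le_of_eq ?_) ((mul_le_of_le_one_left ?_ (inv_le_one_of_one_le₀ hone)).trans
        (tailSum_mul_pow_le hc hr h n))
      · rw [pow_succ]; ring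
      · exact mul_nonneg (tailSum_nonneg hc n) (by positivity)
    have hsplit : ∑ j ∈ Finset.range n, c (j + 1) * r ^ (j + 1)
        + ∑' j, c (n + 1 + j) * r ^ (n + 1 + j) ≤ T := by
      refine le_trans (le_of_eq ?_) hT
      rw [← h'.sum_add_tsum_nat_add n]
      congr 1
      exact tsum_congr fun j => by rw [show j + n + 1 = n + 1 + j by ring]
    set X := ∑ j ∈ Finset.range n, c (j + 1) * r ^ (j + 1)
    set Y := ∑' j, c (n + 1 + j) * r ^ (n + 1 + j)
    have hX0 : 0 ≤ X := Finset.sum_nonneg fun j _ => mul_nonneg (hc _) (by positivity)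
    have hY0 : 0 ≤ Y := tsum_nonneg fun j => mul_nonneg (hc _) (by positivity)
    have hK0 : 0 ≤ T / (r * (1 - T)) := div_nonneg hT0 (mul_nonneg hr0.le (by linarith))
    calc |u n - (∑' j, c j)⁻¹| * r ^ n
        ≤ Y / r + X * (T / (r * (1 - T))) := by
          have := mul_le_mul_of_nonneg_right habs (pow_nonneg hr0.le n)
          rw [add_mul] at this
          linarith
      _ ≤ T / r + T * (T / (r * (1 - T))) := by
          gcongr <;> linarith
      _ = _ := hB

end Renewal

/-! ### Taboo laws, first entrance and last exit decompositions. -/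

section Taboo

variable {S : Type*} [MeasurableSpace S]

/-- The law of the chain at time `n` on the event that it has not visited `C` at times `< n`, for
the initial measure `η`. -/
noncomputable def taboo (P : Kernel S S) (C : Set S) (η : Measure S) : ℕ → Measure S
  | 0 => η
  | n + 1 => P ∘ₘ ((taboo P C η n).restrict Cᶜ)

/-- The renewal sequence of the visits to `C` for the atom law `ν`. -/
noncomputable def renewalSeq (P : Kernel S S) (C : Set S) (ν : Measure S) : ℕ → ℝ≥0∞
  | 0 => 1
  | n + 1 => ((P ^ n) ∘ₘ ν) C

variable {P : Kernel S S} {C : Set S} {ν : Measure S}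

theorem comp_finset_sum {ι : Type*} (κ : Kernel S S) (s : Finset ι) (μ : ι → Measure S) :
    κ ∘ₘ (∑ i ∈ s, μ i) = ∑ i ∈ s, κ ∘ₘ μ i := by
  classical
  induction s using Finset.induction_on with
  | empty => simp
  | insert i s hi ih => rw [Finset.sum_insert hi, Finset.sum_insert hi, Measure.comp_add, ih]

theorem one_comp_measure (η : Measure S) : (1 : Kernel S S) ∘ₘ η = η :=
  Measure.id_comp

theorem comp_pow_succ (κ : Kernel S S) (n : ℕ) (η : Measure S) :
    (κ ^ (n + 1)) ∘ₘ η = κ ∘ₘ ((κ ^ n) ∘ₘ η) := by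
  rw [add_comm, Kernel.pow_add, pow_one, Measure.comp_assoc]

/-- The mass on `C` moves by the single law `ν`. Iterating this one-step splitting yields both
decompositions below. -/
theorem comp_eq_smul_add (hC : MeasurableSet C) (hν : ∀ x ∈ C, P x = ν) (μ : Measure S) :
    P ∘ₘ μ = μ C • ν + P ∘ₘ (μ.restrict Cᶜ) := by
  conv_lhs => rw [← Measure.restrict_add_restrict_compl (μ := μ) hC]
  rw [Measure.comp_add]
  congr 1
  have : P ∘ₘ μ.restrict C = (μ.restrict C).bind fun _ => ν :=
    Measure.bind_congr_right ((ae_restrict_iff' hC).2 (Filter.Eventually.of_forall hν))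
  rw [this, Measure.bind_const, Measure.restrict_apply_univ]

/-- First entrance decomposition. -/
theorem pow_comp_eq_taboo_add (hC : MeasurableSet C) (hν : ∀ x ∈ C, P x = ν) (η : Measure S)
    (n : ℕ) : (P ^ n) ∘ₘ η = taboo P C η n
      + ∑ k ∈ Finset.range n, (taboo P C η k) C • ((P ^ (n - 1 - k)) ∘ₘ ν) := by
  induction n with
  | zero => simp [taboo, one_comp_measure]
  | succ n ih =>
    rw [comp_pow_succ, ih, Measure.comp_add, comp_eq_smul_add hC hν (taboo P C η n),
      comp_finset_sum, Finset.sum_range_succ, add_comm (_ • ν), add_assoc]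
    have h1 : taboo P C η (n + 1) = P ∘ₘ ((taboo P C η n).restrict Cᶜ) := rfl
    rw [h1, add_comm ((taboo P C η n) C • ν)]
    congr 2
    · refine Finset.sum_congr rfl fun k hk => ?_
      have hk' : k < n := Finset.mem_range.1 hk
      rw [Measure.comp_smul, ← comp_pow_succ, show n - 1 - k + 1 = n + 1 - 1 - k by omega]
    · simp [one_comp_measure]

/-- Last exit decomposition. -/
theorem pow_comp_eq_sum_renewalSeq (hC : MeasurableSet C) (hν : ∀ x ∈ C, P x = ν) (n : ℕ) :
    (P ^ n) ∘ₘ ν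
      = ∑ k ∈ Finset.range (n + 1), renewalSeq P C ν k • taboo P C ν (n - k) := by
  induction n with
  | zero => simp [taboo, renewalSeq, one_comp_measure]
  | succ n ih =>
    rw [comp_pow_succ, comp_eq_smul_add hC hν, Finset.sum_range_succ, add_comm]
    congr 1
    · rw [ih, ← Measure.restrictₗ_apply, map_sum, comp_finset_sum]
      refine Finset.sum_congr rfl fun k hk => ?_
      have hk' : k < n + 1 := Finset.mem_range.1 hk
      rw [map_smul, Measure.restrictₗ_apply, Measure.comp_smul,
        show n + 1 - k = (n - k) + 1 by omega]
      rfl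
    · simp [taboo, renewalSeq]

theorem taboo_succ_apply_univ [IsMarkovKernel P] (η : Measure S) (n : ℕ) :
    taboo P C η (n + 1) Set.univ = taboo P C η n Cᶜ := by
  rw [taboo, Measure.bind_apply MeasurableSet.univ P.aemeasurable]
  simp

theorem taboo_univ_succ_le [IsMarkovKernel P] (η : Measure S) (n : ℕ) :
    taboo P C η (n + 1) Set.univ ≤ taboo P C η n Set.univ := by
  rw [taboo_succ_apply_univ]
  exact measure_mono (Set.subset_univ _)

instance isFiniteMeasure_taboo [IsMarkovKernel P] (η : Measure S) [IsFiniteMeasure η] (n : ℕ) :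
    IsFiniteMeasure (taboo P C η n) := by
  induction n with
  | zero => exact ‹IsFiniteMeasure η›
  | succ n ih => exact ⟨(taboo_univ_succ_le η n).trans_lt (measure_lt_top _ _)⟩

instance isMarkovKernel_pow [IsMarkovKernel P] (n : ℕ) : IsMarkovKernel (P ^ n) := by
  induction n with
  | zero => rw [pow_zero]; exact inferInstanceAs (IsMarkovKernel (Kernel.id : Kernel S S))
  | succ n ih => rw [Kernel.pow_add, pow_one]; infer_instance

theorem renewalSeq_le_one [IsMarkovKernel P] [IsProbabilityMeasure ν] (n : ℕ) :
    renewalSeq P C ν n ≤ 1 := by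
  rcases n with _ | n
  · exact le_rfl
  · exact prob_le_one

theorem sum_renewalSeq_mul_taboo [IsMarkovKernel P] [IsProbabilityMeasure ν] (hC : MeasurableSet C)
    (hν : ∀ x ∈ C, P x = ν) (n : ℕ) : ∑ k ∈ Finset.range (n + 1),
      (renewalSeq P C ν k).toReal * (taboo P C ν (n - k)).real Set.univ = 1 := by
  have h := congrArg (fun μ : Measure S => μ Set.univ) (pow_comp_eq_sum_renewalSeq hC hν n)
  simp only [measure_univ, Measure.finsetSum_apply, Measure.smul_apply, smul_eq_mul] at h
  have h2 := congrArg ENNReal.toReal h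
  rw [ENNReal.toReal_sum fun k _ => ENNReal.mul_ne_top
    ((renewalSeq_le_one k).trans_lt ENNReal.one_lt_top).ne (measure_ne_top _ _)] at h2
  simp only [ENNReal.toReal_one, ENNReal.toReal_mul] at h2
  exact h2.symm

end Taboo

/-! ### Consequences of a scalar drift recursion. -/

section DriftSequence

variable {v p : ℕ → ℝ} {l : ℝ}

/-- In the application v_n is the integral of V - 1 and p_n the mass outside `C`. The quantity r^n
v_n/(1 - rl) is a potential that pays for the n-th summand. -/
theorem drift_sum_add_le (hp : ∀ n, 0 ≤ p n)
    (hstep : ∀ n, v (n + 1) + (1 - l) * p n ≤ l * v n) {r : ℝ} (hr : 1 ≤ r) (hrl : r * l < 1)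
    (n : ℕ) : ∑ j ∈ Finset.range n, r ^ j * (v j + p j) + r ^ n * v n / (1 - r * l)
      ≤ v 0 / (1 - r * l) := by
  have h1 : 0 < 1 - r * l := by linarith
  induction n with
  | zero => simp
  | succ n ih =>
    refine le_trans ?_ ih
    rw [Finset.sum_range_succ, add_assoc]
    gcongr
    rw [le_div_iff₀ h1, add_mul, div_mul_cancel₀ _ h1.ne']
    have h2 : 0 < r ^ n := by positivity
    have h3 := mul_le_mul_of_nonneg_left (hstep n) (show 0 ≤ r by linarith)
    -- After inserting the recursion the left side is at most v_n + (1 - r)p_n, which is where r ≥ 1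
    -- enters.
    have h4 : (v n + p n) * (1 - r * l) + r * v (n + 1) ≤ v n := by
      have := mul_nonneg (hp n) (sub_nonneg.2 hr)
      nlinarith
    have h5 := mul_le_mul_of_nonneg_left h4 h2.le
    rw [pow_succ]
    linarith

theorem drift_sum_le (hv : ∀ n, 0 ≤ v n) (hp : ∀ n, 0 ≤ p n)
    (hstep : ∀ n, v (n + 1) + (1 - l) * p n ≤ l * v n) {r : ℝ} (hr : 1 ≤ r) (hrl : r * l < 1)
    (n : ℕ) : ∑ j ∈ Finset.range n, r ^ j * (v j + p j) ≤ v 0 / (1 - r * l) := by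
  have h1 : 0 ≤ r ^ n * v n / (1 - r * l) :=
    div_nonneg (mul_nonneg (by positivity) (hv n)) (by linarith)
  linarith [drift_sum_add_le hp hstep hr hrl n]

theorem drift_le_pow (hl0 : 0 ≤ l) (hl1 : l ≤ 1) (hp : ∀ n, 0 ≤ p n)
    (hstep : ∀ n, v (n + 1) + (1 - l) * p n ≤ l * v n) (n : ℕ) : v n ≤ l ^ n * v 0 := by
  induction n with
  | zero => simp
  | succ n ih =>
    have h1 := mul_nonneg (sub_nonneg.2 hl1) (hp n)
    have h2 := mul_le_mul_of_nonneg_left ih hl0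
    rw [pow_succ]
    linarith [hstep n]

theorem drift_mass_le (hl0 : 0 ≤ l) (hl1 : l < 1) (hv : ∀ n, 0 ≤ v n) (hp : ∀ n, 0 ≤ p n)
    (hstep : ∀ n, v (n + 1) + (1 - l) * p n ≤ l * v n) (n : ℕ) :
    p n ≤ l ^ (n + 1) * v 0 / (1 - l) := by
  rw [le_div_iff₀ (by linarith), pow_succ]
  have h := mul_le_mul_of_nonneg_left (drift_le_pow hl0 hl1.le hp hstep n) hl0
  linarith [hstep n, hv (n + 1)]

theorem drift_tail_le (hl0 : 0 ≤ l) (hl1 : l < 1) (hv : ∀ n, 0 ≤ v n) (hp : ∀ n, 0 ≤ p n)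
    (hstep : ∀ n, v (n + 1) + (1 - l) * p n ≤ l * v n) (m n : ℕ) :
    ∑ j ∈ Finset.range n, (v (m + j) + p (m + j)) ≤ l ^ m * v 0 / (1 - l) := by
  have h := drift_sum_le (v := fun j => v (m + j)) (p := fun j => p (m + j)) (fun _ => hv _)
    (fun _ => hp _) (fun j => hstep (m + j)) le_rfl (by linarith) n
  simp only [one_pow, one_mul, add_zero] at h
  exact h.trans (div_le_div_of_nonneg_right (drift_le_pow hl0 hl1.le hp hstep m) (by linarith))

/-- Telescoping l⁻ⁿ v_n controls the masses at the endpoint radius 1/l itself, where `drift_sum_le`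
breaks down because its denominator vanishes. -/
theorem drift_mass_sum_le (hl0 : 0 < l) (hv : ∀ n, 0 ≤ v n)
    (hstep : ∀ n, v (n + 1) + (1 - l) * p n ≤ l * v n) (n : ℕ) :
    (l⁻¹ - 1) * ∑ j ∈ Finset.range n, l⁻¹ ^ j * p j ≤ v 0 := by
  have key : (l⁻¹ - 1) * ∑ j ∈ Finset.range n, l⁻¹ ^ j * p j + l⁻¹ ^ n * v n ≤ v 0 := by
    induction n with
    | zero => simp
    | succ n ih =>
      refine le_trans ?_ ih
      have h1 := mul_le_mul_of_nonneg_left (hstep n) (show 0 ≤ l⁻¹ ^ (n + 1) by positivity)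
      have h2 : l⁻¹ ^ (n + 1) * (l * v n) = l⁻¹ ^ n * v n := by
        rw [pow_succ]; field_simp
      have h3 : l⁻¹ ^ (n + 1) * ((1 - l) * p n) = (l⁻¹ - 1) * (l⁻¹ ^ n * p n) := by
        rw [pow_succ]; field_simp
      rw [mul_add, h2, h3] at h1
      rw [Finset.sum_range_succ, mul_add]
      linarith
  have : 0 ≤ l⁻¹ ^ n * v n := mul_nonneg (by positivity) (hv n)
  linarith

end DriftSequence

/-! ### The drift condition along taboo laws. -/

section Drift

variable {S : Type*} [MeasurableSpace S]

/-- A geometric drift condition towards an atom `C` with regeneration law `ν`. -/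
structure AtomDrift (P : Kernel S S) (C : Set S) (ν : Measure S) (V : Weight S) (l K : ℝ) :
    Prop where
  measurableSet : MeasurableSet C
  pos : 0 < l
  lt_one : l < 1
  atom : ∀ x ∈ C, P x = ν
  drift : ∀ x, x ∉ C → ∫⁻ y, ENNReal.ofReal (V y) ∂(P x) ≤ ENNReal.ofReal (l * V x)
  drift_atom : ∫⁻ y, ENNReal.ofReal (V y) ∂ν ≤ ENNReal.ofReal K

/-- The integral of `V` for the taboo law at time `n`. -/
noncomputable def tabooV (P : Kernel S S) (C : Set S) (V : Weight S) (η : Measure S) (n : ℕ) : ℝ :=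
  (∫⁻ x, ENNReal.ofReal (V x) ∂(taboo P C η n)).toReal

/-- The integral of `V - 1` over the complement of `C` for the taboo law at time `n`. -/
noncomputable def tabooExcess (P : Kernel S S) (C : Set S) (V : Weight S) (η : Measure S) (n : ℕ) :
    ℝ :=
  (∫⁻ x in Cᶜ, ENNReal.ofReal (V x - 1) ∂(taboo P C η n)).toReal

/-- The mass outside `C` of the taboo law at time `n`. -/
noncomputable def tabooMass (P : Kernel S S) (C : Set S) (η : Measure S) (n : ℕ) : ℝ :=
  (taboo P C η n).real Cᶜ

theorem Weight.measurable_ofReal (V : Weight S) : Measurable fun x => ENNReal.ofReal (V x) :=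
  V.measurable_toFun.ennreal_ofReal

theorem Weight.measurable_ofReal_sub_one (V : Weight S) :
    Measurable fun x => ENNReal.ofReal (V x - 1) :=
  (V.measurable_toFun.sub_const 1).ennreal_ofReal

theorem Weight.ofReal_eq (V : Weight S) (x : S) :
    ENNReal.ofReal (V x) = ENNReal.ofReal (V x - 1) + 1 := by
  rw [← ENNReal.ofReal_one, ← ENNReal.ofReal_add (sub_nonneg.2 (V.one_le_toFun x)) zero_le_one,
    sub_add_cancel]

theorem Weight.lintegral_ofReal (V : Weight S) (μ : Measure S) :
    ∫⁻ x, ENNReal.ofReal (V x) ∂μ = ∫⁻ x, ENNReal.ofReal (V x - 1) ∂μ + μ Set.univ := by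
  simp_rw [V.ofReal_eq]
  rw [lintegral_add_right _ measurable_const]
  simp

variable {P : Kernel S S} {C : Set S} {ν : Measure S} {V : Weight S} {l K : ℝ}

theorem tabooExcess_nonneg (η : Measure S) (n : ℕ) : 0 ≤ tabooExcess P C V η n :=
  ENNReal.toReal_nonneg

theorem tabooMass_nonneg (η : Measure S) (n : ℕ) : 0 ≤ tabooMass P C η n :=
  measureReal_nonneg

theorem tabooV_nonneg (η : Measure S) (n : ℕ) : 0 ≤ tabooV P C V η n :=
  ENNReal.toReal_nonneg

theorem BV.integrable {μ : Measure S} (hμ : ∫⁻ x, ENNReal.ofReal (V x) ∂μ < ⊤) (g : BV V) :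
    Integrable (g : S → ℂ) μ := by
  refine ⟨g.measurable.aestronglyMeasurable, ?_⟩
  have h1 : ∫⁻ x, ‖g x‖ₑ ∂μ ≤ ∫⁻ x, ENNReal.ofReal ‖g‖ * ENNReal.ofReal (V x) ∂μ := by
    refine lintegral_mono fun x => ?_
    rw [← ENNReal.ofReal_mul (norm_nonneg g), ← ofReal_norm]
    exact ENNReal.ofReal_le_ofReal (g.norm_apply_le x)
  rw [lintegral_const_mul _ V.measurable_ofReal] at h1
  exact h1.trans_lt (ENNReal.mul_lt_top ENNReal.ofReal_lt_top hμ)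

theorem BV.norm_integral_le {μ : Measure S} (hμ : ∫⁻ x, ENNReal.ofReal (V x) ∂μ < ⊤) (g : BV V) :
    ‖∫ x, g x ∂μ‖ ≤ ‖g‖ * (∫⁻ x, ENNReal.ofReal (V x) ∂μ).toReal := by
  have hV : Integrable (fun x => V x) μ := by
    refine ⟨V.measurable_toFun.aestronglyMeasurable, ?_⟩
    refine (lintegral_congr fun x => ?_).trans_lt hμ
    rw [← ofReal_norm, Real.norm_of_nonneg (V.pos x).le]
  have h1 : ∫ x, V x ∂μ = (∫⁻ x, ENNReal.ofReal (V x) ∂μ).toReal :=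
    integral_eq_lintegral_of_nonneg_ae (Filter.Eventually.of_forall fun x => (V.pos x).le)
      V.measurable_toFun.aestronglyMeasurable
  rw [← h1, ← integral_const_mul]
  exact norm_integral_le_of_norm_le (hV.const_mul _)
    (Filter.Eventually.of_forall fun x => g.norm_apply_le x)

namespace AtomDrift

/-- Since P1 = 1, replacing V by V - 1 in the drift inequality leaves a gain 1 - l per unit of mass
outside `C`. This gain bounds the excursion lengths and sharpens the constants from `K` to K - 1. -/
theorem excess_le [IsMarkovKernel P] (hD : AtomDrift P C ν V l K) {x : S} (hx : x ∉ C) :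
    ∫⁻ y, ENNReal.ofReal (V y - 1) ∂(P x) + ENNReal.ofReal (1 - l)
      ≤ ENNReal.ofReal l * ENNReal.ofReal (V x - 1) := by
  have hl := hD.pos
  have hl1 := hD.lt_one
  have h := hD.drift x hx
  rw [V.lintegral_ofReal, measure_univ] at h
  have h1 : ENNReal.ofReal (l * V x)
      = ENNReal.ofReal l * ENNReal.ofReal (V x - 1) + ENNReal.ofReal l := by
    rw [← ENNReal.ofReal_mul hl.le, ← ENNReal.ofReal_add
      (mul_nonneg hl.le (sub_nonneg.2 (V.one_le_toFun x))) hl.le]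
    congr 1; ring
  have h2 : (1 : ℝ≥0∞) = ENNReal.ofReal (1 - l) + ENNReal.ofReal l := by
    rw [← ENNReal.ofReal_add (by linarith) hl.le]; simp
  rw [h1, h2, ← add_assoc] at h
  exact (ENNReal.add_le_add_iff_right ENNReal.ofReal_ne_top).1 h

theorem lintegral_taboo_succ_le (hD : AtomDrift P C ν V l K) (η : Measure S) (n : ℕ) :
    ∫⁻ x, ENNReal.ofReal (V x) ∂(taboo P C η (n + 1))
      ≤ ENNReal.ofReal l * ∫⁻ x in Cᶜ, ENNReal.ofReal (V x) ∂(taboo P C η n) := by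
  rw [taboo, Measure.lintegral_bind P.aemeasurable V.measurable_ofReal.aemeasurable,
    ← lintegral_const_mul _ V.measurable_ofReal]
  refine setLIntegral_mono' hD.measurableSet.compl fun x hx => ?_
  rw [← ENNReal.ofReal_mul hD.pos.le]
  exact hD.drift x hx

theorem lintegral_excess_succ_le
    [IsMarkovKernel P] (hD : AtomDrift P C ν V l K) (η : Measure S) (n : ℕ) :
    ∫⁻ x, ENNReal.ofReal (V x - 1) ∂(taboo P C η (n + 1))
        + ENNReal.ofReal (1 - l) * taboo P C η n Cᶜ
      ≤ ENNReal.ofReal l * ∫⁻ x in Cᶜ, ENNReal.ofReal (V x - 1) ∂(taboo P C η n) := by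
  rw [taboo, Measure.lintegral_bind P.aemeasurable V.measurable_ofReal_sub_one.aemeasurable,
    ← lintegral_const_mul _ V.measurable_ofReal_sub_one, ← setLIntegral_const,
    ← lintegral_add_right _ measurable_const]
  exact setLIntegral_mono' hD.measurableSet.compl fun x hx => hD.excess_le hx

theorem lintegral_taboo_lt_top (hD : AtomDrift P C ν V l K) {η : Measure S} (hη : ∫⁻ x, ENNReal.ofReal (V x) ∂η < ⊤) (n : ℕ) :
    ∫⁻ x, ENNReal.ofReal (V x) ∂(taboo P C η n) < ⊤ := by
  induction n with
  | zero => exact hη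
  | succ n ih =>
    refine (hD.lintegral_taboo_succ_le η n).trans_lt (ENNReal.mul_lt_top ENNReal.ofReal_lt_top ?_)
    exact (setLIntegral_le_lintegral _ _).trans_lt ih

theorem lintegral_excess_lt_top (hD : AtomDrift P C ν V l K) {η : Measure S} (hη : ∫⁻ x, ENNReal.ofReal (V x) ∂η < ⊤) (n : ℕ) :
    ∫⁻ x, ENNReal.ofReal (V x - 1) ∂(taboo P C η n) < ⊤ :=
  (lintegral_mono fun x => ENNReal.ofReal_le_ofReal (by linarith)).trans_lt
    (hD.lintegral_taboo_lt_top hη n)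

theorem lintegral_compl_eq [IsMarkovKernel P] (hD : AtomDrift P C ν V l K) {η : Measure S}
    [IsFiniteMeasure η]
    (hη : ∫⁻ x, ENNReal.ofReal (V x) ∂η < ⊤) (n : ℕ) :
    (∫⁻ x in Cᶜ, ENNReal.ofReal (V x) ∂(taboo P C η n)).toReal
      = tabooExcess P C V η n + tabooMass P C η n := by
  rw [V.lintegral_ofReal, Measure.restrict_apply_univ, ENNReal.toReal_add]
  · rfl
  · exact ((setLIntegral_le_lintegral _ _).trans_lt (hD.lintegral_excess_lt_top hη n)).ne
  · exact measure_ne_top _ _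

theorem tabooV_succ_le [IsMarkovKernel P] (hD : AtomDrift P C ν V l K) {η : Measure S}
    [IsFiniteMeasure η]
    (hη : ∫⁻ x, ENNReal.ofReal (V x) ∂η < ⊤) (n : ℕ) :
    tabooV P C V η (n + 1) ≤ l * (tabooExcess P C V η n + tabooMass P C η n) := by
  rw [← hD.lintegral_compl_eq hη, tabooV, ← ENNReal.toReal_ofReal_mul _ _ hD.pos.le]
  refine ENNReal.toReal_mono ?_ (hD.lintegral_taboo_succ_le η n)
  exact ENNReal.mul_ne_top ENNReal.ofReal_ne_top
    ((setLIntegral_le_lintegral _ _).trans_lt (hD.lintegral_taboo_lt_top hη n)).ne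

theorem tabooExcess_succ_le [IsMarkovKernel P] (hD : AtomDrift P C ν V l K) {η : Measure S}
    [IsFiniteMeasure η]
    (hη : ∫⁻ x, ENNReal.ofReal (V x) ∂η < ⊤) (n : ℕ) :
    tabooExcess P C V η (n + 1) + (1 - l) * tabooMass P C η n ≤ l * tabooExcess P C V η n := by
  have hfin : ∀ n, ∫⁻ x in Cᶜ, ENNReal.ofReal (V x - 1) ∂(taboo P C η n) ≠ ⊤ := fun n =>
    ((setLIntegral_le_lintegral _ _).trans_lt (hD.lintegral_excess_lt_top hη n)).ne
  have h : ∫⁻ x in Cᶜ, ENNReal.ofReal (V x - 1) ∂(taboo P C η (n + 1))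
        + ENNReal.ofReal (1 - l) * taboo P C η n Cᶜ
      ≤ ENNReal.ofReal l * ∫⁻ x in Cᶜ, ENNReal.ofReal (V x - 1) ∂(taboo P C η n) :=
    le_trans (by gcongr; exact Measure.restrict_le_self) (hD.lintegral_excess_succ_le η n)
  have h2 := ENNReal.toReal_mono (ENNReal.mul_ne_top ENNReal.ofReal_ne_top (hfin n)) h
  rw [ENNReal.toReal_add (hfin _) (ENNReal.mul_ne_top ENNReal.ofReal_ne_top (measure_ne_top _ _)),
    ENNReal.toReal_ofReal_mul _ _ hD.pos.le,
    ENNReal.toReal_ofReal_mul _ _ (by linarith [hD.lt_one])] at h2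
  exact h2

theorem excess_add_mass_add_le [IsMarkovKernel P] (hD : AtomDrift P C ν V l K) {η : Measure S}
    [IsFiniteMeasure η]
    (hη : ∫⁻ x, ENNReal.ofReal (V x) ∂η < ⊤) (n : ℕ) :
    tabooExcess P C V η n + tabooMass P C η n + (taboo P C η n).real C ≤ tabooV P C V η n := by
  have hfin := (hD.lintegral_taboo_lt_top hη n).ne
  have hfin' : ∀ A, ∫⁻ x in A, ENNReal.ofReal (V x) ∂(taboo P C η n) ≠ ⊤ := fun A =>
    ((setLIntegral_le_lintegral _ _).trans_lt hfin.lt_top).ne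
  rw [← hD.lintegral_compl_eq hη, tabooV, ← lintegral_add_compl (μ := taboo P C η n) _ hD.measurableSet,
    ENNReal.toReal_add (hfin' _) (hfin' _), add_comm]
  gcongr
  refine ENNReal.toReal_mono (hfin' _) ?_
  rw [← setLIntegral_one]
  exact lintegral_mono fun x => ENNReal.one_le_ofReal.2 (V.one_le_toFun x)

end AtomDrift

end Drift

/-! ### Return times to the atom and moments of an excursion. -/

section Regeneration

variable {S : Type*} [MeasurableSpace S]

/-- The tail probabilities of the return time to the atom. -/
noncomputable def returnTail (P : Kernel S S) (C : Set S) (ν : Measure S) (n : ℕ) : ℝ :=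
  (taboo P C ν n).real Set.univ

/-- The regenerative representation of the invariant probability measure. -/
noncomputable def regenerativeMeasure (P : Kernel S S) (C : Set S) (ν : Measure S) : Measure S :=
  ENNReal.ofReal (∑' n, returnTail P C ν n)⁻¹ • Measure.sum (taboo P C ν)

variable {P : Kernel S S} {C : Set S} {ν : Measure S} {V : Weight S} {l K : ℝ}

theorem returnTail_nonneg (n : ℕ) : 0 ≤ returnTail P C ν n := measureReal_nonneg

theorem returnTail_zero [IsProbabilityMeasure ν] : returnTail P C ν 0 = 1 := by
  rw [returnTail, taboo, probReal_univ]

theorem taboo_succ_real_univ [IsMarkovKernel P] (η : Measure S) (n : ℕ) :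
    (taboo P C η (n + 1)).real Set.univ = tabooMass P C η n := by
  rw [tabooMass, measureReal_def, measureReal_def, taboo_succ_apply_univ]

theorem returnTail_succ [IsMarkovKernel P] (n : ℕ) : returnTail P C ν (n + 1) = tabooMass P C ν n :=
  taboo_succ_real_univ ν n

theorem tabooMass_add_real [IsMarkovKernel P] (hC : MeasurableSet C) (η : Measure S)
    [IsFiniteMeasure η] (n : ℕ) :
    tabooMass P C η n + (taboo P C η n).real C = (taboo P C η n).real Set.univ := by
  rw [tabooMass, add_comm, measureReal_add_measureReal_compl hC]

theorem returnTail_antitone [IsMarkovKernel P] [IsFiniteMeasure ν] : Antitone (returnTail P C ν) :=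
  antitone_nat_of_succ_le fun n =>
    ENNReal.toReal_mono (measure_ne_top _ _) (taboo_univ_succ_le ν n)

theorem sum_renewalSeq_mul_returnTail [IsMarkovKernel P]
    [IsProbabilityMeasure ν] (hC : MeasurableSet C)
    (hν : ∀ x ∈ C, P x = ν) (n : ℕ) : ∑ k ∈ Finset.range (n + 1),
      (renewalSeq P C ν k).toReal * returnTail P C ν (n - k) = 1 :=
  sum_renewalSeq_mul_taboo hC hν n

namespace AtomDrift

theorem lintegral_atom_lt_top (hD : AtomDrift P C ν V l K) :
    ∫⁻ x, ENNReal.ofReal (V x) ∂ν < ⊤ :=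
  hD.drift_atom.trans_lt ENNReal.ofReal_lt_top

theorem one_lt_inv (hD : AtomDrift P C ν V l K) : 1 < l⁻¹ := one_lt_inv₀ hD.pos |>.2 hD.lt_one

theorem const_nonneg [IsProbabilityMeasure ν] (hD : AtomDrift P C ν V l K) : 0 ≤ K := by
  by_contra h
  have h1 := hD.drift_atom
  rw [ENNReal.ofReal_of_nonpos (not_le.1 h).le, V.lintegral_ofReal, measure_univ] at h1
  simp at h1

theorem tabooV_zero_le [IsProbabilityMeasure ν] (hD : AtomDrift P C ν V l K) :
    tabooV P C V ν 0 ≤ K := by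
  have := ENNReal.toReal_mono ENNReal.ofReal_ne_top hD.drift_atom
  rwa [ENNReal.toReal_ofReal hD.const_nonneg] at this

/-- Both on and off `C`, V is at least 1, so splitting ν(V) ≤ K and removing the total mass 1 leaves
at most K - 1. -/
theorem tabooExcess_zero_le [IsMarkovKernel P]
    [IsProbabilityMeasure ν] (hD : AtomDrift P C ν V l K) :
    tabooExcess P C V ν 0 ≤ K - 1 := by
  have h1 := hD.excess_add_mass_add_le hD.lintegral_atom_lt_top 0
  have h2 := tabooMass_add_real (P := P) hD.measurableSet ν 0
  have h3 : (taboo P C ν 0).real Set.univ = 1 := returnTail_zero (P := P) (C := C)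
  linarith [hD.tabooV_zero_le]

theorem one_le_const [IsMarkovKernel P]
    [IsProbabilityMeasure ν] (hD : AtomDrift P C ν V l K) : 1 ≤ K := by
  linarith [hD.tabooExcess_zero_le, tabooExcess_nonneg (P := P) (C := C) (V := V) ν 0]

theorem sum_returnTail_le [IsMarkovKernel P]
    [IsProbabilityMeasure ν] (hD : AtomDrift P C ν V l K) (n : ℕ) :
    ∑ j ∈ Finset.range n, returnTail P C ν (j + 1) * l⁻¹ ^ (j + 1)
      ≤ l⁻¹ * (K - 1) / (l⁻¹ - 1) := by
  have h1 := drift_mass_sum_le hD.pos (fun n => tabooExcess_nonneg ν n)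
    (fun n => hD.tabooExcess_succ_le hD.lintegral_atom_lt_top n) n
  have h2 := hD.one_lt_inv
  have h3 := hD.tabooExcess_zero_le
  rw [le_div_iff₀ (by linarith)]
  have h4 : ∑ j ∈ Finset.range n, returnTail P C ν (j + 1) * l⁻¹ ^ (j + 1)
      = l⁻¹ * ∑ j ∈ Finset.range n, l⁻¹ ^ j * tabooMass P C ν j := by
    rw [Finset.mul_sum]
    refine Finset.sum_congr rfl fun j _ => ?_
    rw [returnTail_succ]; ring
  rw [h4]
  have h5 := mul_le_mul_of_nonneg_left (h1.trans h3) (show 0 ≤ l⁻¹ by linarith)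
  linarith

theorem summable_returnTail_mul_pow [IsMarkovKernel P]
    [IsProbabilityMeasure ν] (hD : AtomDrift P C ν V l K) :
    Summable fun n => returnTail P C ν n * l⁻¹ ^ n := by
  rw [← summable_nat_add_iff 1]
  refine summable_of_sum_range_le (fun n => ?_) hD.sum_returnTail_le
  exact mul_nonneg (returnTail_nonneg _) (pow_nonneg (by linarith [hD.one_lt_inv]) _)

theorem tsum_returnTail_le [IsMarkovKernel P]
    [IsProbabilityMeasure ν] (hD : AtomDrift P C ν V l K) :
    ∑' n, returnTail P C ν (n + 1) * l⁻¹ ^ (n + 1) ≤ l⁻¹ * (K - 1) / (l⁻¹ - 1) :=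
  Real.tsum_le_of_sum_range_le (fun _ => mul_nonneg (returnTail_nonneg _)
    (pow_nonneg (by linarith [hD.one_lt_inv]) _)) hD.sum_returnTail_le

theorem summable_returnTail [IsMarkovKernel P]
    [IsProbabilityMeasure ν] (hD : AtomDrift P C ν V l K) :
    Summable (returnTail P C ν) :=
  summable_of_summable_mul_pow returnTail_nonneg hD.one_lt_inv.le hD.summable_returnTail_mul_pow

theorem one_le_tsum_returnTail [IsMarkovKernel P]
    [IsProbabilityMeasure ν] (hD : AtomDrift P C ν V l K) :
    1 ≤ ∑' n, returnTail P C ν n :=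
  one_le_tsum_of_zero_eq_one returnTail_zero returnTail_nonneg hD.summable_returnTail

/-- The term j = 0 costs at most rK, the later ones together at most r²l(K-1)/(1-rl) by the drift;
the sum of the two is the stated constant. -/
theorem sum_pow_mul_tabooV_le [IsMarkovKernel P]
    [IsProbabilityMeasure ν] (hD : AtomDrift P C ν V l K) {r : ℝ}
    (hr : 1 ≤ r) (hrl : r * l < 1) (n : ℕ) :
    ∑ j ∈ Finset.range (n + 1), r ^ (j + 1) * tabooV P C V ν j
      ≤ r * (K - r * l) / (1 - r * l) := by
  have hl := hD.pos
  have hfin := hD.lintegral_atom_lt_top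
  have h1 := drift_sum_le (fun n => tabooExcess_nonneg ν n) (fun n => tabooMass_nonneg ν n)
    (fun n => hD.tabooExcess_succ_le hfin n) hr hrl n
  have h2 : 0 < 1 - r * l := by linarith
  have h3 : ∑ j ∈ Finset.range n, r ^ (j + 1 + 1) * tabooV P C V ν (j + 1)
      ≤ r ^ 2 * l * ∑ j ∈ Finset.range n, r ^ j * (tabooExcess P C V ν j + tabooMass P C ν j) := by
    rw [Finset.mul_sum]
    refine Finset.sum_le_sum fun j _ => ?_
    have := mul_le_mul_of_nonneg_left (hD.tabooV_succ_le hfin j)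
      (show 0 ≤ r ^ (j + 2) by positivity)
    calc _ ≤ _ := this
      _ = _ := by ring
  rw [Finset.sum_range_succ', le_div_iff₀ h2]
  have h4 := h1.trans (div_le_div_of_nonneg_right hD.tabooExcess_zero_le h2.le)
  rw [le_div_iff₀ h2] at h4
  have h5 := mul_le_mul_of_nonneg_left h4 (show 0 ≤ r ^ 2 * l by positivity)
  have h6 := mul_le_mul_of_nonneg_left hD.tabooV_zero_le (show 0 ≤ r * (1 - r * l) by positivity)
  have h7 := mul_le_mul_of_nonneg_right h3 h2.le
  simp only [zero_add, pow_one]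
  nlinarith

theorem sum_tabooV_add_le [IsMarkovKernel P]
    [IsProbabilityMeasure ν] (hD : AtomDrift P C ν V l K) (m n : ℕ) :
    ∑ j ∈ Finset.range n, tabooV P C V ν (j + (m + 1)) ≤ l ^ (m + 1) * (K - 1) / (1 - l) := by
  have hl := hD.pos
  have hl1 : 0 < 1 - l := by linarith [hD.lt_one]
  have hfin := hD.lintegral_atom_lt_top
  have h1 := drift_tail_le hl.le hD.lt_one (fun n => tabooExcess_nonneg ν n)
    (fun n => tabooMass_nonneg ν n) (fun n => hD.tabooExcess_succ_le hfin n) m n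
  calc ∑ j ∈ Finset.range n, tabooV P C V ν (j + (m + 1))
      ≤ ∑ j ∈ Finset.range n, l * (tabooExcess P C V ν (m + j) + tabooMass P C ν (m + j)) := by
        refine Finset.sum_le_sum fun j _ => ?_
        have := hD.tabooV_succ_le hfin (m + j)
        rwa [show j + (m + 1) = m + j + 1 by ring]
    _ ≤ l * (l ^ m * tabooExcess P C V ν 0 / (1 - l)) := by
        rw [← Finset.mul_sum]
        exact mul_le_mul_of_nonneg_left h1 hl.le
    _ = l ^ (m + 1) * tabooExcess P C V ν 0 / (1 - l) := by rw [pow_succ]; ring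
    _ ≤ _ := by
        have := hD.tabooExcess_zero_le
        gcongr

theorem sum_tabooV_le [IsMarkovKernel P]
    [IsProbabilityMeasure ν] (hD : AtomDrift P C ν V l K) (n : ℕ) :
    ∑ j ∈ Finset.range n, tabooV P C V ν j ≤ (K - l) / (1 - l) := by
  have h := hD.sum_pow_mul_tabooV_le le_rfl (by linarith [hD.lt_one]) n
  simp only [one_pow, one_mul] at h
  refine le_trans ?_ h
  exact Finset.sum_le_sum_of_subset_of_nonneg (Finset.range_mono (Nat.le_succ n))
    fun _ _ _ => tabooV_nonneg ν _

theorem summable_tabooV [IsMarkovKernel P] [IsProbabilityMeasure ν] (hD : AtomDrift P C ν V l K) :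
    Summable (tabooV P C V ν) :=
  summable_of_sum_range_le (fun n => tabooV_nonneg ν n) hD.sum_tabooV_le

/-- The mass on `C` at time n is c_n - c_{n+1}, so the series telescopes to c_0 = 1: return to the
atom is certain. -/
theorem hasSum_taboo_atom [IsMarkovKernel P] [IsProbabilityMeasure ν] (hD : AtomDrift P C ν V l K) :
    HasSum (fun n => (taboo P C ν n).real C) 1 := by
  have hs := hD.summable_returnTail
  have hs1 : Summable fun n => returnTail P C ν (n + 1) := (summable_nat_add_iff 1).2 hs
  have h1 := hs.hasSum.sub hs1.hasSum
  rw [hs.tsum_eq_zero_add, add_sub_cancel_right, returnTail_zero] at h1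
  refine h1.congr_fun fun n => ?_
  rw [returnTail_succ, returnTail, ← tabooMass_add_real hD.measurableSet]
  ring

end AtomDrift

end Regeneration

/-! ### The invariant measure and convergence from the atom. -/

section Invariant

variable {S : Type*} [MeasurableSpace S] {P : Kernel S S} {C : Set S} {ν : Measure S}
  {V : Weight S} {l K : ℝ}

theorem measure_sum_succ (μ : ℕ → Measure S) :
    μ 0 + Measure.sum (fun n => μ (n + 1)) = Measure.sum μ := by
  ext s hs
  rw [Measure.add_apply, Measure.sum_apply _ hs, Measure.sum_apply _ hs]
  exact (tsum_eq_zero_add' (f := fun n => μ n s) ENNReal.summable).symm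

theorem tsum_ofReal_eq {f : ℕ → ℝ} (hf : ∀ n, 0 ≤ f n) (hs : Summable f) :
    ∑' n, ENNReal.ofReal (f n) = ENNReal.ofReal (∑' n, f n) :=
  (ENNReal.ofReal_tsum_of_nonneg hf hs).symm

namespace AtomDrift

theorem sum_taboo_univ [IsMarkovKernel P] [IsProbabilityMeasure ν] (hD : AtomDrift P C ν V l K) :
    Measure.sum (taboo P C ν) Set.univ = ENNReal.ofReal (∑' n, returnTail P C ν n) := by
  rw [Measure.sum_apply _ MeasurableSet.univ, ← tsum_ofReal_eq returnTail_nonneg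
    hD.summable_returnTail]
  exact tsum_congr fun n => (ofReal_measureReal (measure_ne_top _ _)).symm

theorem sum_taboo_atom [IsMarkovKernel P] [IsProbabilityMeasure ν] (hD : AtomDrift P C ν V l K) :
    Measure.sum (taboo P C ν) C = 1 := by
  rw [Measure.sum_apply _ hD.measurableSet, ← ENNReal.ofReal_one, ← hD.hasSum_taboo_atom.tsum_eq,
    ← tsum_ofReal_eq (fun _ => measureReal_nonneg) hD.hasSum_taboo_atom.summable]
  exact tsum_congr fun n => (ofReal_measureReal (measure_ne_top _ _)).symm

theorem isProbabilityMeasure_regenerative [IsMarkovKernel P] [IsProbabilityMeasure ν]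
    (hD : AtomDrift P C ν V l K) : IsProbabilityMeasure (regenerativeMeasure P C ν) := by
  have h := hD.one_le_tsum_returnTail
  constructor
  rw [regenerativeMeasure, Measure.smul_apply, hD.sum_taboo_univ, smul_eq_mul,
    ← ENNReal.ofReal_mul (by positivity), inv_mul_cancel₀ (by linarith), ENNReal.ofReal_one]

theorem regenerative_atom [IsMarkovKernel P] [IsProbabilityMeasure ν]
    (hD : AtomDrift P C ν V l K) :
    (regenerativeMeasure P C ν C).toReal = (∑' n, returnTail P C ν n)⁻¹ := by
  have h := hD.one_le_tsum_returnTail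
  rw [regenerativeMeasure, Measure.smul_apply, hD.sum_taboo_atom, smul_eq_mul, mul_one,
    ENNReal.toReal_ofReal (by positivity)]

/-- One step sends the occupation measure of an excursion to its terms shifted by one, plus `ν`
weighted by the mass 1 on `C`; this `ν` restores the missing initial term. -/
theorem invariant_regenerative [IsMarkovKernel P] [IsProbabilityMeasure ν]
    (hD : AtomDrift P C ν V l K) : Kernel.Invariant P (regenerativeMeasure P C ν) := by
  have h : P ∘ₘ (Measure.sum (taboo P C ν)) = Measure.sum (taboo P C ν) := by
    rw [comp_eq_smul_add hD.measurableSet hD.atom, hD.sum_taboo_atom, one_smul,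
      Measure.restrict_sum _ hD.measurableSet.compl, Measure.bind_sum _ _ P.aemeasurable]
    exact measure_sum_succ (taboo P C ν)
  rw [Kernel.Invariant, regenerativeMeasure, Measure.comp_smul, h]

theorem lintegral_sum_taboo [IsMarkovKernel P] [IsProbabilityMeasure ν]
    (hD : AtomDrift P C ν V l K) : ∫⁻ x, ENNReal.ofReal (V x) ∂(Measure.sum (taboo P C ν))
      = ENNReal.ofReal (∑' n, tabooV P C V ν n) := by
  rw [lintegral_sum_measure, ← tsum_ofReal_eq (fun n => tabooV_nonneg ν n) hD.summable_tabooV]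
  exact tsum_congr fun n =>
    (ENNReal.ofReal_toReal (hD.lintegral_taboo_lt_top hD.lintegral_atom_lt_top n).ne).symm

theorem lintegral_regenerative_lt_top [IsMarkovKernel P] [IsProbabilityMeasure ν]
    (hD : AtomDrift P C ν V l K) :
    ∫⁻ x, ENNReal.ofReal (V x) ∂(regenerativeMeasure P C ν) < ⊤ := by
  rw [regenerativeMeasure, lintegral_smul_measure, hD.lintegral_sum_taboo]
  exact ENNReal.mul_lt_top ENNReal.ofReal_lt_top ENNReal.ofReal_lt_top

theorem hasSum_integral_taboo [IsMarkovKernel P] [IsProbabilityMeasure ν]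
    (hD : AtomDrift P C ν V l K) (g : BV V) :
    HasSum (fun n => ∫ x, g x ∂(taboo P C ν n)) (∫ x, g x ∂(Measure.sum (taboo P C ν))) :=
  hasSum_integral_measure (BV.integrable (by rw [hD.lintegral_sum_taboo]; exact ENNReal.ofReal_lt_top) g)

theorem integral_regenerative [IsMarkovKernel P] [IsProbabilityMeasure ν]
    (hD : AtomDrift P C ν V l K) (g : BV V) : ∫ x, g x ∂(regenerativeMeasure P C ν)
      = ((∑' n, returnTail P C ν n)⁻¹ : ℝ) * ∑' n, ∫ x, g x ∂(taboo P C ν n) := by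
  have h := hD.one_le_tsum_returnTail
  rw [regenerativeMeasure, integral_smul_measure, ENNReal.toReal_ofReal (by positivity),
    (hD.hasSum_integral_taboo g).tsum_eq, Complex.real_smul]

theorem norm_integral_taboo_le [IsMarkovKernel P] (hD : AtomDrift P C ν V l K) {η : Measure S}
    (hη : ∫⁻ x, ENNReal.ofReal (V x) ∂η < ⊤) (g : BV V) (n : ℕ) :
    ‖∫ x, g x ∂(taboo P C η n)‖ ≤ ‖g‖ * tabooV P C V η n :=
  BV.norm_integral_le (hD.lintegral_taboo_lt_top hη n) g

theorem norm_integral_regenerative_le [IsMarkovKernel P] [IsProbabilityMeasure ν]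
    (hD : AtomDrift P C ν V l K) (g : BV V) :
    ‖∫ x, g x ∂(regenerativeMeasure P C ν)‖ ≤ ‖g‖ * ((K - l) / (1 - l)) := by
  have h := hD.one_le_tsum_returnTail
  refine (BV.norm_integral_le hD.lintegral_regenerative_lt_top g).trans ?_
  refine mul_le_mul_of_nonneg_left ?_ (norm_nonneg g)
  rw [regenerativeMeasure, lintegral_smul_measure, hD.lintegral_sum_taboo, smul_eq_mul,
    ← ENNReal.ofReal_mul (by positivity), ENNReal.toReal_ofReal
    (mul_nonneg (by positivity) (tsum_nonneg fun n => tabooV_nonneg ν n))]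
  refine (mul_le_of_le_one_left (tsum_nonneg fun n => tabooV_nonneg ν n)
    (inv_le_one_of_one_le₀ h)).trans ?_
  exact Real.tsum_le_of_sum_range_le (fun n => tabooV_nonneg ν n) hD.sum_tabooV_le

theorem integral_pow_comp_atom [IsMarkovKernel P] [IsProbabilityMeasure ν]
    (hD : AtomDrift P C ν V l K) (g : BV V) (n : ℕ) : ∫ x, g x ∂((P ^ n) ∘ₘ ν)
      = ∑ k ∈ Finset.range (n + 1),
        ((renewalSeq P C ν k).toReal : ℂ) * ∫ x, g x ∂(taboo P C ν (n - k)) := by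
  rw [pow_comp_eq_sum_renewalSeq hD.measurableSet hD.atom, integral_finsetSum_measure]
  · refine Finset.sum_congr rfl fun k _ => ?_
    rw [integral_smul_measure, Complex.real_smul]
  · intro k _
    exact (BV.integrable (hD.lintegral_taboo_lt_top hD.lintegral_atom_lt_top _) g).smul_measure
      ((renewalSeq_le_one k).trans_lt ENNReal.one_lt_top).ne

theorem norm_tsum_integral_taboo_le [IsMarkovKernel P] [IsProbabilityMeasure ν]
    (hD : AtomDrift P C ν V l K) (g : BV V) (m : ℕ) :
    ‖∑' i, ∫ x, g x ∂(taboo P C ν (i + (m + 1)))‖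
      ≤ ‖g‖ * (l ^ (m + 1) * (K - 1) / (1 - l)) := by
  have hs : Summable fun i => ‖g‖ * tabooV P C V ν (i + (m + 1)) :=
    ((summable_nat_add_iff (m + 1)).2 hD.summable_tabooV).mul_left _
  refine (tsum_of_norm_bounded hs.hasSum fun i =>
    hD.norm_integral_taboo_le hD.lintegral_atom_lt_top g _).trans ?_
  rw [tsum_mul_left]
  exact mul_le_mul_of_nonneg_left (Real.tsum_le_of_sum_range_le (fun n => tabooV_nonneg ν _)
    (hD.sum_tabooV_add_le m)) (norm_nonneg g)

/-- Convergence from the atom, with a rate inherited from the renewal sequence. -/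
theorem norm_integral_atom_sub_le [IsMarkovKernel P] [IsProbabilityMeasure ν]
    (hD : AtomDrift P C ν V l K) {r k₀ : ℝ} (hr : 1 < r) (hrl : r * l < 1)
    (hk : ∀ n, |(renewalSeq P C ν n).toReal - (∑' j, returnTail P C ν j)⁻¹| * r ^ n ≤ k₀)
    (g : BV V) (n : ℕ) :
    ‖∫ x, g x ∂((P ^ n) ∘ₘ ν) - ∫ x, g x ∂(regenerativeMeasure P C ν)‖ * r ^ (n + 1)
      ≤ ‖g‖ * (r * l * (K - 1) / ((1 - l) * (1 - r * l))
        + r * (K - r * l) / (1 - r * l) * k₀) := by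
  have hl := hD.pos
  have hl1 : 0 < 1 - l := by linarith [hD.lt_one]
  have hrl1 : 0 < 1 - r * l := by linarith
  have hr0 : 0 < r := by linarith
  have hK := hD.one_le_const
  have hk0 : 0 ≤ k₀ := (mul_nonneg (abs_nonneg _) (by positivity)).trans (hk 0)
  have hone := hD.one_le_tsum_returnTail
  set U := (∑' j, returnTail P C ν j)⁻¹ with hU
  have hU0 : 0 ≤ U := inv_nonneg.2 (by linarith)
  have hU1 : U ≤ 1 := inv_le_one_of_one_le₀ hone
  set G : ℕ → ℂ := fun i => ∫ x, g x ∂(taboo P C ν i) with hG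
  have hGle : ∀ i, ‖G i‖ ≤ ‖g‖ * tabooV P C V ν i :=
    fun i => hD.norm_integral_taboo_le hD.lintegral_atom_lt_top g i
  have hGs : Summable G := (hD.hasSum_integral_taboo g).summable
  -- Last exit decomposition for Pⁿ and the excursion series for π, split at `n`: a convolution with
  -- the renewal deviations, minus the part of the series beyond `n`.
  have hdiff : ∫ x, g x ∂((P ^ n) ∘ₘ ν) - ∫ x, g x ∂(regenerativeMeasure P C ν)
      = ∑ k ∈ Finset.range (n + 1), (((renewalSeq P C ν k).toReal - U : ℝ) : ℂ) * G (n - k)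
        - U * ∑' i, G (i + (n + 1)) := by
    have h2 : ∑ k ∈ Finset.range (n + 1), G (n - k) = ∑ k ∈ Finset.range (n + 1), G k := by
      simpa using Finset.sum_range_reflect G (n + 1)
    rw [hD.integral_pow_comp_atom, hD.integral_regenerative, ← hU, ← hGs.sum_add_tsum_nat_add (n + 1),
      ← h2, mul_add, Finset.mul_sum]
    simp_rw [Complex.ofReal_sub, sub_mul, Finset.sum_sub_distrib]
    ring
  rw [hdiff]
  have h1 : ‖∑ k ∈ Finset.range (n + 1), (((renewalSeq P C ν k).toReal - U : ℝ) : ℂ) * G (n - k)‖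
      * r ^ (n + 1) ≤ ‖g‖ * (r * (K - r * l) / (1 - r * l) * k₀) := by
    calc _ ≤ (∑ k ∈ Finset.range (n + 1),
          ‖(((renewalSeq P C ν k).toReal - U : ℝ) : ℂ) * G (n - k)‖) * r ^ (n + 1) := by
          gcongr; exact norm_sum_le _ _
      _ ≤ ∑ k ∈ Finset.range (n + 1), ‖g‖ * k₀ * (r ^ (n - k + 1) * tabooV P C V ν (n - k)) := by
          rw [Finset.sum_mul]
          refine Finset.sum_le_sum fun k hk' => ?_
          have hkn : k ≤ n := by simpa [Nat.lt_succ_iff] using hk'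
          rw [norm_mul, Complex.norm_real, Real.norm_eq_abs,
            show r ^ (n + 1) = r ^ k * r ^ (n - k + 1) by rw [← pow_add]; congr 1; omega]
          have h3 := mul_le_mul (hk k) (hGle (n - k)) (norm_nonneg _) hk0
          have h4 := mul_le_mul_of_nonneg_right h3 (show 0 ≤ r ^ (n - k + 1) by positivity)
          linarith
      _ = ‖g‖ * k₀ * ∑ j ∈ Finset.range (n + 1), r ^ (j + 1) * tabooV P C V ν j := by
          rw [← Finset.mul_sum]
          congr 1
          simpa using Finset.sum_range_reflect (fun j => r ^ (j + 1) * tabooV P C V ν j) (n + 1)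
      _ ≤ ‖g‖ * k₀ * (r * (K - r * l) / (1 - r * l)) :=
          mul_le_mul_of_nonneg_left (hD.sum_pow_mul_tabooV_le hr.le hrl n)
            (mul_nonneg (norm_nonneg g) hk0)
      _ = _ := by ring
  have h2 : ‖(U : ℂ) * ∑' i, G (i + (n + 1))‖ * r ^ (n + 1)
      ≤ ‖g‖ * (r * l * (K - 1) / ((1 - l) * (1 - r * l))) := by
    rw [norm_mul, Complex.norm_real, Real.norm_of_nonneg hU0]
    have h3 := hD.norm_tsum_integral_taboo_le g n
    have h4 : U * ‖∑' i, G (i + (n + 1))‖ ≤ ‖g‖ * (l ^ (n + 1) * (K - 1) / (1 - l)) :=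
      (mul_le_of_le_one_left (norm_nonneg _) hU1).trans h3
    refine (mul_le_mul_of_nonneg_right h4 (by positivity)).trans ?_
    rw [mul_assoc]
    refine mul_le_mul_of_nonneg_left ?_ (norm_nonneg g)
    have hrl0 : 0 ≤ r * l := by positivity
    have h5 : (r * l) ^ (n + 1) ≤ r * l := by
      rw [pow_succ]
      exact mul_le_of_le_one_left hrl0 (pow_le_one₀ hrl0 hrl.le)
    have hK1 : 0 ≤ K - 1 := by linarith
    calc l ^ (n + 1) * (K - 1) / (1 - l) * r ^ (n + 1)
        = (r * l) ^ (n + 1) * (K - 1) / (1 - l) := by rw [mul_pow]; ring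
      _ ≤ r * l * (K - 1) / (1 - l) := by gcongr
      -- A factor 1/(1 - rl) ≥ 1 is given away here to reach the third term of `MVBound`.
      _ ≤ r * l * (K - 1) / ((1 - l) * (1 - r * l)) := by
          gcongr
          exact mul_le_of_le_one_right hl1.le (by linarith)
  have h3 := mul_le_mul_of_nonneg_right (norm_sub_le (∑ k ∈ Finset.range (n + 1),
    (((renewalSeq P C ν k).toReal - U : ℝ) : ℂ) * G (n - k)) (U * ∑' i, G (i + (n + 1))))
    (show 0 ≤ r ^ (n + 1) by positivity)
  rw [add_mul] at h3
  linarith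

end AtomDrift

end Invariant

/-! ### Convergence from an arbitrary point and uniqueness. -/

section Convergence

variable {S : Type*} [MeasurableSpace S] {P : Kernel S S} {C : Set S} {ν : Measure S}
  {V : Weight S} {l K : ℝ}

theorem Weight.lintegral_dirac_lt_top (V : Weight S) (x : S) :
    ∫⁻ y, ENNReal.ofReal (V y) ∂(Measure.dirac x) < ⊤ := by
  rw [lintegral_dirac' x V.measurable_ofReal]
  exact ENNReal.ofReal_lt_top

theorem tabooV_dirac_zero (x : S) : tabooV P C V (Measure.dirac x) 0 = V x := by
  rw [tabooV, taboo, lintegral_dirac' x V.measurable_ofReal, ENNReal.toReal_ofReal (V.pos x).le]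

theorem pow_apply_eq_comp_dirac (n : ℕ) (x : S) : (P ^ n) x = (P ^ n) ∘ₘ Measure.dirac x :=
  (Measure.dirac_bind (P ^ n).measurable x).symm

namespace AtomDrift

/-- The quantity rⁿ∫V decreases along the taboo laws by at least the weighted mass absorbed in `C`,
because V ≥ 1 there. Hence the generating function of the hitting time is bounded by V(x) with
constant 1. -/
theorem sum_real_atom_le [IsMarkovKernel P] (hD : AtomDrift P C ν V l K) (x : S) {r : ℝ}
    (hr : 0 ≤ r) (hrl : r * l ≤ 1) (n : ℕ) :
    ∑ k ∈ Finset.range n, (taboo P C (Measure.dirac x) k).real C * r ^ k ≤ V x := by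
  have hη := V.lintegral_dirac_lt_top x
  have key : ∑ k ∈ Finset.range n, (taboo P C (Measure.dirac x) k).real C * r ^ k
      + r ^ n * tabooV P C V (Measure.dirac x) n ≤ V x := by
    induction n with
    | zero => simp [tabooV_dirac_zero]
    | succ n ih =>
      refine le_trans ?_ ih
      have h1 := hD.tabooV_succ_le hη n
      have h2 := hD.excess_add_mass_add_le hη n
      have h3 : r * tabooV P C V (Measure.dirac x) (n + 1)
          + (taboo P C (Measure.dirac x) n).real C ≤ tabooV P C V (Measure.dirac x) n := by
        have h4 := mul_le_mul_of_nonneg_left h1 hr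
        have h5 : 0 ≤ tabooExcess P C V (Measure.dirac x) n + tabooMass P C (Measure.dirac x) n :=
          add_nonneg (tabooExcess_nonneg _ _) (tabooMass_nonneg _ _)
        nlinarith
      have h6 := mul_le_mul_of_nonneg_left h3 (pow_nonneg hr n)
      rw [Finset.sum_range_succ, pow_succ]
      linarith
  have : 0 ≤ r ^ n * tabooV P C V (Measure.dirac x) n :=
    mul_nonneg (pow_nonneg hr n) (tabooV_nonneg _ _)
  linarith

theorem tabooV_dirac_le [IsMarkovKernel P] (hD : AtomDrift P C ν V l K) (x : S) (n : ℕ) :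
    tabooV P C V (Measure.dirac x) n ≤ l ^ n * V x := by
  have hη := V.lintegral_dirac_lt_top x
  induction n with
  | zero => simp [tabooV_dirac_zero]
  | succ n ih =>
    have h1 := hD.tabooV_succ_le hη n
    have h2 := hD.excess_add_mass_add_le hη n
    have h3 : 0 ≤ (taboo P C (Measure.dirac x) n).real C := measureReal_nonneg
    have h4 := mul_le_mul_of_nonneg_left (show tabooExcess P C V (Measure.dirac x) n
      + tabooMass P C (Measure.dirac x) n ≤ l ^ n * V x by linarith) hD.pos.le
    rw [pow_succ]
    linarith

theorem taboo_dirac_univ_le [IsMarkovKernel P] (hD : AtomDrift P C ν V l K) (x : S) (n : ℕ) :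
    (taboo P C (Measure.dirac x) (n + 1)).real Set.univ ≤ l ^ (n + 1) * V x / (1 - l) := by
  have hη := V.lintegral_dirac_lt_top x
  have hl1 : 0 < 1 - l := by linarith [hD.lt_one]
  rw [taboo_succ_real_univ]
  refine (drift_mass_le hD.pos.le hD.lt_one (fun n => tabooExcess_nonneg _ n)
    (fun n => tabooMass_nonneg _ n) (fun n => hD.tabooExcess_succ_le hη n) n).trans ?_
  have h2 := hD.excess_add_mass_add_le hη 0
  have h3 : 0 ≤ (taboo P C (Measure.dirac x) 0).real C := measureReal_nonneg
  have h4 : 0 ≤ tabooMass P C (Measure.dirac x) 0 := tabooMass_nonneg _ _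
  rw [tabooV_dirac_zero] at h2
  have := hD.pos
  gcongr
  linarith

/-- First entrance decomposition. Subtracting `w` inside each summand leaves only the mass that has
not yet hit `C`, since the decomposition has total mass 1. -/
theorem integral_pow_sub_eq [IsMarkovKernel P] [IsProbabilityMeasure ν]
    (hD : AtomDrift P C ν V l K) (g : BV V) (x : S) (n : ℕ) (w : ℂ) :
    ∫ y, g y ∂((P ^ n) x) - w = ∫ y, g y ∂(taboo P C (Measure.dirac x) n)
      + ∑ k ∈ Finset.range n, ((taboo P C (Measure.dirac x) k).real C : ℂ)
        * (∫ y, g y ∂((P ^ (n - 1 - k)) ∘ₘ ν) - w)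
      - ((taboo P C (Measure.dirac x) n).real Set.univ : ℂ) * w := by
  have hη := V.lintegral_dirac_lt_top x
  have hfin : ∀ m : ℕ, ∫⁻ y, ENNReal.ofReal (V y) ∂((P ^ m) ∘ₘ ν) < ⊤ := by
    intro m
    rw [pow_comp_eq_sum_renewalSeq hD.measurableSet hD.atom, lintegral_finsetSum_measure]
    refine ENNReal.sum_lt_top.2 fun k _ => ?_
    rw [lintegral_smul_measure]
    exact ENNReal.mul_lt_top ((renewalSeq_le_one k).trans_lt ENNReal.one_lt_top)
      (hD.lintegral_taboo_lt_top hD.lintegral_atom_lt_top _)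
  have hdec := pow_comp_eq_taboo_add hD.measurableSet hD.atom (Measure.dirac x) n
  have hint : ∀ k ∈ Finset.range n, Integrable (g : S → ℂ)
      ((taboo P C (Measure.dirac x) k) C • ((P ^ (n - 1 - k)) ∘ₘ ν)) := fun k _ =>
    (BV.integrable (hfin _) g).smul_measure (measure_ne_top _ _)
  have h1 : ∫ y, g y ∂((P ^ n) x) = ∫ y, g y ∂(taboo P C (Measure.dirac x) n)
      + ∑ k ∈ Finset.range n, ((taboo P C (Measure.dirac x) k).real C : ℂ)
        * ∫ y, g y ∂((P ^ (n - 1 - k)) ∘ₘ ν) := by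
    rw [pow_apply_eq_comp_dirac, hdec, integral_add_measure
      (BV.integrable (hD.lintegral_taboo_lt_top hη n) g) (integrable_finsetSum_measure.2 hint),
      integral_finsetSum_measure hint]
    congr 1
    refine Finset.sum_congr rfl fun k _ => ?_
    rw [integral_smul_measure, Complex.real_smul, measureReal_def]
  have h2 : (1 : ℝ) = (taboo P C (Measure.dirac x) n).real Set.univ
      + ∑ k ∈ Finset.range n, (taboo P C (Measure.dirac x) k).real C := by
    have h3 := congrArg (fun μ : Measure S => (μ Set.univ).toReal) hdec
    simp only [measure_univ, Measure.add_apply, Measure.finsetSum_apply, Measure.smul_apply,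
      smul_eq_mul, mul_one, ENNReal.toReal_one] at h3
    rwa [ENNReal.toReal_add (measure_ne_top _ _) (ENNReal.sum_ne_top.2 fun k _ =>
      measure_ne_top _ _), ENNReal.toReal_sum fun k _ => measure_ne_top _ _] at h3
  have h3 : (1 : ℂ) = ((taboo P C (Measure.dirac x) n).real Set.univ : ℂ)
      + ∑ k ∈ Finset.range n, ((taboo P C (Measure.dirac x) k).real C : ℂ) := by
    exact_mod_cast h2
  rw [h1]
  simp_rw [mul_sub, Finset.sum_sub_distrib, ← Finset.sum_mul]
  linear_combination (-w) * h3

/-- Geometric convergence in weighted norm, with a rate inherited from the renewal sequence. -/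
theorem norm_integral_pow_sub_le [IsMarkovKernel P] [IsProbabilityMeasure ν]
    (hD : AtomDrift P C ν V l K) {r k₀ : ℝ} (hr : 1 < r) (hrl : r * l < 1)
    (hk : ∀ n, |(renewalSeq P C ν n).toReal - (∑' j, returnTail P C ν j)⁻¹| * r ^ n ≤ k₀)
    (g : BV V) (x : S) (n : ℕ) :
    ‖∫ y, g y ∂((P ^ (n + 1)) x) - ∫ y, g y ∂(regenerativeMeasure P C ν)‖ * r ^ (n + 1)
      ≤ MVBound l K k₀ r * ‖g‖ * V x := by
  have hη := V.lintegral_dirac_lt_top x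
  have hl := hD.pos
  have hl1 : 0 < 1 - l := by linarith [hD.lt_one]
  have hrl1 : 0 < 1 - r * l := by linarith
  have hr0 : 0 < r := by linarith
  have hK := hD.one_le_const
  have hV := V.pos x
  have hg := norm_nonneg g
  have hk0 : 0 ≤ k₀ := (mul_nonneg (abs_nonneg _) (by positivity)).trans (hk 0)
  set w := ∫ y, g y ∂(regenerativeMeasure P C ν) with hw
  -- B is the constant for convergence from the atom. The other two terms of `MVBound` come from
  -- paths that have not hit `C`: one from `g` itself, one from π(g).
  set B := r * l * (K - 1) / ((1 - l) * (1 - r * l)) + r * (K - r * l) / (1 - r * l) * k₀ with hB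
  have hB0 : 0 ≤ B := by
    have : 0 ≤ K - 1 := by linarith
    have : 0 ≤ K - r * l := by linarith
    positivity
  have hrl0 : 0 ≤ r * l := by positivity
  have hpow : (r * l) ^ (n + 1) ≤ r * l := by
    rw [pow_succ]
    exact mul_le_of_le_one_left hrl0 (pow_le_one₀ hrl0 hrl.le)
  have h1 : ‖∫ y, g y ∂(taboo P C (Measure.dirac x) (n + 1))‖ * r ^ (n + 1)
      ≤ r * l / (1 - r * l) * ‖g‖ * V x := by
    have h2 := (hD.norm_integral_taboo_le hη g (n + 1)).trans
      (mul_le_mul_of_nonneg_left (hD.tabooV_dirac_le x (n + 1)) hg)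
    have h3 : r * l ≤ r * l / (1 - r * l) := le_div_self hrl0 hrl1 (by linarith)
    calc _ ≤ ‖g‖ * (l ^ (n + 1) * V x) * r ^ (n + 1) := by gcongr
      _ = (r * l) ^ (n + 1) * ‖g‖ * V x := by rw [mul_pow]; ring
      _ ≤ _ := by gcongr; exact hpow.trans h3
  have h2 : ‖∑ k ∈ Finset.range (n + 1), ((taboo P C (Measure.dirac x) k).real C : ℂ)
        * (∫ y, g y ∂((P ^ (n + 1 - 1 - k)) ∘ₘ ν) - w)‖ * r ^ (n + 1) ≤ B * ‖g‖ * V x := by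
    calc _ ≤ (∑ k ∈ Finset.range (n + 1), ‖((taboo P C (Measure.dirac x) k).real C : ℂ)
        * (∫ y, g y ∂((P ^ (n + 1 - 1 - k)) ∘ₘ ν) - w)‖) * r ^ (n + 1) := by
          gcongr; exact norm_sum_le _ _
      _ ≤ ∑ k ∈ Finset.range (n + 1),
          (taboo P C (Measure.dirac x) k).real C * r ^ k * (‖g‖ * B) := by
          rw [Finset.sum_mul]
          refine Finset.sum_le_sum fun k hk' => ?_
          have hkn : k ≤ n := by simpa [Nat.lt_succ_iff] using hk'
          have h3 := hD.norm_integral_atom_sub_le hr hrl hk g (n - k)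
          rw [norm_mul, Complex.norm_real, Real.norm_of_nonneg measureReal_nonneg,
            show r ^ (n + 1) = r ^ k * r ^ (n - k + 1) by rw [← pow_add]; congr 1; omega,
            Nat.add_sub_cancel]
          have h4 := mul_le_mul_of_nonneg_left h3 (show 0 ≤
            (taboo P C (Measure.dirac x) k).real C * r ^ k from
              mul_nonneg measureReal_nonneg (by positivity))
          linarith
      _ ≤ V x * (‖g‖ * B) := by
          rw [← Finset.sum_mul]
          exact mul_le_mul_of_nonneg_right (hD.sum_real_atom_le x hr0.le hrl.le (n + 1))
            (mul_nonneg hg hB0)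
      _ = _ := by ring
  have h3 : ‖((taboo P C (Measure.dirac x) (n + 1)).real Set.univ : ℂ) * w‖ * r ^ (n + 1)
      ≤ r * l * (K - l) / (1 - l) ^ 2 * ‖g‖ * V x := by
    rw [norm_mul, Complex.norm_real, Real.norm_of_nonneg measureReal_nonneg]
    have h4 := mul_le_mul (hD.taboo_dirac_univ_le x n) (hD.norm_integral_regenerative_le g)
      (norm_nonneg _) (by positivity)
    have hKl : 0 ≤ K - l := by linarith
    calc _ ≤ l ^ (n + 1) * V x / (1 - l) * (‖g‖ * ((K - l) / (1 - l))) * r ^ (n + 1) := by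
          gcongr
      _ = (r * l) ^ (n + 1) * (K - l) / (1 - l) ^ 2 * ‖g‖ * V x := by
          rw [mul_pow]; field_simp
      _ ≤ _ := by gcongr
  rw [hD.integral_pow_sub_eq g x (n + 1) w]
  set X := ∫ y, g y ∂(taboo P C (Measure.dirac x) (n + 1))
  set Y := ∑ k ∈ Finset.range (n + 1), ((taboo P C (Measure.dirac x) k).real C : ℂ)
        * (∫ y, g y ∂((P ^ (n + 1 - 1 - k)) ∘ₘ ν) - w)
  set Z := ((taboo P C (Measure.dirac x) (n + 1)).real Set.univ : ℂ) * w
  have h5 : ‖X + Y - Z‖ ≤ ‖X‖ + ‖Y‖ + ‖Z‖ :=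
    (norm_sub_le _ _).trans (by gcongr; exact norm_add_le _ _)
  have h6 := mul_le_mul_of_nonneg_right h5 (show 0 ≤ r ^ (n + 1) by positivity)
  have h7 : MVBound l K k₀ r * ‖g‖ * V x = r * l / (1 - r * l) * ‖g‖ * V x
      + r * l * (K - l) / (1 - l) ^ 2 * ‖g‖ * V x + B * ‖g‖ * V x := by
    rw [MVBound, hB]; ring
  rw [h7]
  linarith

theorem MVBound_nonneg [IsMarkovKernel P] [IsProbabilityMeasure ν] (hD : AtomDrift P C ν V l K)
    {r k₀ : ℝ} (hr : 1 < r) (hrl : r * l < 1) (hk : 0 ≤ k₀) : 0 ≤ MVBound l K k₀ r := by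
  have hl := hD.pos
  have : 0 < 1 - l := by linarith [hD.lt_one]
  have : 0 < 1 - r * l := by linarith
  have : 0 < r := by linarith
  have : 0 ≤ K - 1 := by linarith [hD.one_le_const]
  have : 0 ≤ K - r * l := by linarith
  have : 0 ≤ K - l := by linarith [hD.lt_one]
  rw [MVBound]
  positivity

theorem optimalConst_le [IsMarkovKernel P] [IsProbabilityMeasure ν]
    (hD : AtomDrift P C ν V l K) {r k₀ : ℝ} (hr : 1 < r) (hrl : r * l < 1)
    (hk : ∀ n, |(renewalSeq P C ν n).toReal - (∑' j, returnTail P C ν j)⁻¹| * r ^ n ≤ k₀) :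
    optimalConst P (regenerativeMeasure P C ν) V r ≤ ENNReal.ofReal (MVBound l K k₀ r) := by
  have hk0 : 0 ≤ k₀ := (mul_nonneg (abs_nonneg _) (by positivity)).trans (hk 0)
  refine sInf_le fun n hn g x => ?_
  obtain ⟨n, rfl⟩ := Nat.exists_eq_add_of_le' hn
  have h := hD.norm_integral_pow_sub_le hr hrl hk g x n
  have hp : 0 < r ^ (n + 1) := by positivity
  rw [← ENNReal.ofReal_mul (hD.MVBound_nonneg hr hrl hk0), ← ofReal_norm]
  refine ENNReal.ofReal_le_ofReal ?_
  rw [← le_div_iff₀ hp] at h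
  refine h.trans (le_of_eq ?_)
  field_simp

/-- The bounded function `1_A` as an element of `B_V`. -/
theorem exists_indicator (V : Weight S) {A : Set S} (hA : MeasurableSet A) :
    ∃ g : BV V, ∀ x, g x = A.indicator (fun _ => (1 : ℂ)) x := by
  refine ⟨⟨A.indicator fun _ => (1 : ℂ), measurable_const.indicator hA, 1, ?_⟩, fun _ => rfl⟩
  rintro _ ⟨x, rfl⟩
  rw [div_le_one (V.pos x)]
  refine le_trans ?_ (V.one_le_toFun x)
  by_cases hx : x ∈ A <;> simp [hx]

theorem tendsto_pow_apply [IsMarkovKernel P] [IsProbabilityMeasure ν]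
    (hD : AtomDrift P C ν V l K) {r k₀ : ℝ} (hr : 1 < r) (hrl : r * l < 1)
    (hk : ∀ n, |(renewalSeq P C ν n).toReal - (∑' j, returnTail P C ν j)⁻¹| * r ^ n ≤ k₀)
    {A : Set S} (hA : MeasurableSet A) (x : S) :
    Filter.Tendsto (fun n => ((P ^ (n + 1)) x) A) Filter.atTop
      (nhds (regenerativeMeasure P C ν A)) := by
  have := hD.isProbabilityMeasure_regenerative
  obtain ⟨g, hg⟩ := exists_indicator V hA
  have hint : ∀ μ : Measure S, ∫ y, g y ∂μ = (μ.real A : ℂ) := by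
    intro μ
    simp_rw [hg]
    rw [integral_indicator hA, setIntegral_const, Complex.real_smul, mul_one]
  rw [← ENNReal.tendsto_toReal_iff (fun n => measure_ne_top _ _) (measure_ne_top _ _)]
  rw [tendsto_iff_norm_sub_tendsto_zero]
  have hr0 : 0 < r := by linarith
  have hz : Filter.Tendsto (fun n : ℕ => MVBound l K k₀ r * ‖g‖ * V x * r⁻¹ ^ (n + 1))
      Filter.atTop (nhds 0) := by
    have := (tendsto_pow_atTop_nhds_zero_of_lt_one (inv_nonneg.2 hr0.le)
      (inv_lt_one_of_one_lt₀ hr)).comp (Filter.tendsto_add_atTop_nat 1)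
    simpa using this.const_mul (MVBound l K k₀ r * ‖g‖ * V x)
  refine squeeze_zero (fun n => norm_nonneg _) (fun n => ?_) hz
  have h := hD.norm_integral_pow_sub_le hr hrl hk g x n
  rw [hint, hint, ← Complex.ofReal_sub, Complex.norm_real] at h
  rw [inv_pow, ← div_eq_mul_inv, le_div_iff₀ (by positivity)]
  exact h

/-- Integrating the setwise convergence of P^{n+1}(x, A) against an invariant law gives a constant
sequence; dominated convergence identifies its limit. -/
theorem eq_regenerative [IsMarkovKernel P] [IsProbabilityMeasure ν]
    (hD : AtomDrift P C ν V l K) {r k₀ : ℝ} (hr : 1 < r) (hrl : r * l < 1)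
    (hk : ∀ n, |(renewalSeq P C ν n).toReal - (∑' j, returnTail P C ν j)⁻¹| * r ^ n ≤ k₀)
    (π : Measure S) [IsProbabilityMeasure π] (hπ : Kernel.Invariant P π) :
    π = regenerativeMeasure P C ν := by
  have hinv : ∀ n : ℕ, (P ^ n) ∘ₘ π = π := by
    intro n
    induction n with
    | zero => rw [pow_zero, one_comp_measure]
    | succ n ih => rw [comp_pow_succ, ih]; exact hπ
  ext A hA
  have h1 : Filter.Tendsto (fun n => ∫⁻ x, ((P ^ (n + 1)) x) A ∂π) Filter.atTop
      (nhds (∫⁻ _, regenerativeMeasure P C ν A ∂π)) :=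
    tendsto_lintegral_of_dominated_convergence (fun _ => 1)
      (fun n => (P ^ (n + 1)).measurable_coe hA)
      (fun n => Filter.Eventually.of_forall fun x => prob_le_one) (by simp)
      (Filter.Eventually.of_forall fun x => hD.tendsto_pow_apply hr hrl hk hA x)
  have h2 : ∀ n : ℕ, ∫⁻ x, ((P ^ (n + 1)) x) A ∂π = π A := fun n => by
    conv_rhs => rw [← hinv (n + 1)]
    rw [Measure.bind_apply hA (P ^ (n + 1)).aemeasurable]
  simp_rw [h2] at h1
  simpa using tendsto_nhds_unique tendsto_const_nhds h1

end AtomDrift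

end Convergence

/-! ### Completeness of `B_V` and the spectral radius. -/

section Spectrum

/-- A geometric bound on the powers of an element bounds its spectral radius. -/
theorem spectralRadius_le_of_norm_pow_le {A : Type*} [NormedRing A] [NormedAlgebra ℂ A]
    [CompleteSpace A] {a : A} {r M : ℝ} (hr : 0 < r)
    (h : ∀ n : ℕ, ‖a ^ (n + 1)‖ * r ^ (n + 1) ≤ M) : spectralRadius ℂ a ≤ ENNReal.ofReal r⁻¹ := by
  refine iSup₂_le fun k hk => ?_
  have hb : ∀ n : ℕ, (‖k‖ * r) ^ (n + 1) ≤ M * ‖(1 : A)‖ := by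
    intro n
    have h1 := spectrum.norm_le_norm_mul_of_mem (spectrum.pow_mem_pow a (n + 1) hk)
    rw [norm_pow] at h1
    calc (‖k‖ * r) ^ (n + 1) = ‖k‖ ^ (n + 1) * r ^ (n + 1) := mul_pow _ _ _
      _ ≤ ‖a ^ (n + 1)‖ * ‖(1 : A)‖ * r ^ (n + 1) := by gcongr
      _ = ‖a ^ (n + 1)‖ * r ^ (n + 1) * ‖(1 : A)‖ := by ring
      _ ≤ _ := mul_le_mul_of_nonneg_right (h n) (norm_nonneg _)
  have hk1 : ‖k‖ * r ≤ 1 := by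
    by_contra hcon
    obtain ⟨n, hn⟩ := pow_unbounded_of_one_lt (M * ‖(1 : A)‖) (not_le.1 hcon)
    have h2 := pow_le_pow_right₀ (not_le.1 hcon).le (Nat.le_add_right n 1)
    linarith [hb n]
  rw [← ENNReal.ofReal_coe_nnreal, coe_nnnorm]
  refine ENNReal.ofReal_le_ofReal ?_
  rw [← one_div, le_div_iff₀ hr]
  exact hk1

variable {S : Type*} [MeasurableSpace S]

instance BV.completeSpace (V : Weight S) : CompleteSpace (BV V) := by
  refine Metric.complete_of_cauchySeq_tendsto fun f hf => ?_
  have hsub : ∀ (m n : ℕ) (x : S), ‖f m x - f n x‖ ≤ ‖f m - f n‖ * V x := fun m n x =>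
    (f m - f n).norm_apply_le x
  have hcau : ∀ ε > 0, ∃ N, ∀ m ≥ N, ∀ n ≥ N, ‖f m - f n‖ < ε := by
    simpa [dist_eq_norm] using Metric.cauchySeq_iff.1 hf
  have hpt : ∀ x, ∃ y : ℂ, Filter.Tendsto (fun n => f n x) Filter.atTop (nhds y) := by
    intro x
    refine cauchySeq_tendsto_of_complete (Metric.cauchySeq_iff.2 fun ε hε => ?_)
    obtain ⟨N, hN⟩ := hcau (ε / V x) (div_pos hε (V.pos x))
    refine ⟨N, fun m hm n hn => ?_⟩
    rw [dist_eq_norm]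
    exact (hsub m n x).trans_lt ((lt_div_iff₀ (V.pos x)).1 (hN m hm n hn))
  choose F hF using hpt
  have hmeas : Measurable F :=
    measurable_of_tendsto_metrizable (fun n => (f n).measurable) (tendsto_pi_nhds.2 hF)
  have hlim : ∀ ε > 0, ∃ N, ∀ m ≥ N, ∀ x, ‖f m x - F x‖ ≤ ε * V x := by
    intro ε hε
    obtain ⟨N, hN⟩ := hcau ε hε
    refine ⟨N, fun m hm x => ?_⟩
    refine le_of_tendsto ((tendsto_const_nhds.sub (hF x)).norm) ?_
    filter_upwards [Filter.eventually_ge_atTop N] with n hn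
    exact (hsub m n x).trans (mul_le_mul_of_nonneg_right (hN m hm n hn).le (V.pos x).le)
  have hbdd : BddAbove (Set.range fun x => ‖F x‖ / V x) := by
    obtain ⟨N, hN⟩ := hlim 1 one_pos
    refine ⟨‖f N‖ + 1, ?_⟩
    rintro _ ⟨x, rfl⟩
    simp only
    rw [div_le_iff₀ (V.pos x), add_mul]
    have h1 : ‖F x‖ ≤ ‖f N x‖ + ‖f N x - F x‖ := norm_le_norm_add_norm_sub _ _
    linarith [(f N).norm_apply_le x, hN N le_rfl x]
  obtain ⟨G, hG⟩ : ∃ G : BV V, ∀ x, G x = F x :=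
    ⟨(⟨F, ⟨hmeas, hbdd⟩⟩ : boundedBy V), fun _ => rfl⟩
  simp_rw [← hG] at hlim
  refine ⟨G, ?_⟩
  rw [Metric.tendsto_atTop]
  intro ε hε
  obtain ⟨N, hN⟩ := hlim (ε / 2) (half_pos hε)
  refine ⟨N, fun n hn => ?_⟩
  rw [dist_eq_norm]
  refine lt_of_le_of_lt ?_ (half_lt_self hε)
  exact BV.norm_le_of_forall _ (half_pos hε).le fun x => hN n hn x

theorem integrable_and_integral_comp (κ : Kernel S S) {μ : Measure S} {f : S → ℂ}
    (hf : Integrable f (κ ∘ₘ μ)) : Integrable (fun x => ∫ y, f y ∂(κ x)) μ ∧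
      ∫ x, f x ∂(κ ∘ₘ μ) = ∫ x, ∫ y, f y ∂(κ x) ∂μ := by
  rw [Measure.comp_eq_comp_const_apply] at hf ⊢
  constructor
  · simpa using hf.integral_comp
  · rw [Kernel.integral_comp hf, Kernel.const_apply]

variable {P : Kernel S S} {C : Set S} {ν : Measure S} {V : Weight S} {l K : ℝ}

namespace AtomDrift

theorem lintegral_kernel_le [IsProbabilityMeasure ν] (hD : AtomDrift P C ν V l K) (x : S) :
    ∫⁻ y, ENNReal.ofReal (V y) ∂(P x) ≤ ENNReal.ofReal (l + K) * ENNReal.ofReal (V x) := by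
  have hK := hD.const_nonneg
  have hl := hD.pos
  have hV := V.one_le_toFun x
  rw [← ENNReal.ofReal_mul (by linarith)]
  by_cases hx : x ∈ C
  · rw [hD.atom x hx]
    refine hD.drift_atom.trans (ENNReal.ofReal_le_ofReal ?_)
    nlinarith
  · refine (hD.drift x hx).trans (ENNReal.ofReal_le_ofReal ?_)
    nlinarith

theorem lintegral_comp_lt_top [IsProbabilityMeasure ν] (hD : AtomDrift P C ν V l K) {μ : Measure S}
    (hμ : ∫⁻ x, ENNReal.ofReal (V x) ∂μ < ⊤) : ∫⁻ x, ENNReal.ofReal (V x) ∂(P ∘ₘ μ) < ⊤ := by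
  rw [Measure.lintegral_bind P.aemeasurable V.measurable_ofReal.aemeasurable]
  refine (lintegral_mono fun x => hD.lintegral_kernel_le x).trans_lt ?_
  rw [lintegral_const_mul _ V.measurable_ofReal]
  exact ENNReal.mul_lt_top ENNReal.ofReal_lt_top hμ

theorem lintegral_pow_lt_top [IsProbabilityMeasure ν] (hD : AtomDrift P C ν V l K) (n : ℕ) (x : S) :
    ∫⁻ y, ENNReal.ofReal (V y) ∂((P ^ n) x) < ⊤ := by
  rw [pow_apply_eq_comp_dirac]
  induction n with
  | zero => rw [pow_zero, one_comp_measure]; exact V.lintegral_dirac_lt_top x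
  | succ n ih => rw [comp_pow_succ]; exact hD.lintegral_comp_lt_top ih

theorem lintegral_apply_lt_top [IsProbabilityMeasure ν] (hD : AtomDrift P C ν V l K) (x : S) :
    ∫⁻ y, ENNReal.ofReal (V y) ∂(P x) < ⊤ := by
  simpa using hD.lintegral_pow_lt_top 1 x

/-- The centered transition operator is bounded on `B_V`. -/
theorem exists_isCentered [IsProbabilityMeasure ν] (hD : AtomDrift P C ν V l K)
    {π : Measure S} (hπ : ∫⁻ x, ENNReal.ofReal (V x) ∂π < ⊤) :
    ∃ T : BV V →L[ℂ] BV V, IsCentered P π V T := by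
  have hK := hD.const_nonneg
  have hl := hD.pos
  set A := l + K + (∫⁻ x, ENNReal.ofReal (V x) ∂π).toReal with hA
  have hA0 : 0 ≤ A := by positivity
  have hbound : ∀ (g : BV V) (x : S),
      ‖(∫ y, g y ∂(P x)) - ∫ y, g y ∂π‖ ≤ A * ‖g‖ * V x := by
    intro g x
    have h1 := BV.norm_integral_le (hD.lintegral_apply_lt_top x) g
    have h2 := BV.norm_integral_le hπ g
    have h3 : (∫⁻ y, ENNReal.ofReal (V y) ∂(P x)).toReal ≤ (l + K) * V x := by
      have := ENNReal.toReal_mono (ENNReal.mul_ne_top ENNReal.ofReal_ne_top ENNReal.ofReal_ne_top)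
        (hD.lintegral_kernel_le x)
      rwa [ENNReal.toReal_mul, ENNReal.toReal_ofReal (by linarith),
        ENNReal.toReal_ofReal (V.pos x).le] at this
    have h4 := mul_le_mul_of_nonneg_left h3 (norm_nonneg g)
    have h5 : ‖g‖ * (∫⁻ x, ENNReal.ofReal (V x) ∂π).toReal
        ≤ ‖g‖ * (∫⁻ x, ENNReal.ofReal (V x) ∂π).toReal * V x :=
      le_mul_of_one_le_right (mul_nonneg (norm_nonneg g) ENNReal.toReal_nonneg) (V.one_le_toFun x)
    refine (norm_sub_le _ _).trans ?_
    rw [hA]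
    linarith
  have hmeas : ∀ g : BV V, Measurable fun x => (∫ y, g y ∂(P x)) - ∫ y, g y ∂π := fun g =>
    (g.measurable.stronglyMeasurable.integral_kernel (κ := P)).measurable.sub_const _
  let T : BV V →ₗ[ℂ] BV V :=
    { toFun := fun g => ⟨fun x => (∫ y, g y ∂(P x)) - ∫ y, g y ∂π, hmeas g, A * ‖g‖, by
        rintro _ ⟨x, rfl⟩
        exact (div_le_iff₀ (V.pos x)).2 (hbound g x)⟩
      map_add' := fun g h => by
        apply Subtype.ext
        funext x
        have h1 : ∀ μ : Measure S, ∫⁻ y, ENNReal.ofReal (V y) ∂μ < ⊤ →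
            ∫ y, (g + h : BV V) y ∂μ = ∫ y, g y ∂μ + ∫ y, h y ∂μ := fun μ hμ =>
          integral_add (BV.integrable hμ g) (BV.integrable hμ h)
        change (∫ y, (g + h : BV V) y ∂(P x)) - ∫ y, (g + h : BV V) y ∂π
          = ((∫ y, g y ∂(P x)) - ∫ y, g y ∂π) + ((∫ y, h y ∂(P x)) - ∫ y, h y ∂π)
        rw [h1 _ (hD.lintegral_apply_lt_top x), h1 _ hπ]
        ring
      map_smul' := fun c g => by
        apply Subtype.ext
        funext x
        have h1 : ∀ μ : Measure S, ∫ y, (c • g : BV V) y ∂μ = c * ∫ y, g y ∂μ := fun μ =>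
          integral_const_mul c _
        change (∫ y, (c • g : BV V) y ∂(P x)) - ∫ y, (c • g : BV V) y ∂π
          = c * ((∫ y, g y ∂(P x)) - ∫ y, g y ∂π)
        rw [h1, h1]
        ring }
  refine ⟨T.mkContinuous A fun g => ?_, fun g x => rfl⟩
  exact BV.norm_le_of_forall _ (mul_nonneg hA0 (norm_nonneg g)) fun x => hbound g x

theorem integral_isCentered [IsProbabilityMeasure ν] (hD : AtomDrift P C ν V l K)
    {π : Measure S} {T : BV V →L[ℂ] BV V} (hT : IsCentered P π V T) {μ : Measure S}
    [IsProbabilityMeasure μ] (hμ : ∫⁻ x, ENNReal.ofReal (V x) ∂μ < ⊤) (g : BV V) :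
    ∫ x, (T g) x ∂μ = ∫ x, g x ∂(P ∘ₘ μ) - ∫ x, g x ∂π := by
  have hint : Integrable (g : S → ℂ) (P ∘ₘ μ) := BV.integrable (hD.lintegral_comp_lt_top hμ) g
  have h1 : ∀ x, (T g) x = (∫ y, g y ∂(P x)) - ∫ y, g y ∂π := fun x => hT g x
  obtain ⟨hint2, h2⟩ := integrable_and_integral_comp P hint
  rw [integral_congr_ae (Filter.Eventually.of_forall h1), integral_sub hint2 (integrable_const _),
    ← h2, integral_const, probReal_univ, one_smul]

/-- By invariance the image of T has π-integral zero, so iterating subtracts π(g) only once. The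
exponent starts at 1, since T⁰ is the identity without any centering. -/
theorem isCentered_pow_apply [IsMarkovKernel P] [IsProbabilityMeasure ν]
    (hD : AtomDrift P C ν V l K) {π : Measure S} [IsProbabilityMeasure π]
    (hinv : Kernel.Invariant P π) (hπ : ∫⁻ x, ENNReal.ofReal (V x) ∂π < ⊤)
    {T : BV V →L[ℂ] BV V} (hT : IsCentered P π V T) (n : ℕ) (g : BV V) (x : S) :
    ((T ^ (n + 1)) g) x = ∫ y, g y ∂((P ^ (n + 1)) x) - ∫ y, g y ∂π := by
  induction n generalizing g with
  | zero => simpa using hT g x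
  | succ n ih =>
    have h1 : (T ^ (n + 1 + 1)) g = (T ^ (n + 1)) (T g) := by
      rw [pow_succ T (n + 1)]; rfl
    have hinv' : P ∘ₘ π = π := hinv
    rw [h1, ih, hD.integral_isCentered hT (hD.lintegral_pow_lt_top _ _),
      hD.integral_isCentered hT hπ, hinv', pow_apply_eq_comp_dirac (n + 1), ← comp_pow_succ,
      ← pow_apply_eq_comp_dirac]
    ring

theorem spectralRadius_le [IsMarkovKernel P] [IsProbabilityMeasure ν]
    (hD : AtomDrift P C ν V l K) {T : BV V →L[ℂ] BV V}
    (hT : IsCentered P (regenerativeMeasure P C ν) V T) {r k₀ : ℝ} (hr : 1 < r) (hrl : r * l < 1)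
    (hk : ∀ n, |(renewalSeq P C ν n).toReal - (∑' j, returnTail P C ν j)⁻¹| * r ^ n ≤ k₀) :
    spectralRadius ℂ T ≤ ENNReal.ofReal r⁻¹ := by
  have := hD.isProbabilityMeasure_regenerative
  have hk0 : 0 ≤ k₀ := (mul_nonneg (abs_nonneg _) (by positivity)).trans (hk 0)
  have hM := hD.MVBound_nonneg hr hrl hk0
  have hr0 : 0 < r := by linarith
  refine spectralRadius_le_of_norm_pow_le hr0 (M := MVBound l K k₀ r) fun n => ?_
  rw [← le_div_iff₀ (by positivity)]
  refine ContinuousLinearMap.opNorm_le_bound _ (by positivity) fun g => ?_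
  refine BV.norm_le_of_forall _ (by positivity) fun x => ?_
  rw [hD.isCentered_pow_apply hD.invariant_regenerative hD.lintegral_regenerative_lt_top hT]
  have h := hD.norm_integral_pow_sub_le hr hrl hk g x n
  rw [← le_div_iff₀ (by positivity)] at h
  refine h.trans (le_of_eq ?_)
  ring

end AtomDrift

end Spectrum

/-! ### The parameters α, κ and α₀. -/

section Parameters

/-- At α = 1 the chord is √2, and the claim reduces to 0 ≤ 2b(1-b)(√2 - 1). It guarantees
(1-b)r^κ(1) < 1 whenever r^κ(1) < 1 + D(1), as needed when α < 1. -/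
theorem mul_kendallD_one_le {b : ℝ} (hb0 : 0 < b) (hb1 : b < 1) : (1 - b) * kendallD b 1 ≤ b := by
  have hb : 0 < 1 - b := by linarith
  have h2 : (1 : ℝ) < √2 := by
    rw [Real.lt_sqrt zero_le_one]; norm_num
  have h2' : √2 * √2 = 2 := Real.mul_self_sqrt (by norm_num)
  have ht : 2 * Real.sin (Real.pi / (1 + 1) / 2) = √2 := by
    rw [show Real.pi / (1 + 1) / 2 = Real.pi / 4 by ring, Real.sin_pi_div_four]
    ring
  rw [kendallD_eq hb1 zero_le_one, mul_div_cancel₀ _ hb.ne', ht, chordBound,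
    div_le_iff₀ (by linarith), sub_le_iff_le_add, Real.sqrt_le_iff]
  constructor
  · positivity
  · rw [show √2 ^ 2 = 2 by rw [sq, h2']]
    nlinarith [mul_pos (mul_pos hb0 hb) (sub_pos.2 h2)]

theorem kendall_excess_eq {l K : ℝ} (hl0 : 0 < l) (hl1 : l < 1) :
    (l⁻¹ * K - 1) / (l⁻¹ - 1) - 1 = l⁻¹ * (K - 1) / (l⁻¹ - 1) := by
  have h : l⁻¹ - 1 ≠ 0 := by
    have := (one_lt_inv₀ hl0).2 hl1
    linarith
  rw [div_sub_one h]
  congr 1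
  ring

/-- Positivity of κ makes `kendallRadius` exceed 1; the stronger κ ≥ 1 yields r ≤ r^κ, used in the
case α < 1. -/
theorem one_le_kendallKappa {b R L α : ℝ} (hR : 1 < R) (hb1 : b < 1) (hα : 0 < α)
    (h : R * ((1 - b) * α) ≤ (L - 1) / (R - 1) - 1) : 1 ≤ kendallKappa b R L α := by
  have hm : 0 < (1 - b) * α := mul_pos (by linarith) hα
  rw [kendallKappa, one_le_div (Real.log_pos hR)]
  exact Real.log_le_log (by linarith) ((le_div_iff₀ hm).2 h)

theorem one_lt_kendallRadius {b R L α : ℝ} (hb0 : 0 < b) (hb1 : b < 1) (hα : 0 < α)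
    (hκ : 0 < kendallKappa b R L α) : 1 < kendallRadius b R L α := by
  have := div_pos (kendallD_pos hb0 hb1 hα.le) hα
  exact Real.one_lt_rpow (by linarith) (one_div_pos.2 hκ)

theorem rpow_kendallKappa_lt {b R L α r : ℝ} (hb0 : 0 < b) (hb1 : b < 1) (hα : 0 < α)
    (hκ : 0 < kendallKappa b R L α) (hr : 0 ≤ r) (h : r < kendallRadius b R L α) :
    r ^ kendallKappa b R L α < 1 + kendallD b α / α := by
  have h1 := div_pos (kendallD_pos hb0 hb1 hα.le) hα
  have h2 := Real.rpow_lt_rpow hr h hκ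
  rwa [kendallRadius, ← Real.rpow_mul (by linarith), one_div_mul_cancel hκ.ne', Real.rpow_one] at h2

theorem continuousOn_kendallD {b a : ℝ} (hb1 : b < 1) : ContinuousOn (kendallD b) (Set.Icc 1 a) := by
  have h : Set.EqOn (kendallD b)
      (fun α => chordBound b (2 * Real.sin (Real.pi / (1 + α) / 2)) / (1 - b)) (Set.Icc 1 a) :=
    fun α hα => kendallD_eq hb1 (by linarith [hα.1])
  refine ContinuousOn.congr ?_ h
  have hsin : ContinuousOn (fun α : ℝ => 2 * Real.sin (Real.pi / (1 + α) / 2)) (Set.Icc 1 a) := by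
    refine continuousOn_const.mul (Real.continuous_sin.comp_continuousOn ?_)
    refine (continuousOn_const.div (by fun_prop) fun α hα => ?_).div_const _
    linarith [hα.1]
  refine ContinuousOn.div_const ?_ _
  unfold chordBound
  refine ContinuousOn.div ?_ hsin fun α hα => ?_
  · exact (Real.continuous_sqrt.comp_continuousOn
      (continuousOn_const.add (continuousOn_const.mul (hsin.pow 2)))).sub continuousOn_const
  · exact (mul_pos two_pos (sin_half_pos (by linarith [hα.1]))).ne'

theorem continuousOn_kendallKappa {b R L a : ℝ} (hb1 : b < 1)
    (hM : 0 < (L - 1) / (R - 1) - 1) : ContinuousOn (kendallKappa b R L) (Set.Icc 1 a) := by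
  unfold kendallKappa
  have hb : 0 < 1 - b := by linarith
  refine ContinuousOn.div_const (ContinuousOn.log ?_ fun α hα => ?_) _
  · refine continuousOn_const.div (by fun_prop) fun α hα => ?_
    exact (mul_pos hb (by linarith [hα.1])).ne'
  · exact (div_pos hM (mul_pos hb (by linarith [hα.1]))).ne'

theorem continuousOn_kendallRadius {b R L a : ℝ} (hb0 : 0 < b) (hb1 : b < 1)
    (hM : 0 < (L - 1) / (R - 1) - 1) (hκ : ∀ α ∈ Set.Icc 1 a, 0 < kendallKappa b R L α) :
    ContinuousOn (kendallRadius b R L) (Set.Icc 1 a) := by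
  unfold kendallRadius
  refine ContinuousOn.rpow ?_ ?_ fun α hα => Or.inl ?_
  · exact continuousOn_const.add ((continuousOn_kendallD hb1).div continuousOn_id
      fun α hα => (zero_lt_one.trans_le hα.1).ne')
  · exact continuousOn_const.div (continuousOn_kendallKappa hb1 hM) fun α hα => (hκ α hα).ne'
  · have h0 : 0 < α := by linarith [hα.1]
    have := div_pos (kendallD_pos hb0 hb1 h0.le) h0
    linarith

theorem continuousOn_kendallBound {b R L a r : ℝ} (hb1 : b < 1)
    (hM : 0 < (L - 1) / (R - 1) - 1) (hr : 1 < r)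
    (h : ∀ α ∈ Set.Icc 1 a, r ^ kendallKappa b R L α < 1 + kendallD b α / α) :
    ContinuousOn (fun α => kendallBound b R L α r) (Set.Icc 1 a) := by
  have hr0 : 0 < r := by linarith
  have hpow : ContinuousOn (fun α => r ^ kendallKappa b R L α) (Set.Icc 1 a) :=
    continuousOn_const.rpow (continuousOn_kendallKappa hb1 hM) fun α _ => Or.inl hr0.ne'
  unfold kendallBound
  refine (hpow.sub continuousOn_const).div (continuousOn_const.mul (((
    (continuousOn_kendallD hb1).div continuousOn_id fun α hα => ?_).sub hpow).add
      continuousOn_const)) fun α hα => ?_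
  · exact (zero_lt_one.trans_le hα.1).ne'
  · have h1 := h α hα
    exact (mul_pos (by linarith) (by linarith)).ne'

theorem kendallBound_nonneg {b R L α r : ℝ} (hr : 1 < r) (hκ : 0 < kendallKappa b R L α)
    (h : r ^ kendallKappa b R L α < 1 + kendallD b α / α) : 0 ≤ kendallBound b R L α r := by
  have h1 := Real.one_lt_rpow hr hκ
  exact div_nonneg (by linarith) (mul_nonneg (by linarith) (by linarith))

/-- Among sequences bounded by `q` with sum `q α`, the weighted sum `∑ aⱼ Rʲ (R - 1)` is at least
its value `q (R ^ α - 1)` for mass concentrated at the smallest indices. -/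
theorem mul_rpow_sub_one_le_tsum {a : ℕ → ℝ} {q R α : ℝ} (ha0 : ∀ n, 0 ≤ a n)
    (haq : ∀ n, a n ≤ q) (hR : 1 < R) (hα : 0 ≤ α) (hs : Summable fun n => a n * R ^ n)
    (hsum : ∑' n, a n = q * α) : q * (R ^ α - 1) ≤ (R - 1) * ∑' n, a n * R ^ n := by
  have hR0 : 0 < R := by linarith
  have hq : 0 ≤ q := (ha0 0).trans (haq 0)
  set n := ⌊α⌋₊ with hn
  have hnα : (n : ℝ) ≤ α := Nat.floor_le hα
  have hαn : α < n + 1 := Nat.lt_floor_add_one α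
  have hsa := summable_of_summable_mul_pow ha0 hR.le hs
  have hfin : HasSum (fun j => if j < n then q * (R ^ j - R ^ n) else 0)
      (∑ j ∈ Finset.range n, q * (R ^ j - R ^ n)) := by
    have : HasSum (fun j => if j < n then q * (R ^ j - R ^ n) else 0)
        (∑ j ∈ Finset.range n, if j < n then q * (R ^ j - R ^ n) else 0) :=
      hasSum_sum_of_ne_finset_zero fun j hj => if_neg (by simpa using hj)
    convert this using 1
    exact Finset.sum_congr rfl fun j hj => (if_pos (Finset.mem_range.1 hj)).symm
  -- Comparison with the sequence that saturates the bound `q` below n = ⌊α⌋ and puts the rest at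
  -- `n`. For j < n this is (q - a_j)(Rⁿ - R^j) ≥ 0.
  have hterm : ∀ j, a j * R ^ n + (if j < n then q * (R ^ j - R ^ n) else 0) ≤ a j * R ^ j := by
    intro j
    split_ifs with hj
    · have := pow_le_pow_right₀ hR.le hj.le
      nlinarith [mul_nonneg (sub_nonneg.2 (haq j)) (sub_nonneg.2 this)]
    · have := pow_le_pow_right₀ hR.le (not_lt.1 hj)
      rw [add_zero]
      exact mul_le_mul_of_nonneg_left this (ha0 j)
  have h1 := ((hsa.mul_right (R ^ n)).add hfin.summable).tsum_le_tsum hterm hs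
  rw [(hsa.mul_right (R ^ n)).tsum_add hfin.summable, tsum_mul_right, hfin.tsum_eq, hsum,
    ← Finset.mul_sum, Finset.sum_sub_distrib, Finset.sum_const, Finset.card_range,
    nsmul_eq_mul] at h1
  have hgeom : (R - 1) * ∑ j ∈ Finset.range n, R ^ j = R ^ n - 1 := mul_geom_sum R n
  -- Bernoulli's inequality handles the fractional part of α.
  have h2 : R ^ α ≤ R ^ n * (1 + (α - n) * (R - 1)) := by
    have h3 : R ^ α = R ^ n * R ^ (α - n) := by
      rw [← Real.rpow_natCast, ← Real.rpow_add hR0]; congr 1; ring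
    have h4 := rpow_one_add_le_one_add_mul_self (s := R - 1) (p := α - n) (by linarith)
      (by linarith) (by linarith)
    rw [add_sub_cancel] at h4
    rw [h3]
    gcongr
  have h5 := mul_le_mul_of_nonneg_left h1 (show 0 ≤ R - 1 by linarith)
  have h6 := mul_le_mul_of_nonneg_left h2 hq
  calc q * (R ^ α - 1) ≤ q * (R ^ n * (1 + (α - n) * (R - 1)) - 1) := by linarith
    _ = (R - 1) * (q * α * R ^ n + q * ((∑ j ∈ Finset.range n, R ^ j) - n * R ^ n)) := by
        linear_combination (-q) * hgeom
    _ ≤ _ := h5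

theorem kendallAlpha0_eq {b l K : ℝ} (hl0 : 0 < l) :
    kendallAlpha0 b l⁻¹ (l⁻¹ * K) = Real.log ((K - b) / (1 - b)) / Real.log l⁻¹ := by
  have h : l⁻¹ ≠ 0 := inv_ne_zero hl0.ne'
  rw [kendallAlpha0]
  congr 2
  rw [show l⁻¹ * K - b * l⁻¹ = (K - b) * l⁻¹ by ring, mul_div_mul_right _ _ h]

/-- α₀ is the value of α at which the least weighted sum compatible with c_1 ≤ 1 - b reaches the
drift bound K - 1. -/
theorem le_kendallAlpha0_iff {b l K α : ℝ} (hl0 : 0 < l) (hl1 : l < 1) (hb1 : b < 1) (hK : 1 ≤ K) :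
    α ≤ kendallAlpha0 b l⁻¹ (l⁻¹ * K) ↔ (1 - b) * (l⁻¹ ^ α - 1) ≤ K - 1 := by
  have hR := (one_lt_inv₀ hl0).2 hl1
  have hb : 0 < 1 - b := by linarith
  rw [kendallAlpha0_eq hl0, le_div_iff₀ (Real.log_pos hR),
    Real.le_log_iff_exp_le (div_pos (by linarith) hb), mul_comm α,
    ← Real.rpow_def_of_pos (by linarith), le_div_iff₀ hb]
  constructor <;> intro h <;> linarith

/-- On the range of admissible parameters the exponent `κ` is at least one. -/
theorem excess_ge_of_le_kendallAlpha0 {b l K α : ℝ} (hl0 : 0 < l) (hl1 : l < 1) (hb1 : b < 1)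
    (hK : 1 ≤ K) (hα1 : 1 ≤ α) (hα : α ≤ kendallAlpha0 b l⁻¹ (l⁻¹ * K)) :
    l⁻¹ * ((1 - b) * α) ≤ (l⁻¹ * K - 1) / (l⁻¹ - 1) - 1 := by
  have hR := (one_lt_inv₀ hl0).2 hl1
  have hb : 0 < 1 - b := by linarith
  rw [le_kendallAlpha0_iff hl0 hl1 hb1 hK] at hα
  rw [kendall_excess_eq hl0 hl1, le_div_iff₀ (by linarith)]
  -- Bernoulli for the exponent α ≥ 1 replaces R^α - 1 by the smaller α(R - 1).
  have h1 := one_add_mul_self_le_rpow_one_add (s := l⁻¹ - 1) (by linarith) hα1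
  rw [add_sub_cancel] at h1
  have h2 := mul_le_mul_of_nonneg_left h1 hb.le
  have h3 : (1 - b) * (α * (l⁻¹ - 1)) ≤ K - 1 := by linarith
  have h4 := mul_le_mul_of_nonneg_left h3 (show 0 ≤ l⁻¹ by linarith)
  linarith

end Parameters

/-! ### Renewal rates for the chain and the final assembly. -/

section Main

variable {S : Type*} [MeasurableSpace S] {P : Kernel S S} {C : Set S} {ν : Measure S}
  {V : Weight S} {b l K : ℝ}

theorem eq_of_forall_le_apply {μ η : Measure S} [IsProbabilityMeasure μ] [IsProbabilityMeasure η]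
    (h : ∀ A, MeasurableSet A → η A ≤ μ A) : μ = η :=
  (Measure.eq_of_le_of_isProbabilityMeasure (Measure.le_iff.2 h)).symm

/-- The spectral bounds hold for each r below the critical radius; letting r increase to it gives
the bound at the radius itself. -/
theorem le_ofReal_inv_of_forall_lt {x : ℝ≥0∞} {ρ : ℝ} (hρ : 1 < ρ)
    (h : ∀ r, 1 < r → r < ρ → x ≤ ENNReal.ofReal r⁻¹) : x ≤ ENNReal.ofReal ρ⁻¹ := by
  have hc : Filter.Tendsto (fun r : ℝ => ENNReal.ofReal r⁻¹) (nhdsWithin ρ (Set.Iio ρ))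
      (nhds (ENNReal.ofReal ρ⁻¹)) :=
    (ENNReal.continuous_ofReal.tendsto _).comp
      ((tendsto_inv₀ (by linarith)).mono_left nhdsWithin_le_nhds)
  refine ge_of_tendsto hc ?_
  filter_upwards [Ioo_mem_nhdsLT hρ] with r hr using h r hr.1 hr.2

namespace AtomDrift

theorem tsum_succ_eq [IsMarkovKernel P] [IsProbabilityMeasure ν] (hD : AtomDrift P C ν V l K) :
    ∑' n, returnTail P C ν (n + 1) = ∑' n, returnTail P C ν n - 1 := by
  rw [hD.summable_returnTail.tsum_eq_zero_add, returnTail_zero, add_sub_cancel_left]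

theorem tsum_returnTail_le_excess [IsMarkovKernel P] [IsProbabilityMeasure ν]
    (hD : AtomDrift P C ν V l K) : ∑' n, returnTail P C ν (n + 1) * l⁻¹ ^ (n + 1)
      ≤ (l⁻¹ * K - 1) / (l⁻¹ - 1) - 1 :=
  hD.tsum_returnTail_le.trans_eq (kendall_excess_eq hD.pos hD.lt_one).symm

theorem mul_tsum_succ_le_excess [IsMarkovKernel P] [IsProbabilityMeasure ν]
    (hD : AtomDrift P C ν V l K) :
    l⁻¹ * ∑' n, returnTail P C ν (n + 1) ≤ (l⁻¹ * K - 1) / (l⁻¹ - 1) - 1 := by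
  refine le_trans ?_ hD.tsum_returnTail_le_excess
  have hs := (summable_nat_add_iff 1).2 hD.summable_returnTail
  have hs' := (summable_nat_add_iff 1).2 hD.summable_returnTail_mul_pow
  rw [← tsum_mul_left]
  refine (hs.mul_left _).tsum_le_tsum (fun n => ?_) hs'
  rw [mul_comm]
  exact mul_le_mul_of_nonneg_left (le_self_pow₀ hD.one_lt_inv.le n.succ_ne_zero)
    (returnTail_nonneg _)

/-- The first drift step gives (1-l)c_1 ≤ l(K-1), because the excess at time 1 is nonnegative. With
c_1 = 1-b this is the criterion for α = 1. -/
theorem one_le_kendallAlpha0 [IsMarkovKernel P] [IsProbabilityMeasure ν]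
    (hD : AtomDrift P C ν V l K) (hb1 : b < 1) (hb : returnTail P C ν 1 = 1 - b) :
    1 ≤ kendallAlpha0 b l⁻¹ (l⁻¹ * K) := by
  have hl := hD.pos
  rw [le_kendallAlpha0_iff hl hD.lt_one hb1 hD.one_le_const, Real.rpow_one]
  have h1 := hD.tabooExcess_succ_le hD.lintegral_atom_lt_top 0
  rw [← returnTail_succ, zero_add, hb] at h1
  have h2 := tabooExcess_nonneg (P := P) (C := C) (V := V) ν 1
  have h3 := mul_le_mul_of_nonneg_left hD.tabooExcess_zero_le hl.le
  have h4 : (1 - l) * (1 - b) ≤ l * (K - 1) := by linarith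
  calc (1 - b) * (l⁻¹ - 1) = l⁻¹ * ((1 - l) * (1 - b)) := by
        linear_combination (1 - b) * inv_mul_cancel₀ hl.ne'
    _ ≤ l⁻¹ * (l * (K - 1)) := mul_le_mul_of_nonneg_left h4 (inv_nonneg.2 hl.le)
    _ = K - 1 := inv_mul_cancel_left₀ hl.ne' _

theorem abs_renewalSeq_sub_le_kendallBound [IsMarkovKernel P] [IsProbabilityMeasure ν]
    (hD : AtomDrift P C ν V l K) (hb0 : 0 < b) (hb1 : b < 1) (hb : returnTail P C ν 1 ≤ 1 - b)
    {α r : ℝ} (hr : 1 < r) (hrR : r < l⁻¹) (hα : 0 < α)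
    (hcα : ∑' n, returnTail P C ν (n + 1) = (1 - b) * α)
    (hκ : r ^ kendallKappa b l⁻¹ (l⁻¹ * K) α < 1 + kendallD b α / α) (n : ℕ) :
    |(renewalSeq P C ν n).toReal - (∑' j, returnTail P C ν j)⁻¹| * r ^ n
      ≤ (∑' j, returnTail P C ν j)⁻¹ * kendallBound b l⁻¹ (l⁻¹ * K) α r :=
  abs_renewal_sub_le_kendallBound returnTail_zero returnTail_antitone returnTail_nonneg
    (fun _ => ENNReal.toReal_nonneg) (sum_renewalSeq_mul_returnTail hD.measurableSet hD.atom)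
    hb0 hb1 hb hr hrR hD.summable_returnTail_mul_pow hα hcα hD.tsum_returnTail_le_excess hκ n

theorem one_le_kendallKappa_of_tsum_eq [IsMarkovKernel P] [IsProbabilityMeasure ν]
    (hD : AtomDrift P C ν V l K) (hb1 : b < 1) {α : ℝ} (hα : 0 < α)
    (hcα : ∑' n, returnTail P C ν (n + 1) = (1 - b) * α) :
    1 ≤ kendallKappa b l⁻¹ (l⁻¹ * K) α :=
  one_le_kendallKappa hD.one_lt_inv hb1 hα (hcα ▸ hD.mul_tsum_succ_le_excess)

section Known

variable [IsMarkovKernel P] [IsProbabilityMeasure ν]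

theorem known_pos (hD : AtomDrift P C ν V l K) (hb1 : b < 1)
    (hp : (∑' j, returnTail P C ν j)⁻¹ < 1) :
    0 < (((∑' j, returnTail P C ν j)⁻¹)⁻¹ - 1) / (1 - b) := by
  have h := hD.one_le_tsum_returnTail
  rw [inv_inv]
  have : 1 < ∑' j, returnTail P C ν j := by
    by_contra! h'
    rw [le_antisymm h' h, inv_one] at hp
    exact lt_irrefl _ hp
  exact div_pos (by linarith) (by linarith)

theorem known_tsum_eq (hD : AtomDrift P C ν V l K) (hb1 : b < 1) :
    ∑' n, returnTail P C ν (n + 1)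
      = (1 - b) * ((((∑' j, returnTail P C ν j)⁻¹)⁻¹ - 1) / (1 - b)) := by
  rw [inv_inv, mul_div_cancel₀ _ (by linarith), hD.tsum_succ_eq]

theorem one_lt_r0Known (hD : AtomDrift P C ν V l K) (hb0 : 0 < b) (hb1 : b < 1)
    (hp : (∑' j, returnTail P C ν j)⁻¹ < 1) :
    1 < r0Known b l⁻¹ (l⁻¹ * K) (∑' j, returnTail P C ν j)⁻¹ := by
  have hα := hD.known_pos hb1 hp
  exact lt_min hD.one_lt_inv (one_lt_kendallRadius hb0 hb1 hα
    (zero_lt_one.trans_le (hD.one_le_kendallKappa_of_tsum_eq hb1 hα (hD.known_tsum_eq hb1))))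

theorem abs_renewalSeq_sub_le_K0Known (hD : AtomDrift P C ν V l K) (hb0 : 0 < b) (hb1 : b < 1)
    (hb : returnTail P C ν 1 ≤ 1 - b) (hp : (∑' j, returnTail P C ν j)⁻¹ < 1) {r : ℝ} (hr : 1 < r)
    (hr0 : r < r0Known b l⁻¹ (l⁻¹ * K) (∑' j, returnTail P C ν j)⁻¹) (n : ℕ) :
    |(renewalSeq P C ν n).toReal - (∑' j, returnTail P C ν j)⁻¹| * r ^ n
      ≤ K0Known b l⁻¹ (l⁻¹ * K) (∑' j, returnTail P C ν j)⁻¹ r := by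
  have hα := hD.known_pos hb1 hp
  have hκ := hD.one_le_kendallKappa_of_tsum_eq hb1 hα (hD.known_tsum_eq hb1)
  exact hD.abs_renewalSeq_sub_le_kendallBound hb0 hb1 hb hr (hr0.trans_le (min_le_left _ _)) hα
    (hD.known_tsum_eq hb1) (rpow_kendallKappa_lt hb0 hb1 hα (by linarith) (by linarith)
      (hr0.trans_le (min_le_right _ _))) n

end Known

/-- Some rate is needed for ergodicity and uniqueness without assuming π(C) < 1 or α₀ ≥ 1. If π(C) =
1, then c_n = 0 for n ≥ 1 and the elementary renewal bound applies with T = 0. -/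
theorem exists_abs_renewalSeq_sub_le [IsMarkovKernel P] [IsProbabilityMeasure ν]
    (hD : AtomDrift P C ν V l K) (hb0 : 0 < b) (hb1 : b < 1) (hb : returnTail P C ν 1 ≤ 1 - b) :
    ∃ r k₀ : ℝ, 1 < r ∧ r < l⁻¹ ∧
      ∀ n, |(renewalSeq P C ν n).toReal - (∑' j, returnTail P C ν j)⁻¹| * r ^ n ≤ k₀ := by
  have h1 := hD.one_le_tsum_returnTail
  by_cases hp : (∑' j, returnTail P C ν j)⁻¹ < 1
  · obtain ⟨r, hr, hr0⟩ := exists_between (hD.one_lt_r0Known hb0 hb1 hp)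
    exact ⟨r, _, hr, hr0.trans_le (min_le_left _ _),
      hD.abs_renewalSeq_sub_le_K0Known hb0 hb1 hb hp hr hr0⟩
  · obtain ⟨r, hr, hr0⟩ := exists_between hD.one_lt_inv
    refine ⟨r, _, hr, hr0, fun n => abs_renewal_sub_le_of_tsum_lt_one (T := 0) returnTail_zero
      returnTail_nonneg (sum_renewalSeq_mul_returnTail hD.measurableSet hD.atom) hr.le
      (summable_mul_pow_of_le returnTail_nonneg (by linarith) hr0.le
        hD.summable_returnTail_mul_pow) ?_ zero_lt_one n⟩
    have h2 : ∑' j, returnTail P C ν j ≤ 1 := by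
      rw [not_lt, le_inv_comm₀ zero_lt_one (by linarith), inv_one] at hp
      exact hp
    have h3 : ∑' n, returnTail P C ν (n + 1) = 0 := by
      rw [hD.tsum_succ_eq]; linarith
    have hs := (summable_nat_add_iff 1).2 hD.summable_returnTail
    have h4 := (hs.hasSum_iff.2 h3)
    rw [hasSum_zero_iff_of_nonneg fun _ => returnTail_nonneg _] at h4
    simp [funext_iff] at h4
    simp [h4]

section Unknown

variable [IsMarkovKernel P] [IsProbabilityMeasure ν]

theorem one_le_kendallKappa_of_mem (hD : AtomDrift P C ν V l K) (hb1 : b < 1) {α : ℝ}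
    (hα : α ∈ Set.Icc 1 (kendallAlpha0 b l⁻¹ (l⁻¹ * K))) :
    1 ≤ kendallKappa b l⁻¹ (l⁻¹ * K) α :=
  one_le_kendallKappa hD.one_lt_inv hb1 (zero_lt_one.trans_le hα.1)
    (excess_ge_of_le_kendallAlpha0 hD.pos hD.lt_one hb1 hD.one_le_const hα.1 hα.2)

theorem excess_pos (hD : AtomDrift P C ν V l K) (hb1 : b < 1)
    (hα0 : 1 ≤ kendallAlpha0 b l⁻¹ (l⁻¹ * K)) : 0 < (l⁻¹ * K - 1) / (l⁻¹ - 1) - 1 := by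
  refine lt_of_lt_of_le ?_
    (excess_ge_of_le_kendallAlpha0 hD.pos hD.lt_one hb1 hD.one_le_const le_rfl hα0)
  have := hD.one_lt_inv
  exact mul_pos (by linarith) (by linarith)

theorem isCompact_image_kendallRadius (hD : AtomDrift P C ν V l K) (hb0 : 0 < b) (hb1 : b < 1)
    (hα0 : 1 ≤ kendallAlpha0 b l⁻¹ (l⁻¹ * K)) :
    IsCompact (kendallRadius b l⁻¹ (l⁻¹ * K) '' Set.Icc 1 (kendallAlpha0 b l⁻¹ (l⁻¹ * K))) :=
  isCompact_Icc.image_of_continuousOn (continuousOn_kendallRadius hb0 hb1 (hD.excess_pos hb1 hα0)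
    fun _ hα => zero_lt_one.trans_le (hD.one_le_kendallKappa_of_mem hb1 hα))

theorem one_lt_r0 (hD : AtomDrift P C ν V l K) (hb0 : 0 < b) (hb1 : b < 1)
    (hα0 : 1 ≤ kendallAlpha0 b l⁻¹ (l⁻¹ * K)) : 1 < r0 b l⁻¹ (l⁻¹ * K) := by
  refine lt_min hD.one_lt_inv ?_
  obtain ⟨α, hα, h⟩ := (hD.isCompact_image_kendallRadius hb0 hb1 hα0).sInf_mem
    ((Set.nonempty_Icc.2 hα0).image _)
  rw [← h]
  exact one_lt_kendallRadius hb0 hb1 (zero_lt_one.trans_le hα.1)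
    (zero_lt_one.trans_le (hD.one_le_kendallKappa_of_mem hb1 hα))

theorem rpow_kendallKappa_lt_of_lt_r0 (hD : AtomDrift P C ν V l K) (hb0 : 0 < b) (hb1 : b < 1)
    {α r : ℝ} (hr : 1 < r) (hr0 : r < r0 b l⁻¹ (l⁻¹ * K))
    (hα : α ∈ Set.Icc 1 (kendallAlpha0 b l⁻¹ (l⁻¹ * K))) :
    r ^ kendallKappa b l⁻¹ (l⁻¹ * K) α < 1 + kendallD b α / α :=
  rpow_kendallKappa_lt hb0 hb1 (zero_lt_one.trans_le hα.1)
    (zero_lt_one.trans_le (hD.one_le_kendallKappa_of_mem hb1 hα)) (by linarith)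
    (hr0.trans_le ((min_le_right _ _).trans (csInf_le
      (hD.isCompact_image_kendallRadius hb0 hb1 (hα.1.trans hα.2)).bddBelow
      (Set.mem_image_of_mem _ hα))))

theorem kendallBound_le_K0 (hD : AtomDrift P C ν V l K) (hb0 : 0 < b) (hb1 : b < 1)
    {α r : ℝ} (hr : 1 < r) (hr0 : r < r0 b l⁻¹ (l⁻¹ * K))
    (hα : α ∈ Set.Icc 1 (kendallAlpha0 b l⁻¹ (l⁻¹ * K))) :
    kendallBound b l⁻¹ (l⁻¹ * K) α r ≤ K0 b l⁻¹ (l⁻¹ * K) r :=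
  le_csSup (isCompact_Icc.image_of_continuousOn (continuousOn_kendallBound hb1
    (hD.excess_pos hb1 (hα.1.trans hα.2)) hr fun _ =>
      hD.rpow_kendallKappa_lt_of_lt_r0 hb0 hb1 hr hr0)).bddAbove (Set.mem_image_of_mem _ hα)

/-- The terms c_n with n ≥ 1 are at most 1 - b and sum to (1-b)α, so their weighted sum is at least
that of mass packed at the smallest indices. The drift bounds the same weighted sum from above. -/
theorem le_kendallAlpha0_of_tsum_eq (hD : AtomDrift P C ν V l K) (hb1 : b < 1)
    (hb : returnTail P C ν 1 ≤ 1 - b) {α : ℝ} (hα : 0 ≤ α)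
    (hcα : ∑' n, returnTail P C ν (n + 1) = (1 - b) * α) :
    α ≤ kendallAlpha0 b l⁻¹ (l⁻¹ * K) := by
  have hR := hD.one_lt_inv
  rw [le_kendallAlpha0_iff hD.pos hD.lt_one hb1 hD.one_le_const]
  have hsh : ∀ n, returnTail P C ν (n + 1) * l⁻¹ ^ (n + 1)
      = l⁻¹ * (returnTail P C ν (n + 1) * l⁻¹ ^ n) := fun n => by ring
  have hs := (summable_nat_add_iff 1).2 hD.summable_returnTail_mul_pow
  have hT := hD.tsum_returnTail_le
  simp only [hsh] at hs hT
  rw [summable_mul_left_iff (by linarith)] at hs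
  rw [tsum_mul_left, mul_div_assoc, mul_le_mul_iff_of_pos_left (by linarith),
    le_div_iff₀ (by linarith), mul_comm] at hT
  exact (mul_rpow_sub_one_le_tsum (fun _ => returnTail_nonneg _)
    (fun n => (returnTail_antitone (by omega)).trans hb) hR hα hs hcα).trans hT

theorem abs_renewalSeq_sub_le_K0 (hD : AtomDrift P C ν V l K) (hb0 : 0 < b) (hb1 : b < 1)
    (hb : returnTail P C ν 1 ≤ 1 - b) (hα0 : 1 ≤ kendallAlpha0 b l⁻¹ (l⁻¹ * K)) {r : ℝ}
    (hr : 1 < r) (hr0 : r < r0 b l⁻¹ (l⁻¹ * K)) (n : ℕ) :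
    |(renewalSeq P C ν n).toReal - (∑' j, returnTail P C ν j)⁻¹| * r ^ n
      ≤ K0 b l⁻¹ (l⁻¹ * K) r := by
  have hb' : 0 < 1 - b := by linarith
  have hrR : r < l⁻¹ := hr0.trans_le (min_le_left _ _)
  -- If the true α is at least 1 it lies in [1, α₀] and the analytic bound applies, with π(C) ≤ 1
  -- discarded. Otherwise the elementary bound with T = (1-b)r^κ(1) is compared with `kendallBound`
  -- at α = 1.
  rcases le_or_gt (1 - b) (∑' n, returnTail P C ν (n + 1)) with hge | hlt
  · have hα : 1 ≤ (∑' n, returnTail P C ν (n + 1)) / (1 - b) := (one_le_div hb').2 hge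
    have hcα := (mul_div_cancel₀ (∑' n, returnTail P C ν (n + 1)) hb'.ne').symm
    have hmem : _ ∈ Set.Icc 1 (kendallAlpha0 b l⁻¹ (l⁻¹ * K)) :=
      ⟨hα, hD.le_kendallAlpha0_of_tsum_eq hb1 hb (by linarith) hcα⟩
    have hκ := hD.rpow_kendallKappa_lt_of_lt_r0 hb0 hb1 hr hr0 hmem
    refine (hD.abs_renewalSeq_sub_le_kendallBound hb0 hb1 hb hr hrR (by linarith) hcα hκ n).trans ?_
    refine le_trans ?_ (hD.kendallBound_le_K0 hb0 hb1 hr hr0 hmem)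
    exact mul_le_of_le_one_left (kendallBound_nonneg hr
      (zero_lt_one.trans_le (hD.one_le_kendallKappa_of_mem hb1 hmem)) hκ)
      (inv_le_one_of_one_le₀ hD.one_le_tsum_returnTail)
  · have hmem : (1 : ℝ) ∈ Set.Icc 1 (kendallAlpha0 b l⁻¹ (l⁻¹ * K)) := ⟨le_rfl, hα0⟩
    have hκ := hD.rpow_kendallKappa_lt_of_lt_r0 hb0 hb1 hr hr0 hmem
    have hκ1 := hD.one_le_kendallKappa_of_mem hb1 hmem
    have hM := hD.excess_pos hb1 hα0
    have hT := tsum_succ_mul_pow_le_mul_rpow (c := returnTail P C ν) returnTail_nonneg hr.le hrR.le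
      hD.one_lt_inv (div_pos hM hb') hD.summable_returnTail_mul_pow hlt.le
      (hD.tsum_returnTail_le_excess.trans_eq (div_mul_cancel₀ _ hb'.ne').symm)
    rw [show Real.log (((l⁻¹ * K - 1) / (l⁻¹ - 1) - 1) / (1 - b)) / Real.log l⁻¹
      = kendallKappa b l⁻¹ (l⁻¹ * K) 1 by rw [kendallKappa, mul_one]] at hT
    have hle := hD.kendallBound_le_K0 hb0 hb1 hr hr0 hmem
    rw [kendallBound] at hle
    rw [div_one] at hle hκ
    have hry : r ≤ r ^ kendallKappa b l⁻¹ (l⁻¹ * K) 1 := by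
      simpa using Real.rpow_le_rpow_of_exponent_le hr.le hκ1
    set y := r ^ kendallKappa b l⁻¹ (l⁻¹ * K) 1
    have hDb := mul_kendallD_one_le hb0 hb1
    have hX : 0 < kendallD b 1 - y + 1 := by linarith
    have hT1 : (1 - b) * (kendallD b 1 - y + 1) ≤ 1 - (1 - b) * y := by linarith
    have hX' := mul_pos hb' hX
    refine (abs_renewal_sub_le_of_tsum_lt_one returnTail_zero returnTail_nonneg
      (sum_renewalSeq_mul_returnTail hD.measurableSet hD.atom) hr.le
      (summable_mul_pow_of_le returnTail_nonneg (by linarith) hrR.le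
        hD.summable_returnTail_mul_pow) hT (by linarith) n).trans (le_trans ?_ hle)
    -- The last inequality y/r ≤ (y-1)/(r-1), up to the common denominator, is equivalent to r ≤ y.
    calc (1 - b) * y / (r * (1 - (1 - b) * y))
        ≤ (1 - b) * y / (r * ((1 - b) * (kendallD b 1 - y + 1))) :=
          div_le_div_of_nonneg_left (mul_nonneg hb'.le (by linarith))
            (mul_pos (by linarith) hX') (mul_le_mul_of_nonneg_left hT1 (by linarith))
      _ = y / (r * (kendallD b 1 - y + 1)) := by
          rw [mul_left_comm r, mul_div_mul_left _ _ hb'.ne']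
      _ ≤ _ := by
          rw [div_le_div_iff₀ (mul_pos (by linarith) hX) (mul_pos (by linarith) hX)]
          nlinarith [mul_nonneg hX.le (sub_nonneg.2 hry)]

end Unknown

end AtomDrift

end Main

theorem theorem2 {S : Type*} [MeasurableSpace S]
    (P : ProbabilityTheory.Kernel S S) [ProbabilityTheory.IsMarkovKernel P]
    (C : Set S) (hC : MeasurableSet C)
    (ν : MeasureTheory.Measure S) [MeasureTheory.IsProbabilityMeasure ν]
    (V : Weight S) (b l K : ℝ)
    (hb0 : 0 < b) (hb1 : b < 1) (hl0 : 0 < l) (hl1 : l < 1)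
    -- minorization with constant one
    (hmin : ∀ x ∈ C, ∀ A : Set S, MeasurableSet A → ν A ≤ P x A)
    -- drift
    (hdrift : ∀ x, x ∉ C → ∫⁻ y, ENNReal.ofReal (V y) ∂(P x) ≤ ENNReal.ofReal (l * V x))
    (hdriftC : ∀ x ∈ C, ∫⁻ y, ENNReal.ofReal (V y) ∂(P x) ≤ ENNReal.ofReal K)
    -- strong aperiodicity
    (haper : ENNReal.ofReal b ≤ ν C) :
    ∃ π : MeasureTheory.Measure S,
      MeasureTheory.IsProbabilityMeasure π ∧
      ProbabilityTheory.Kernel.Invariant P π ∧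
      (∀ π' : MeasureTheory.Measure S, MeasureTheory.IsProbabilityMeasure π' →
        ProbabilityTheory.Kernel.Invariant P π' → π' = π) ∧
      ∫⁻ y, ENNReal.ofReal (V y) ∂π < ⊤ ∧
      ∃ T : BV V →L[ℂ] BV V, IsCentered P π V T ∧
        -- geometric ergodicity
        spectralRadius ℂ T < 1 ∧
        (∃ r : ℝ, 1 < r ∧ optimalConst P π V r < ⊤) ∧
        -- explicit bounds, with `π(C)` as a known parameter
        ((π C).toReal < 1 →
          1 < r0Known b l⁻¹ (l⁻¹ * K) (π C).toReal ∧
          spectralRadius ℂ T ≤ ENNReal.ofReal (r0Known b l⁻¹ (l⁻¹ * K) (π C).toReal)⁻¹ ∧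
          ∀ r : ℝ, 1 < r → r < r0Known b l⁻¹ (l⁻¹ * K) (π C).toReal →
            optimalConst P π V r ≤
              ENNReal.ofReal (MVBound l K (K0Known b l⁻¹ (l⁻¹ * K) (π C).toReal r) r)) ∧
        -- explicit bounds in terms of `b`, `l`, `K` only; the interval `[1, α₀]` is non-empty if `b = ν(C)`
        (ν C = ENNReal.ofReal b → 1 ≤ kendallAlpha0 b l⁻¹ (l⁻¹ * K)) ∧
        (1 ≤ kendallAlpha0 b l⁻¹ (l⁻¹ * K) →
          1 < r0 b l⁻¹ (l⁻¹ * K) ∧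
          spectralRadius ℂ T ≤ ENNReal.ofReal (r0 b l⁻¹ (l⁻¹ * K))⁻¹ ∧
          ∀ r : ℝ, 1 < r → r < r0 b l⁻¹ (l⁻¹ * K) →
            optimalConst P π V r ≤
              ENNReal.ofReal (MVBound l K (K0 b l⁻¹ (l⁻¹ * K) r) r)) := by
  have hCne : C.Nonempty := by
    rw [Set.nonempty_iff_ne_empty]
    rintro rfl
    rw [measure_empty, nonpos_iff_eq_zero, ENNReal.ofReal_eq_zero] at haper
    linarith
  -- Both are probability measures, so domination with constant 1 is equality. As `C` is nonempty,
  -- the drift bound on `C` becomes a bound for ν(V).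
  have hatom : ∀ x ∈ C, P x = ν := fun x hx => eq_of_forall_le_apply (hmin x hx)
  obtain ⟨x₀, hx₀⟩ := hCne
  have hD : AtomDrift P C ν V l K := ⟨hC, hl0, hl1, hatom, hdrift, hatom x₀ hx₀ ▸ hdriftC x₀ hx₀⟩
  have hc1 : returnTail P C ν 1 = 1 - ν.real C := by
    have h := tabooMass_add_real (P := P) hC ν 0
    rw [← returnTail_succ, zero_add, taboo, probReal_univ] at h
    linarith
  have hb : returnTail P C ν 1 ≤ 1 - b := by
    have := (ENNReal.ofReal_le_iff_le_toReal (measure_ne_top ν C)).1 haper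
    rw [hc1, measureReal_def]
    linarith
  have hrl : ∀ {r : ℝ}, r < l⁻¹ → r * l < 1 := fun h => by
    rwa [← one_div, lt_div_iff₀ hl0] at h
  obtain ⟨T, hT⟩ := hD.exists_isCentered hD.lintegral_regenerative_lt_top
  obtain ⟨r₁, k₁, hr₁, hr₁R, hk₁⟩ := hD.exists_abs_renewalSeq_sub_le hb0 hb1 hb
  refine ⟨regenerativeMeasure P C ν, hD.isProbabilityMeasure_regenerative,
    hD.invariant_regenerative, fun π' _ hπ' => hD.eq_regenerative hr₁ (hrl hr₁R) hk₁ π' hπ',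
    hD.lintegral_regenerative_lt_top, T, hT, ?_, ⟨r₁, hr₁, ?_⟩, ?_, ?_, ?_⟩
  · refine (hD.spectralRadius_le hT hr₁ (hrl hr₁R) hk₁).trans_lt ?_
    rw [ENNReal.ofReal_lt_one]
    exact inv_lt_one_of_one_lt₀ hr₁
  · exact (hD.optimalConst_le hr₁ (hrl hr₁R) hk₁).trans_lt ENNReal.ofReal_lt_top
  · rw [hD.regenerative_atom]
    intro hp
    have hr0 := hD.one_lt_r0Known hb0 hb1 hp
    refine ⟨hr0, le_ofReal_inv_of_forall_lt hr0 fun r hr h => ?_, fun r hr h => ?_⟩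
    · exact hD.spectralRadius_le hT hr (hrl (h.trans_le (min_le_left _ _)))
        (hD.abs_renewalSeq_sub_le_K0Known hb0 hb1 hb hp hr h)
    · exact hD.optimalConst_le hr (hrl (h.trans_le (min_le_left _ _)))
        (hD.abs_renewalSeq_sub_le_K0Known hb0 hb1 hb hp hr h)
  · intro h
    refine hD.one_le_kendallAlpha0 hb1 ?_
    rw [hc1, measureReal_def, h, ENNReal.toReal_ofReal hb0.le]
  · intro hα0
    have hr0 := hD.one_lt_r0 hb0 hb1 hα0
    refine ⟨hr0, le_ofReal_inv_of_forall_lt hr0 fun r hr h => ?_, fun r hr h => ?_⟩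
    · exact hD.spectralRadius_le hT hr (hrl (h.trans_le (min_le_left _ _)))
        (hD.abs_renewalSeq_sub_le_K0 hb0 hb1 hb hα0 hr h)
    · exact hD.optimalConst_le hr (hrl (h.trans_le (min_le_left _ _)))
        (hD.abs_renewalSeq_sub_le_K0 hb0 hb1 hb hα0 hr h)
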